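/- The $k$-range-medians problem: given an unsorted array $S[1],\ldots,S[n]$ of entries from a linearly ordered set and $k$ (not necessarily disjoint) nonempty intervals $Q_j=[l_j,r_j]\subseteq[1,n]$, find for each $j=1,\ldots,k$ (a position in $Q_j$ of) the median of $S[l_j],\ldots,S[r_j]$, where the median of $m$ entries is the one of rank $\lceil m/2\rceil$. (a) There is a deterministic algorithm that solves the $k$-range-medians problem for all $n,k\ge 1$ in $O(n\log k+k\log k\log n)$ time, where $\log x$ in this bound stands for $\log(x+1)$, so that it does not vanish at $x=1$. More precisely, there are a single program of a word RAM with words of $O(\log(n+k))$ bits and unit-cost operations (addition, truncated subtraction, multiplication, integer division, comparison of words, indirect addressing, branching, procedure calls), which accesses the entries of $S$ only through unit-cost comparisons $S[i]\le S[j]$, and a constant $C$ such that for all $n,k\ge 1$, all arrays $S$ and all queries $Q_1,\ldots,Q_k$, the program outputs the positions of the $k$ medians within $C\,(n\log (k+1)+k\log (k+1)\log (n+1))$ steps. (b) In the comparison model, any algorithm that solves the problem requires $\Omega(n\log k)$ comparisons in the worst case for $2\le k\le n$, even if the intervals are hierarchical. More precisely, there is a constant $c>0$ such that for all $2\le k\le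 n$ there are $k$ distinct intervals $Q_1,\ldots,Q_k\subseteq[1,n]$, any two of which are nested or disjoint, with the following property: every comparison decision tree that outputs correct positions of the medians of $Q_1,\ldots,Q_k$ on every array of $n$ distinct entries performs at least $c\,n\log k$ comparisons on some array of $n$ distinct entries. -/

import Mathlib

universe u

namespace RangeMedians

/-! ## The problem

Array positions and queries are 0-based. A query is a nonempty interval `[fst, snd]` of positions,
`NonemptyInterval (Fin n)`. -/

/-- The set of positions of the array that the query `q` covers. -/
def positions {n : ℕ} (q : NonemptyInterval (Fin n)) : Finset (Fin n) :=
  Finset.Icc q.fst q.snd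

/-- `S[i]` is the median of the entries of `S` in the interval `q`: position `i` lies in `q`, and
`S[i]` is the entry of rank `⌈m/2⌉` (the `⌈m/2⌉`-th smallest, counted with multiplicity) among the
`m` entries of `S` in `q`. -/
def IsMedian {α : Type*} [LinearOrder α] {n : ℕ} (S : Fin n → α)
    (q : NonemptyInterval (Fin n)) (i : Fin n) : Prop :=
  i ∈ positions q ∧
    ((positions q).filter fun j => S j < S i).card < ((positions q).card + 1) / 2 ∧
    ((positions q).card + 1) / 2 ≤ ((positions q).filter fun j => S j ≤ S i).card

/-- Any two of the intervals are nested or disjoint. -/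
def Hierarchical {n k : ℕ} (Q : Fin k → NonemptyInterval (Fin n)) : Prop :=
  ∀ i j, positions (Q i) ⊆ positions (Q j) ∨ positions (Q j) ⊆ positions (Q i) ∨
    Disjoint (positions (Q i)) (positions (Q j))

/-! ## The comparison model: decision trees

For fixed `n` and fixed queries, a comparison-based algorithm is a binary decision tree. An inner
vertex compares two array entries, a leaf holds the answers, given as array positions. -/

/-- Comparison trees on an array of size `n` that answer `k` queries. -/
inductive CompTree (n k : ℕ) : Type
  | output (x : Fin k → Fin n) : CompTree n k
  | compare (i j : Fin n) (yes no : CompTree n k) : CompTree n k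

/-- The answers computed on input `S`. -/
def CompTree.run {α : Type*} [LinearOrder α] {n k : ℕ} (S : Fin n → α) :
    CompTree n k → Fin k → Fin n
  | .output x => x
  | .compare i j yes no => if S i ≤ S j then yes.run S else no.run S

/-- The number of comparisons performed on input `S`. -/
def CompTree.comparisons {α : Type*} [LinearOrder α] {n k : ℕ} (S : Fin n → α) :
    CompTree n k → ℕ
  | .output _ => 0
  | .compare i j yes no => 1 + if S i ≤ S j then yes.comparisons S else no.comparisons S

/-- The tree answers the queries `Q` correctly on every array of `n` distinct entries. -/
def CompTree.Solves {n k : ℕ} (T : CompTree n k) (Q : Fin k → NonemptyInterval (Fin n)) : Prop :=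
  ∀ S : Fin n → ℕ, Function.Injective S → ∀ j, IsMedian S (Q j) (T.run S j)

/-! ## The machine model: a comparison-based word RAM

A program is a fixed finite text that uses finitely many registers and finitely many random-access
arrays of words. Words are natural numbers below a bound `W`. The entries of the input array `S`
are accessible only through comparisons of two entries, given by their positions. Each
operation has unit cost. -/

/-- Word operations. Subtraction is truncated, division rounds down, and `lt` yields `1` or `0`. -/
inductive Op : Type
  | add | sub | mul | div | lt

/-- The result of a word operation. -/
def Op.eval : Op → ℕ → ℕ → ℕ
  | .add, a, b => a + b
  | .sub, a, b => a - b
  | .mul, a, b => a * b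
  | .div, a, b => a / b
  | .lt, a, b => if a < b then 1 else 0

/-- Expressions: constants, registers, array cells, word operations, and the comparison of the
input entries at two positions (`1` if the first is at most the second, otherwise `0`). -/
inductive Expr : Type
  | lit (c : ℕ) : Expr
  | reg (x : ℕ) : Expr
  | cell (a : ℕ) (i : Expr) : Expr
  | op (o : Op) (e₁ e₂ : Expr) : Expr
  | entryLE (i j : Expr) : Expr

/-- Commands. Tests succeed if the value is nonzero. `call p` runs the `p`-th procedure of the
program; procedures have no parameters and no local variables, and they may be recursive. -/
inductive Cmd : Type
  | skip : Cmd
  | assign (x : ℕ) (e : Expr) : Cmd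
  | store (a : ℕ) (i e : Expr) : Cmd
  | seq (c₁ c₂ : Cmd) : Cmd
  | cond (e : Expr) (c₁ c₂ : Cmd) : Cmd
  | loop (e : Expr) (c : Cmd) : Cmd
  | call (p : ℕ) : Cmd

/-- A program: the main command and a finite list of procedure bodies. -/
structure Program : Type where
  main : Cmd
  procs : List Cmd

/-- Contents of the registers `reg x` and of the cells `cell a i` (cell `i` of array `a`). -/
@[ext]
structure State : Type where
  reg : ℕ → ℕ
  cell : ℕ → ℕ → ℕ

/-- The state after writing `v` into register `x`. -/
def State.setReg (s : State) (x v : ℕ) : State :=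
  { s with reg := Function.update s.reg x v }

/-- The state after writing `v` into cell `i` of array `a`. -/
def State.setCell (s : State) (a i v : ℕ) : State :=
  { s with cell := Function.update s.cell a (Function.update (s.cell a) i v) }

/-- The comparison oracle of the input array `S`; it answers `false` on positions that are not
positions of the array. -/
def entryLE {α : Type*} [LinearOrder α] {n : ℕ} (S : Fin n → α) (i j : ℕ) : Bool :=
  if h : i < n ∧ j < n then decide (S ⟨i, h.1⟩ ≤ S ⟨j, h.2⟩) else false

/-- The value of an expression, where `le` is the comparison oracle. -/
def Expr.eval (le : ℕ → ℕ → Bool) (s : State) : Expr → ℕ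
  | .lit c => c
  | .reg x => s.reg x
  | .cell a i => s.cell a (i.eval le s)
  | .op o e₁ e₂ => o.eval (e₁.eval le s) (e₂.eval le s)
  | .entryLE i j => if le (i.eval le s) (j.eval le s) then 1 else 0

/-- All constants in the expression and all results of operations in it are words, that is, less
than `W`. -/
def Expr.Fits (W : ℕ) (le : ℕ → ℕ → Bool) (s : State) : Expr → Prop
  | .lit c => c < W
  | .reg _ => True
  | .cell _ i => i.Fits W le s
  | .op o e₁ e₂ =>
      e₁.Fits W le s ∧ e₂.Fits W le s ∧ o.eval (e₁.eval le s) (e₂.eval le s) < W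
  | .entryLE i j => i.Fits W le s ∧ j.Fits W le s

/-- The cost of evaluating an expression: its number of vertices as a tree. -/
def Expr.cost : Expr → ℕ
  | .lit _ => 1
  | .reg _ => 1
  | .cell _ i => i.cost + 1
  | .op _ e₁ e₂ => e₁.cost + e₂.cost + 1
  | .entryLE i j => i.cost + j.cost + 1

/-- `Exec W le procs c s t s'`: with words below `W`, comparison oracle `le` and procedures `procs`,
the command `c` started in state `s` halts in state `s'` after `t` steps, and no word overflows on
the way. -/
inductive Exec (W : ℕ) (le : ℕ → ℕ → Bool) (procs : List Cmd) :
    Cmd → State → ℕ → State → Prop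
  | skip (s : State) : Exec W le procs .skip s 1 s
  | assign (x : ℕ) (e : Expr) (s : State) (he : e.Fits W le s) :
      Exec W le procs (.assign x e) s (e.cost + 1) (s.setReg x (e.eval le s))
  | store (a : ℕ) (i e : Expr) (s : State) (hi : i.Fits W le s) (he : e.Fits W le s) :
      Exec W le procs (.store a i e) s (i.cost + e.cost + 1)
        (s.setCell a (i.eval le s) (e.eval le s))
  | seq {c₁ c₂ : Cmd} {s s₁ s₂ : State} {t₁ t₂ : ℕ}
      (h₁ : Exec W le procs c₁ s t₁ s₁) (h₂ : Exec W le procs c₂ s₁ t₂ s₂) :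
      Exec W le procs (.seq c₁ c₂) s (t₁ + t₂) s₂
  | cond_true {e : Expr} {c₁ c₂ : Cmd} {s s' : State} {t : ℕ} (he : e.Fits W le s)
      (hne : e.eval le s ≠ 0) (h : Exec W le procs c₁ s t s') :
      Exec W le procs (.cond e c₁ c₂) s (e.cost + 1 + t) s'
  | cond_false {e : Expr} {c₁ c₂ : Cmd} {s s' : State} {t : ℕ} (he : e.Fits W le s)
      (heq : e.eval le s = 0) (h : Exec W le procs c₂ s t s') :
      Exec W le procs (.cond e c₁ c₂) s (e.cost + 1 + t) s'
  | loop_true {e : Expr} {c : Cmd} {s s₁ s₂ : State} {t₁ t₂ : ℕ} (he : e.Fits W le s)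
      (hne : e.eval le s ≠ 0) (h₁ : Exec W le procs c s t₁ s₁)
      (h₂ : Exec W le procs (.loop e c) s₁ t₂ s₂) :
      Exec W le procs (.loop e c) s (e.cost + 1 + t₁ + t₂) s₂
  | loop_false {e : Expr} {c : Cmd} {s : State} (he : e.Fits W le s) (heq : e.eval le s = 0) :
      Exec W le procs (.loop e c) s (e.cost + 1) s
  | call {p : ℕ} {c : Cmd} {s s' : State} {t : ℕ} (hp : procs[p]? = some c)
      (h : Exec W le procs c s t s') :
      Exec W le procs (.call p) s (1 + t) s'

/-- The initial state: registers `0` and `1` hold `n` and `k`, arrays `0` and `1` hold the left and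
the right endpoints of the `k` queries, and everything else is `0`. -/
def initState {n k : ℕ} (Q : Fin k → NonemptyInterval (Fin n)) : State where
  reg x := if x = 0 then n else if x = 1 then k else 0
  cell a j :=
    if h : j < k then
      if a = 0 then ((Q ⟨j, h⟩).fst : ℕ) else if a = 1 then ((Q ⟨j, h⟩).snd : ℕ) else 0
    else 0

/-- On the array `S` and the queries `Q`, with words below `W`, the program halts within `t` steps,
and then array `2` holds, for each query, a position of the median of its interval. -/
def Program.SolvesWithin {α : Type*} [LinearOrder α] {n k : ℕ} (P : Program) (W : ℕ)
    (S : Fin n → α) (Q : Fin k → NonemptyInterval (Fin n)) (t : ℝ) : Prop :=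
  ∃ (T : ℕ) (s : State), Exec W (entryLE S) P.procs P.main (initState Q) T s ∧ (T : ℝ) ≤ t ∧
    ∀ j : Fin k, ∃ i : Fin n, s.cell 2 j = i ∧ IsMedian S (Q j) i

end RangeMedians

/-! Upper bound. Let `L` be the binary logarithm of `k`, rounded up. Ties are broken by positions,
so the entries have distinct keys `v`. Linear-time selection halves the array, then the halves, and
so on for `L` levels. This cuts the sorted order into `2 ^ L` buckets of at most `m = n / 2 ^ L + 1`
elements in `O(n * L)` time, without sorting inside the buckets (`sortBlocks_spec`).

Each query is then led to the bucket that contains its median, as in a wavelet matrix. The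
positions, in their original order, are stably partitioned by one binary digit of the bucket number
after the other, from the highest. Prefix counts of the zero digits tell where the window of a query
goes, and how many of its elements have digit zero; comparing this number with the target rank
decides which part contains the median (`Narrowed.step`). A level costs `O(n + k)`. In the end the
window of a query consists of the elements of its interval in one bucket, at most `m` of them, and
one selection finishes (`Narrowed.exists_selected`). As `k * m ≤ n + k`, the total is `O((L + 1) *
(n + k))`, which is within the claimed bound.

Selection takes as pivot the median of the medians of three of medians of three. It has at least two
ninths of the elements on either side (`four_mul_cnt_le`), up to rounding, so the two recursive
calls work on at most `1/9 + 7/9 < 1` of the input, and the time is linear (`select_spec`).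

Lower bound. A correct tree must learn, for each query and each element of the interval, on which
side of the median the element lies: otherwise element and median can be made adjacent in two linear
extensions that differ in their order only, the output is the same, but the rank of the median
changes (`CompTree.Solves.not_lt_of_path_eq`). Take suffixes as queries, on inputs with small
entries, then `s * κ` medium ones in unknown order, then large ones. The suffixes are chosen so that
their medians are the medium entries of ranks `s, 2 * s, …`. The tree thus learns the class of each
medium entry among `κ` classes of consecutive ranks. A family of `κ.factorial ^ s` inputs with
different classes forces as many leaves (`exists_hard_queries`), hence a height of order `s * κ *
log κ`, which is of order `n * log k`. -/

namespace RangeMedians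

/-! ## Time-bounded execution -/

/-- Started in `s`, the command halts within `T` steps in a state that satisfies `Q`. -/
def Runs (W : ℕ) (le : ℕ → ℕ → Bool) (procs : List Cmd) (c : Cmd) (s : State) (T : ℕ)
    (Q : State → Prop) : Prop :=
  ∃ t s', Exec W le procs c s t s' ∧ t ≤ T ∧ Q s'

section Rules

variable {W : ℕ} {le : ℕ → ℕ → Bool} {procs : List Cmd}

theorem Runs.mono {c : Cmd} {s : State} {T T' : ℕ} {Q Q' : State → Prop}
    (h : Runs W le procs c s T Q) (hT : T ≤ T') (hQ : ∀ s', Q s' → Q' s') :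
    Runs W le procs c s T' Q' := by
  obtain ⟨t, s', he, ht, hq⟩ := h
  exact ⟨t, s', he, ht.trans hT, hQ _ hq⟩

theorem Runs.seq {c₁ c₂ : Cmd} {s : State} {T₁ T₂ T : ℕ} {Q R : State → Prop}
    (h₁ : Runs W le procs c₁ s T₁ R) (h₂ : ∀ s', R s' → Runs W le procs c₂ s' T₂ Q)
    (hT : T₁ + T₂ ≤ T) : Runs W le procs (.seq c₁ c₂) s T Q := by
  obtain ⟨t₁, s₁, e₁, ht₁, hr⟩ := h₁
  obtain ⟨t₂, s₂, e₂, ht₂, hq⟩ := h₂ s₁ hr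
  exact ⟨_, _, .seq e₁ e₂, by omega, hq⟩

theorem Runs.cond {e : Expr} {c₁ c₂ : Cmd} {s : State} {T T' : ℕ} {Q : State → Prop}
    (he : e.Fits W le s) (h₁ : e.eval le s ≠ 0 → Runs W le procs c₁ s T Q)
    (h₂ : e.eval le s = 0 → Runs W le procs c₂ s T Q) (hT : e.cost + 1 + T ≤ T') :
    Runs W le procs (.cond e c₁ c₂) s T' Q := by
  by_cases h : e.eval le s = 0
  · obtain ⟨t, s', h', ht, hq⟩ := h₂ h
    exact ⟨_, _, .cond_false he h h', by omega, hq⟩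
  · obtain ⟨t, s', h', ht, hq⟩ := h₁ h
    exact ⟨_, _, .cond_true he h h', by omega, hq⟩

theorem Runs.call {p : ℕ} {c : Cmd} {s : State} {T T' : ℕ} {Q : State → Prop}
    (hp : procs[p]? = some c) (h : Runs W le procs c s T Q) (hT : T + 1 ≤ T') :
    Runs W le procs (.call p) s T' Q := by
  obtain ⟨t, s', h', ht, hq⟩ := h
  exact ⟨_, _, .call hp h', by omega, hq⟩

/-- Loop rule. The invariant carries the remaining time budget. -/
theorem Runs.loop {e : Expr} {c : Cmd} {Q : State → Prop} (I : ℕ → State → Prop)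
    (hfit : ∀ b s, I b s → e.Fits W le s)
    (hstep : ∀ b s, I b s → e.eval le s ≠ 0 →
      ∃ b' t, e.cost + 1 + t + b' ≤ b ∧ Runs W le procs c s t (I b'))
    (hend : ∀ b s, I b s → e.eval le s = 0 → e.cost + 1 ≤ b ∧ Q s)
    (b : ℕ) (s : State) (hI : I b s) : Runs W le procs (.loop e c) s b Q := by
  -- Every round pays for its test, so the remaining budget strictly decreases, and termination
  -- needs no separate measure.
  induction b using Nat.strong_induction_on generalizing s with
  | _ b ih =>
    by_cases h : e.eval le s = 0
    · obtain ⟨hb, hq⟩ := hend b s hI h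
      exact ⟨_, _, .loop_false (hfit b s hI) h, hb, hq⟩
    · obtain ⟨b', t, hb, t₁, s₁, e₁, ht₁, hI'⟩ := hstep b s hI h
      obtain ⟨t₂, s₂, e₂, ht₂, hq⟩ := ih b' (by omega) s₁ hI'
      exact ⟨_, _, .loop_true (hfit b s hI) h e₁ e₂, by omega, hq⟩

/-! ### Straight-line code -/

/-- The effect of a command without loops and calls. -/
def Cmd.sem (le : ℕ → ℕ → Bool) : Cmd → State → State
  | .skip, s => s
  | .assign x e, s => s.setReg x (e.eval le s)
  | .store a i e, s => s.setCell a (i.eval le s) (e.eval le s)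
  | .seq c₁ c₂, s => c₂.sem le (c₁.sem le s)
  | .cond e c₁ c₂, s => if e.eval le s = 0 then c₂.sem le s else c₁.sem le s
  | .loop _ _, s => s
  | .call _, s => s

/-- The command has no loops and no calls, and no word overflows. -/
def Cmd.Ok (W : ℕ) (le : ℕ → ℕ → Bool) : Cmd → State → Prop
  | .skip, _ => True
  | .assign _ e, s => e.Fits W le s
  | .store _ i e, s => i.Fits W le s ∧ e.Fits W le s
  | .seq c₁ c₂, s => c₁.Ok W le s ∧ c₂.Ok W le (c₁.sem le s)
  | .cond e c₁ c₂, s => e.Fits W le s ∧ (e.eval le s = 0 → c₂.Ok W le s) ∧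
      (e.eval le s ≠ 0 → c₁.Ok W le s)
  | .loop _ _, _ => False
  | .call _, _ => False

/-- A bound on the running time of a command without loops and calls. -/
def Cmd.scost : Cmd → ℕ
  | .skip => 1
  | .assign _ e => e.cost + 1
  | .store _ i e => i.cost + e.cost + 1
  | .seq c₁ c₂ => c₁.scost + c₂.scost
  | .cond e c₁ c₂ => e.cost + 1 + (c₁.scost + c₂.scost)
  | .loop _ _ => 0
  | .call _ => 0

/-- Straight-line code is executed symbolically: `simp` computes the final state, the overflow
conditions and the cost. The cost of a conditional counts both branches, which is crude but
independent of the state. -/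
theorem Runs.straight {c : Cmd} {s : State} {T : ℕ} {Q : State → Prop} (hok : c.Ok W le s)
    (hT : c.scost ≤ T) (hQ : Q (c.sem le s)) : Runs W le procs c s T Q := by
  suffices h : ∀ (c : Cmd) (s : State), c.Ok W le s →
      ∃ t, Exec W le procs c s t (c.sem le s) ∧ t ≤ c.scost by
    obtain ⟨t, he, ht⟩ := h c s hok
    exact ⟨t, _, he, ht.trans hT, hQ⟩
  clear hok hT hQ s c T Q
  intro c
  induction c with
  | skip => exact fun s _ => ⟨_, .skip s, le_rfl⟩
  | assign x e => exact fun s h => ⟨_, .assign x e s h, le_rfl⟩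
  | store a i e => exact fun s h => ⟨_, .store a i e s h.1 h.2, le_rfl⟩
  | seq c₁ c₂ ih₁ ih₂ =>
    intro s h
    obtain ⟨t₁, e₁, h₁⟩ := ih₁ s h.1
    obtain ⟨t₂, e₂, h₂⟩ := ih₂ _ h.2
    exact ⟨_, .seq e₁ e₂, Nat.add_le_add h₁ h₂⟩
  | cond e c₁ c₂ ih₁ ih₂ =>
    intro s h
    simp only [Cmd.sem, Cmd.scost]
    split_ifs with h0
    · obtain ⟨t, e, ht⟩ := ih₂ s (h.2.1 h0)
      exact ⟨_, .cond_false h.1 h0 e, by omega⟩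
    · obtain ⟨t, e, ht⟩ := ih₁ s (h.2.2 h0)
      exact ⟨_, .cond_true h.1 h0 e, by omega⟩
  | loop e c => exact fun s h => h.elim
  | call p => exact fun s h => h.elim

/-! ### Frames -/

/-- The command writes only registers in `R` and arrays in `X`, and contains calls only if `P`. -/
def Cmd.Writes (R X : List ℕ) (P : Prop) : Cmd → Prop
  | .skip => True
  | .assign x _ => x ∈ R
  | .store a _ _ => a ∈ X
  | .seq c₁ c₂ => c₁.Writes R X P ∧ c₂.Writes R X P
  | .cond _ c₁ c₂ => c₁.Writes R X P ∧ c₂.Writes R X P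
  | .loop _ c => c.Writes R X P
  | .call _ => P

/-- The two states agree outside the registers `R` and the arrays `X`. -/
structure Frame (R X : List ℕ) (s s' : State) : Prop where
  reg : ∀ x, x ∉ R → s'.reg x = s.reg x
  cell : ∀ a, a ∉ X → s'.cell a = s.cell a

theorem Frame.refl (R X : List ℕ) (s : State) : Frame R X s s := ⟨fun _ _ => rfl, fun _ _ => rfl⟩

theorem Frame.trans {R X : List ℕ} {s s' s'' : State} (h : Frame R X s s') (h' : Frame R X s' s'') :
    Frame R X s s'' :=
  ⟨fun x hx => (h'.reg x hx).trans (h.reg x hx), fun a ha => (h'.cell a ha).trans (h.cell a ha)⟩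

/-- Induction on the execution rather than on the command, so that recursive procedures are covered.
The parameter `P` says whether calls are allowed; if they are not, nothing is asked of the
procedures. -/
theorem Exec.frame {R X : List ℕ} {P : Prop} {c : Cmd} {s s' : State} {t : ℕ}
    (h : Exec W le procs c s t s') (hP : P → ∀ c ∈ procs, c.Writes R X P)
    (hc : c.Writes R X P) : Frame R X s s' := by
  induction h with
  | skip s => exact .refl _ _ _
  | assign x e s he =>
    refine ⟨fun y hy => ?_, fun _ _ => rfl⟩
    have : y ≠ x := fun h => hy (h ▸ hc)
    simp [State.setReg, Function.update_of_ne this]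
  | store a i e s hi he =>
    refine ⟨fun _ _ => rfl, fun b hb => ?_⟩
    have : b ≠ a := fun h => hb (h ▸ hc)
    simp [State.setCell, Function.update_of_ne this]
  | seq h₁ h₂ ih₁ ih₂ => exact (ih₁ hc.1).trans (ih₂ hc.2)
  | cond_true he hne h ih => exact ih hc.1
  | cond_false he hne h ih => exact ih hc.2
  | loop_true he hne h₁ h₂ ih₁ ih₂ => exact (ih₁ hc).trans (ih₂ hc)
  | loop_false he h => exact .refl _ _ _
  | call hp h ih => exact ih (hP hc _ (List.mem_of_getElem? hp))

theorem Runs.frame {c : Cmd} {s : State} {T : ℕ} {Q : State → Prop}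
    (h : Runs W le procs c s T Q) (R X : List ℕ) (P : Prop)
    (hP : P → ∀ c ∈ procs, c.Writes R X P) (hc : c.Writes R X P) :
    Runs W le procs c s T (fun s' => Q s' ∧ Frame R X s s') := by
  obtain ⟨t, s', he, ht, hq⟩ := h
  exact ⟨t, s', he, ht, hq, he.frame hP hc⟩

/-! ### State updates -/

@[simp] theorem State.setReg_reg (s : State) (x v y : ℕ) :
    (s.setReg x v).reg y = if y = x then v else s.reg y := by
  simp [State.setReg, Function.update_apply]

@[simp] theorem State.setReg_cell (s : State) (x v : ℕ) : (s.setReg x v).cell = s.cell := rfl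

@[simp] theorem State.setCell_reg (s : State) (a i v : ℕ) : (s.setCell a i v).reg = s.reg := rfl

@[simp] theorem State.setCell_cell (s : State) (a i v b : ℕ) :
    (s.setCell a i v).cell b = if b = a then Function.update (s.cell a) i v else s.cell b := by
  simp [State.setCell, Function.update_apply]

/-! ### Counting loops -/

/-- Runs `c` while register `x`, incremented after each round, is less than register `y`. -/
def Cmd.upto (x y : ℕ) (c : Cmd) : Cmd :=
  .loop (.op .lt (.reg x) (.reg y)) (.seq c (.assign x (.op .add (.reg x) (.lit 1))))

/-- Rule for counting loops. The time of the rounds may vary. -/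
theorem Runs.upto {x y : ℕ} {c : Cmd} {s : State} {a N : ℕ} (R X : List ℕ) (P : Prop)
    (I : ℕ → State → Prop) (K : ℕ) {T : ℕ} {Q : State → Prop}
    (hP : P → ∀ c ∈ procs, c.Writes R X P) (hc : c.Writes R X P) (hx : x ∉ R) (hy : y ∉ R)
    (hxy : y ≠ x) (hW : N + 1 < W) (hsx : s.reg x = a) (hsy : s.reg y = N) (haN : a ≤ N)
    (h0 : I a s)
    (hstep : ∀ i s', a ≤ i → i < N → s'.reg x = i → I i s' → Frame (x :: R) X s s' →
      Runs W le procs c s' K (fun s'' => I (i + 1) (s''.setReg x (i + 1))))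
    (hT : (N - a) * (K + 8) + 4 ≤ T)
    (hQ : ∀ s', I N s' → s'.reg x = N → Frame (x :: R) X s s' → Q s') :
    Runs W le procs (.upto x y c) s T Q := by
  refine Runs.mono (Runs.loop (Q := Q) (fun b s' => ∃ i, a ≤ i ∧ i ≤ N ∧ s'.reg x = i ∧ I i s' ∧
    Frame (x :: R) X s s' ∧ b = (N - i) * (K + 8) + 4) ?_ ?_ ?_ ((N - a) * (K + 8) + 4) s
      ⟨a, le_rfl, haN, hsx, h0, .refl _ _ _, rfl⟩) hT fun _ h => h
  · rintro b s' ⟨i, -, -, -, -, -, -⟩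
    simp only [Expr.Fits, true_and, Op.eval]
    split_ifs <;> omega
  · rintro b s' ⟨i, hai, hiN, hi, hI, hF, rfl⟩ hne
    have hyN : s'.reg y = N := by rw [hF.reg y (by simp [hy, hxy]), hsy]
    have hlt : i < N := by
      by_contra hcon
      simp [Expr.eval, Op.eval, hi, hyN, hcon] at hne
    obtain ⟨t, s₁, he, ht, hI₁, hF₁⟩ := (hstep i s' hai hlt hi hI hF).frame R X P hP hc
    have hx₁ : s₁.reg x = i := by rw [hF₁.reg x hx, hi]
    refine ⟨(N - (i + 1)) * (K + 8) + 4, K + 4, ?_, t + 4, _,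
      .seq he (.assign x _ s₁ ?_), by omega, i + 1, by omega, hlt, ?_, ?_, ?_, rfl⟩
    -- Each round has an overhead of 8: 4 for the test and 4 for the increment. The last failing
    -- test costs the additional 4.
    · have : N - i = N - (i + 1) + 1 := by omega
      rw [this, add_mul]
      simp only [Expr.cost]
      omega
    · simp only [Expr.Fits, Expr.eval, Op.eval, hx₁, true_and]
      omega
    · simp [Expr.eval, Op.eval, hx₁]
    · simpa [Expr.eval, Op.eval, hx₁] using hI₁
    · refine hF.trans ⟨fun z hz => ?_, fun b hb => hF₁.cell b hb⟩
      simp only [List.mem_cons, not_or] at hz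
      simp [hz.1, hF₁.reg z hz.2]
  · rintro b s' ⟨i, hai, hiN, hi, hI, hF, rfl⟩ h0
    have hyN : s'.reg y = N := by rw [hF.reg y (by simp [hy, hxy]), hsy]
    have : i = N := by
      by_contra hcon
      have : i < N := by omega
      simp [Expr.eval, Op.eval, hi, hyN, this] at h0
    subst this
    exact ⟨by simp [Expr.cost], hQ _ hI hi hF⟩

/-- A counting loop that stores `g i` at index `f i` of array `r` in round `i`. -/
theorem Runs.fill {x y r : ℕ} {ei ev : Expr} {s : State} {N : ℕ} (f g : ℕ → ℕ)
    {T : ℕ} {Q : State → Prop} (hxy : y ≠ x) (hW : N + 1 < W) (hsx : s.reg x = 0)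
    (hsy : s.reg y = N) (hf : Set.InjOn f (Set.Iio N))
    (hev : ∀ i s', i < N → s'.reg x = i → Frame [x] [r] s s' →
      ei.Fits W le s' ∧ ev.Fits W le s' ∧ ei.eval le s' = f i ∧ ev.eval le s' = g i)
    (hT : N * (ei.cost + ev.cost + 9) + 4 ≤ T)
    (hQ : ∀ s', (∀ i < N, s'.cell r (f i) = g i) → s'.reg x = N → Frame [x] [r] s s' → Q s') :
    Runs W le procs (.upto x y (.store r ei ev)) s T Q := by
  refine Runs.upto (N := N) (a := 0) [] [r] False (fun i s' => ∀ j < i, s'.cell r (f j) = g j)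
    (ei.cost + ev.cost + 1) (fun h => h.elim) (by simp [Cmd.Writes]) (by simp) (by simp) hxy hW hsx
    hsy (Nat.zero_le _) (by simp) ?_ (by simpa using hT) hQ
  intro i s' _ hi hx hI hF
  obtain ⟨h1, h2, h3, h4⟩ := hev i s' hi hx hF
  refine Runs.straight ⟨h1, h2⟩ (by simp [Cmd.scost]) ?_
  intro j hj
  simp only [Cmd.sem, h3, h4, State.setReg_cell, State.setCell_cell, if_true]
  rcases Nat.lt_succ_iff_lt_or_eq.1 hj with hj | rfl
  · rw [Function.update_of_ne, hI j hj]
    exact fun h => hj.ne (hf (Set.mem_Iio.2 (hj.trans hi)) (Set.mem_Iio.2 hi) h)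
  · simp

end Rules

/-! ## Permutations of a window -/

/-- The permutation moves only elements of `[lo, hi)`. -/
def SupportedOn (σ : Equiv.Perm ℕ) (lo hi : ℕ) : Prop := ∀ i, i < lo ∨ hi ≤ i → σ i = i

namespace SupportedOn

variable {σ τ : Equiv.Perm ℕ} {lo hi : ℕ}

theorem one (lo hi : ℕ) : SupportedOn 1 lo hi := fun _ _ => rfl

theorem mul (h : SupportedOn σ lo hi) (h' : SupportedOn τ lo hi) : SupportedOn (σ * τ) lo hi :=
  fun i hi => by rw [Equiv.Perm.mul_apply, h' i hi, h i hi]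

theorem mono {lo' hi' : ℕ} (h : SupportedOn σ lo hi) (hl : lo' ≤ lo) (hh : hi ≤ hi') :
    SupportedOn σ lo' hi' := fun i hi => h i (by omega)

theorem swap {i j : ℕ} (hi₁ : lo ≤ i) (hi₂ : i < hi) (hj₁ : lo ≤ j) (hj₂ : j < hi) :
    SupportedOn (Equiv.swap i j) lo hi :=
  fun l hl => Equiv.swap_apply_of_ne_of_ne (by omega) (by omega)

theorem mem (h : SupportedOn σ lo hi) {i : ℕ} (h₁ : lo ≤ i) (h₂ : i < hi) :
    lo ≤ σ i ∧ σ i < hi := by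
  by_contra hcon
  have : σ (σ i) = σ i := h (σ i) (by omega)
  have := σ.injective this
  omega

theorem symm (h : SupportedOn σ lo hi) : SupportedOn σ⁻¹ lo hi := fun i hi => by
  rw [Equiv.Perm.inv_eq_iff_eq, h i hi]

end SupportedOn

/-- The cells of the window `[lo, hi)` hold positions below `n`, all distinct. -/
structure GoodWindow (n : ℕ) (A : ℕ → ℕ) (lo hi : ℕ) : Prop where
  lt : ∀ i, lo ≤ i → i < hi → A i < n
  inj : ∀ i j, lo ≤ i → i < hi → lo ≤ j → j < hi → A i = A j → i = j

theorem GoodWindow.mono {n : ℕ} {A : ℕ → ℕ} {lo hi lo' hi' : ℕ} (h : GoodWindow n A lo hi)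
    (hl : lo ≤ lo') (hh : hi' ≤ hi) : GoodWindow n A lo' hi' :=
  ⟨fun i h₁ h₂ => h.lt i (by omega) (by omega),
   fun i j h₁ h₂ h₃ h₄ => h.inj i j (by omega) (by omega) (by omega) (by omega)⟩

theorem GoodWindow.comp {n : ℕ} {A : ℕ → ℕ} {lo hi : ℕ} {σ : Equiv.Perm ℕ}
    (h : GoodWindow n A lo hi) (hσ : SupportedOn σ lo hi) : GoodWindow n (A ∘ σ) lo hi := by
  refine ⟨fun i h₁ h₂ => h.lt _ (hσ.mem h₁ h₂).1 (hσ.mem h₁ h₂).2, fun i j h₁ h₂ h₃ h₄ he => ?_⟩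
  exact σ.injective (h.inj _ _ (hσ.mem h₁ h₂).1 (hσ.mem h₁ h₂).2 (hσ.mem h₃ h₄).1
    (hσ.mem h₃ h₄).2 he)

/-! ## Counting in windows -/

open Classical in
/-- The number of elements of `[a, b)` with property `p`. -/
noncomputable def cnt (p : ℕ → Prop) (a b : ℕ) : ℕ := ((Finset.Ico a b).filter p).card

theorem cnt_mono {p q : ℕ → Prop} {a b a' b' : ℕ} (ha : a' ≤ a) (hb : b ≤ b')
    (hpq : ∀ i, a ≤ i → i < b → p i → q i) : cnt p a b ≤ cnt q a' b' := by
  classical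
  refine Finset.card_le_card fun i hi => ?_
  simp only [Finset.mem_filter, Finset.mem_Ico] at hi ⊢
  exact ⟨by omega, hpq i hi.1.1 hi.1.2 hi.2⟩

theorem cnt_congr {p q : ℕ → Prop} {a b : ℕ} (hpq : ∀ i, a ≤ i → i < b → (p i ↔ q i)) :
    cnt p a b = cnt q a b :=
  le_antisymm (cnt_mono le_rfl le_rfl fun i h₁ h₂ => (hpq i h₁ h₂).1)
    (cnt_mono le_rfl le_rfl fun i h₁ h₂ => (hpq i h₁ h₂).2)

theorem cnt_true (a b : ℕ) : cnt (fun _ => True) a b = b - a := by simp [cnt]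

theorem cnt_add (p : ℕ → Prop) {a b c : ℕ} (hab : a ≤ b) (hbc : b ≤ c) :
    cnt p a b + cnt p b c = cnt p a c := by
  classical
  rw [cnt, cnt, cnt, ← Finset.card_union_of_disjoint, ← Finset.filter_union,
    Finset.Ico_union_Ico_eq_Ico hab hbc]
  exact Finset.disjoint_filter_filter (Finset.Ico_disjoint_Ico_consecutive a b c)

theorem cnt_shift (p : ℕ → Prop) (a b h : ℕ) : cnt (fun i => p (i + h)) a b = cnt p (a + h) (b + h) := by
  classical
  refine Finset.card_bij (fun i _ => i + h) ?_ ?_ ?_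
  · intro i hi
    simp only [Finset.mem_filter, Finset.mem_Ico] at hi ⊢
    exact ⟨by omega, hi.2⟩
  · intro i _ j _ hij
    exact Nat.add_right_cancel hij
  · intro j hj
    simp only [Finset.mem_filter, Finset.mem_Ico] at hj
    refine ⟨j - h, ?_, by omega⟩
    simp only [Finset.mem_filter, Finset.mem_Ico]
    refine ⟨by omega, ?_⟩
    rw [Nat.sub_add_cancel (by omega)]
    exact hj.2

theorem cnt_perm (p : ℕ → Prop) {a b : ℕ} {σ : Equiv.Perm ℕ} (hσ : SupportedOn σ a b) :
    cnt (fun i => p (σ i)) a b = cnt p a b := by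
  classical
  refine Finset.card_bij (fun i _ => σ i) ?_ ?_ ?_
  · intro i hi
    simp only [Finset.mem_filter, Finset.mem_Ico] at hi ⊢
    exact ⟨hσ.mem hi.1.1 hi.1.2, hi.2⟩
  · intro i _ j _ hij
    exact σ.injective hij
  · intro j hj
    simp only [Finset.mem_filter, Finset.mem_Ico] at hj
    refine ⟨σ⁻¹ j, ?_, by simp⟩
    simp only [Finset.mem_filter, Finset.mem_Ico]
    exact ⟨hσ.symm.mem hj.1.1 hj.1.2, by simpa using hj.2⟩

/-- Each element of the middle row with the property has a partner above it in its column, and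
distinct columns have distinct partners. -/
theorem two_mul_cnt_le_of_low {p : ℕ → Prop} {a h : ℕ}
    (hp : ∀ j < h, p (a + h + j) → p (a + j)) :
    2 * cnt p (a + h) (a + 2 * h) ≤ cnt p a (a + 3 * h) := by
  have h₁ : cnt p (a + h) (a + 2 * h) ≤ cnt p a (a + h) := by
    rw [show a + 2 * h = a + h + h by ring, ← cnt_shift]
    refine cnt_mono le_rfl le_rfl fun i h₁ h₂ hi => ?_
    have := hp (i - a) (by omega)
    rw [show a + h + (i - a) = i + h by omega, show a + (i - a) = i by omega] at this
    exact this hi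
  have h₂ := cnt_add p (show a ≤ a + h by omega) (show a + h ≤ a + 2 * h by omega)
  have h₃ : cnt p a (a + 2 * h) ≤ cnt p a (a + 3 * h) :=
    cnt_mono le_rfl (by omega) fun _ _ _ h => h
  omega

theorem two_mul_cnt_le_of_high {p : ℕ → Prop} {a h : ℕ}
    (hp : ∀ j < h, p (a + h + j) → p (a + 2 * h + j)) :
    2 * cnt p (a + h) (a + 2 * h) ≤ cnt p a (a + 3 * h) := by
  have h₁ : cnt p (a + h) (a + 2 * h) ≤ cnt p (a + 2 * h) (a + 3 * h) := by
    rw [show a + 2 * h = a + h + h by ring, show a + 3 * h = a + h + h + h by ring,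
      ← cnt_shift p (a + h) (a + h + h)]
    refine cnt_mono le_rfl le_rfl fun i h₁ h₂ hi => ?_
    have := hp (i - (a + h)) (by omega)
    rw [show a + h + (i - (a + h)) = i by omega,
      show a + 2 * h + (i - (a + h)) = i + h by omega] at this
    exact this hi
  have h₂ := cnt_add p (show a + h ≤ a + 2 * h by omega) (show a + 2 * h ≤ a + 3 * h by omega)
  have h₃ : cnt p (a + h) (a + 3 * h) ≤ cnt p a (a + 3 * h) :=
    cnt_mono (by omega) le_rfl fun _ _ _ h => h
  omega

/-- If the median of three rows is in the middle row, twice over, then every property that is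
inherited by all smaller or by all greater elements holds for at least four times as many elements
as in the middle ninth. -/
theorem four_mul_cnt_le {w : ℕ → ℕ} {σ τ : Equiv.Perm ℕ} {lo hi h g : ℕ} {p : ℕ → Prop}
    (hh : 3 * h ≤ hi - lo) (hg : 3 * g ≤ h) (hlo : lo ≤ hi)
    (hw : ∀ j < h, w (lo + j) ≤ w (lo + h + j) ∧ w (lo + h + j) ≤ w (lo + 2 * h + j))
    (hσ : SupportedOn σ (lo + h) (lo + h + 3 * g))
    (hw' : ∀ j < g, w (σ (lo + h + j)) ≤ w (σ (lo + h + g + j)) ∧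
      w (σ (lo + h + g + j)) ≤ w (σ (lo + h + 2 * g + j)))
    (hτ : SupportedOn τ (lo + h + g) (lo + h + 2 * g))
    (hp : (∀ x y, x ≤ y → p y → p x) ∨ (∀ x y, x ≤ y → p x → p y)) :
    4 * cnt (fun i => p (w (σ (τ i)))) (lo + h + g) (lo + h + 2 * g) ≤
      cnt (fun i => p (w (σ (τ i)))) lo hi := by
  have hτ' : SupportedOn τ lo hi := hτ.mono (by omega) (by omega)
  have hσ' : SupportedOn σ lo hi := hσ.mono (by omega) (by omega)
  -- Rearrangements inside a range do not change counts over it, so each factor 2 may be shown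
  -- before the later rearrangements.
  rw [cnt_perm (fun i => p (w (σ i))) hτ, cnt_perm (fun i => p (w (σ i))) hτ',
    cnt_perm (fun i => p (w i)) hσ']
  have h₁ : 2 * cnt (fun i => p (w (σ i))) (lo + h + g) (lo + h + 2 * g) ≤
      cnt (fun i => p (w (σ i))) (lo + h) (lo + h + 3 * g) := by
    rcases hp with hp | hp
    · exact two_mul_cnt_le_of_low fun j hj => hp _ _ (hw' j hj).1
    · exact two_mul_cnt_le_of_high fun j hj => hp _ _ (hw' j hj).2
  have h₂ : 2 * cnt (fun i => p (w i)) (lo + h) (lo + 2 * h) ≤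
      cnt (fun i => p (w i)) lo (lo + 3 * h) := by
    rcases hp with hp | hp
    · exact two_mul_cnt_le_of_low fun j hj => hp _ _ (hw j hj).1
    · exact two_mul_cnt_le_of_high fun j hj => hp _ _ (hw j hj).2
  rw [cnt_perm (fun i => p (w i)) hσ] at h₁
  have h₃ : cnt (fun i => p (w i)) (lo + h) (lo + h + 3 * g) ≤
      cnt (fun i => p (w i)) (lo + h) (lo + 2 * h) :=
    cnt_mono le_rfl (by omega) fun _ _ _ h => h
  have h₄ : cnt (fun i => p (w i)) lo (lo + 3 * h) ≤ cnt (fun i => p (w i)) lo hi :=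
    cnt_mono le_rfl (by omega) fun _ _ _ h => h
  omega

infixr:60 " ;; " => Cmd.seq

/-! ## Comparison of keys -/

/-- Tests whether the first position has the smaller key, where ties between equal entries are
broken by the positions. -/
def Expr.keyLT (i j : Expr) : Expr :=
  .op .add (.op .mul (.op .lt i j) (.entryLE i j))
    (.op .mul (.op .sub (.lit 1) (.op .lt i j)) (.op .sub (.lit 1) (.entryLE j i)))

/-- The keys `v` of the positions below `n` are distinct, and the oracle, with ties broken by the
positions, compares them. -/
structure Compares (n : ℕ) (le : ℕ → ℕ → Bool) (v : ℕ → ℕ) : Prop where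
  lt_iff : ∀ i j, i < n → j < n → ((if i < j then le i j else !le j i) = true ↔ v i < v j)
  inj : ∀ i j, i < n → j < n → v i = v j → i = j

/-- One of the two products vanishes, according to the order of the positions. The other one is a
single answer of the oracle, negated by truncated subtraction from 1 where necessary. -/
theorem Expr.eval_keyLT {n : ℕ} {le : ℕ → ℕ → Bool} {v : ℕ → ℕ} (hv : Compares n le v) {s : State}
    {e₁ e₂ : Expr} (h₁ : e₁.eval le s < n) (h₂ : e₂.eval le s < n) :
    (Expr.keyLT e₁ e₂).eval le s = if v (e₁.eval le s) < v (e₂.eval le s) then 1 else 0 := by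
  have := hv.lt_iff _ _ h₁ h₂
  simp only [Expr.keyLT, Expr.eval, Op.eval]
  by_cases h : e₁.eval le s < e₂.eval le s
  · simp only [h, if_true] at this ⊢
    simp [← this]
  · simp only [h, if_false] at this ⊢
    simp only [← this]
    cases le (e₂.eval le s) (e₁.eval le s) <;> simp

theorem Expr.fits_keyLT {W : ℕ} {le : ℕ → ℕ → Bool} {s : State} {e₁ e₂ : Expr} (hW : 2 < W)
    (h₁ : e₁.Fits W le s) (h₂ : e₂.Fits W le s) : (Expr.keyLT e₁ e₂).Fits W le s := by
  simp only [Expr.keyLT, Expr.Fits, Expr.eval, Op.eval, h₁, h₂, true_and, and_true]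
  refine ⟨⟨?_, ?_⟩, ⟨⟨?_, ?_, ?_⟩, ⟨?_, ?_⟩, ?_⟩, ?_⟩ <;> first | omega | (split_ifs <;> omega)

theorem Expr.fits_lt {W : ℕ} {le : ℕ → ℕ → Bool} {s : State} {e₁ e₂ : Expr} (hW : 2 < W)
    (h₁ : e₁.Fits W le s) (h₂ : e₂.Fits W le s) : (Expr.op .lt e₁ e₂).Fits W le s := by
  refine ⟨h₁, h₂, ?_⟩
  simp only [Op.eval]
  split_ifs <;> omega

/-! ## Selection -/

/-- Swaps the cells of array `3` at the indices in registers `x` and `y`. -/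
def swapCells (x y : ℕ) : Cmd :=
  .assign 9 (.cell 3 (.reg x)) ;; .store 3 (.reg x) (.cell 3 (.reg y)) ;; .store 3 (.reg y) (.reg 9)

/-- Swaps the cells at the indices in registers `x` and `y` if their keys are in the wrong order. -/
def sortCells (x y : ℕ) : Cmd :=
  .cond (.keyLT (.cell 3 (.reg y)) (.cell 3 (.reg x))) (swapCells x y) .skip

/-- Puts the medians of the columns of three rows of length `reg 10`, starting at index `reg 11`,
into the middle row. -/
def sortColumns : Cmd :=
  .assign 8 (.lit 0) ;; .upto 8 10
    (.assign 12 (.op .add (.reg 11) (.reg 8)) ;; .assign 13 (.op .add (.reg 12) (.reg 10)) ;;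
      .assign 14 (.op .add (.reg 13) (.reg 10)) ;;
      sortCells 12 13 ;; sortCells 13 14 ;; sortCells 12 13)

/-- Partitions the window from `reg 2` to `reg 3` around the element at index `reg 6`, and puts the
final index of that element into `reg 7`. -/
def partition : Cmd :=
  swapCells 2 6 ;; .assign 7 (.reg 2) ;; .assign 8 (.op .add (.reg 2) (.lit 1)) ;;
    .upto 8 3 (.cond (.keyLT (.cell 3 (.reg 8)) (.cell 3 (.reg 2)))
      (.assign 7 (.op .add (.reg 7) (.lit 1)) ;; swapCells 8 7) .skip) ;;
    swapCells 2 7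

/-! ### Sorting three cells and the columns of three rows. -/

section Specs

variable {W n : ℕ} {le : ℕ → ℕ → Bool} {procs : List Cmd} {v : ℕ → ℕ}

theorem comp_swap_eq_update (A : ℕ → ℕ) (i j : ℕ) :
    Function.update (Function.update A i (A j)) j (A i) = A ∘ Equiv.swap i j := by
  funext l
  simp only [Function.update_apply, Function.comp_apply, Equiv.swap_apply_def]
  split_ifs <;> simp_all

theorem swapCells_spec {x y : ℕ} {s : State} (hx : x ≠ 9) (hy : y ≠ 9) :
    Runs W le procs (swapCells x y) s 10 (fun s' =>
      s'.cell 3 = s.cell 3 ∘ Equiv.swap (s.reg x) (s.reg y) ∧ Frame [9] [3] s s') := by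
  refine (Runs.straight (T := 10) (Q := fun s' =>
      s'.cell 3 = s.cell 3 ∘ Equiv.swap (s.reg x) (s.reg y)) ?_ ?_ ?_).frame [9] [3] False
      (fun h => h.elim) ?_
  · simp [swapCells, Cmd.Ok, Expr.Fits]
  · simp [swapCells, Cmd.scost, Expr.cost]
  · simp [swapCells, Cmd.sem, Expr.eval, hx, hy, comp_swap_eq_update]
  · simp [swapCells, Cmd.Writes]

theorem sortCells_spec (hv : Compares n le v) (hW : 2 < W) {x y : ℕ} {s : State} (hx : x ≠ 9)
    (hy : y ≠ 9) (hxn : s.cell 3 (s.reg x) < n) (hyn : s.cell 3 (s.reg y) < n) :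
    Runs W le procs (sortCells x y) s 50 (fun s' => (∃ σ : Equiv.Perm ℕ,
      s'.cell 3 = s.cell 3 ∘ σ ∧
      ((σ = 1 ∧ v (s.cell 3 (s.reg x)) ≤ v (s.cell 3 (s.reg y))) ∨
       (σ = Equiv.swap (s.reg x) (s.reg y) ∧ v (s.cell 3 (s.reg y)) < v (s.cell 3 (s.reg x))))) ∧
      Frame [9] [3] s s') := by
  have he := Expr.eval_keyLT hv (s := s) (e₁ := .cell 3 (.reg y)) (e₂ := .cell 3 (.reg x)) hyn hxn
  simp only [Expr.eval] at he
  refine Runs.cond (T := 10) (Expr.fits_keyLT hW trivial trivial) (fun h => ?_) (fun h => ?_)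
    (by simp [Expr.cost, Expr.keyLT])
  · rw [he] at h
    refine (swapCells_spec hx hy).mono le_rfl fun s' h' => ⟨⟨_, h'.1, Or.inr ⟨rfl, ?_⟩⟩, h'.2⟩
    by_contra hc
    simp [hc] at h
  · rw [he] at h
    refine Runs.straight trivial (by simp [Cmd.scost]) ⟨⟨1, rfl, Or.inl ⟨rfl, ?_⟩⟩, .refl _ _ _⟩
    by_contra hc
    simp [not_le.1 hc] at h

/-- This is the sorting network with three comparators. Each comparator is the identity or a swap,
and the eight combinations are checked one by one. -/
theorem sortThree_spec (hv : Compares n le v) (hW : 2 < W) {x y z : ℕ} {s : State} (hx : x ≠ 9)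
    (hy : y ≠ 9) (hz : z ≠ 9) {i j l : ℕ} (hi : s.reg x = i) (hj : s.reg y = j) (hl : s.reg z = l)
    (hij : i < j) (hjl : j < l)
    (hin : s.cell 3 i < n) (hjn : s.cell 3 j < n) (hln : s.cell 3 l < n) :
    Runs W le procs (sortCells x y ;; sortCells y z ;; sortCells x y) s 150 (fun s' =>
      (∃ σ : Equiv.Perm ℕ, s'.cell 3 = s.cell 3 ∘ σ ∧ (∀ m, m ≠ i → m ≠ j → m ≠ l → σ m = m) ∧
        (σ i = i ∨ σ i = j ∨ σ i = l) ∧ (σ j = i ∨ σ j = j ∨ σ j = l) ∧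
        (σ l = i ∨ σ l = j ∨ σ l = l) ∧
        v (s.cell 3 (σ i)) ≤ v (s.cell 3 (σ j)) ∧ v (s.cell 3 (σ j)) ≤ v (s.cell 3 (σ l))) ∧
      Frame [9] [3] s s') := by
  refine (sortCells_spec hv hW hx hy (by rwa [hi]) (by rwa [hj])).seq (T₂ := 100) ?_ (by omega)
  rintro s₁ ⟨⟨σ₁, h₁, c₁⟩, F₁⟩
  have r₁ : ∀ m, m ≠ 9 → s₁.reg m = s.reg m := fun m hm => F₁.reg m (by simpa)
  rw [hi, hj] at c₁
  refine (sortCells_spec hv hW hy hz ?_ ?_).seq (T₁ := 50) (T₂ := 50) ?_ (by omega)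
  · rw [h₁, r₁ y hy, hj]
    rcases c₁ with ⟨rfl, -⟩ | ⟨rfl, -⟩ <;> simpa
  · rw [h₁, r₁ z hz, hl]
    rcases c₁ with ⟨rfl, -⟩ | ⟨rfl, -⟩
    · simpa
    · simpa [Equiv.swap_apply_of_ne_of_ne (show l ≠ i by omega) (show l ≠ j by omega)]
  rintro s₂ ⟨⟨σ₂, h₂, c₂⟩, F₂⟩
  have r₂ : ∀ m, m ≠ 9 → s₂.reg m = s.reg m := fun m hm => by
    rw [F₂.reg m (by simpa), r₁ m hm]
  rw [r₁ y hy, r₁ z hz, hj, hl, h₁] at c₂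
  have hs1 : ∀ m, m ≠ i → m ≠ j → Equiv.swap i j m = m := fun m h h' =>
    Equiv.swap_apply_of_ne_of_ne h h'
  have hs2 : ∀ m, m ≠ j → m ≠ l → Equiv.swap j l m = m := fun m h h' =>
    Equiv.swap_apply_of_ne_of_ne h h'
  have hli := hs1 l (by omega) (by omega)
  have hij' := hs2 i (by omega) (by omega)
  refine (sortCells_spec hv hW hx hy ?_ ?_).mono le_rfl ?_
  · rw [h₂, h₁, r₂ x hx, hi]
    rcases c₁ with ⟨rfl, -⟩ | ⟨rfl, -⟩ <;> rcases c₂ with ⟨rfl, -⟩ | ⟨rfl, -⟩ <;>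
      simp [hij', hin, hjn]
  · rw [h₂, h₁, r₂ y hy, hj]
    rcases c₁ with ⟨rfl, -⟩ | ⟨rfl, -⟩ <;> rcases c₂ with ⟨rfl, -⟩ | ⟨rfl, -⟩ <;>
      simp [hli, hin, hjn, hln]
  rintro s₃ ⟨⟨σ₃, h₃, c₃⟩, F₃⟩
  rw [r₂ x hx, r₂ y hy, hi, hj, h₂, h₁] at c₃
  refine ⟨⟨σ₁ * (σ₂ * σ₃), ?_, ?_⟩, F₁.trans (F₂.trans F₃)⟩
  · rw [h₃, h₂, h₁]
    rfl
  · refine ⟨fun m hmi hmj hml => ?_, ?_⟩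
    · rcases c₁ with ⟨rfl, -⟩ | ⟨rfl, -⟩ <;> rcases c₂ with ⟨rfl, -⟩ | ⟨rfl, -⟩ <;>
        rcases c₃ with ⟨rfl, -⟩ | ⟨rfl, -⟩ <;>
        simp [hs1 m hmi hmj, hs2 m hmj hml]
    · rcases c₁ with ⟨rfl, d₁⟩ | ⟨rfl, d₁⟩ <;> rcases c₂ with ⟨rfl, d₂⟩ | ⟨rfl, d₂⟩ <;>
        rcases c₃ with ⟨rfl, d₃⟩ | ⟨rfl, d₃⟩ <;>
        simp [hli, hij'] at d₁ d₂ d₃ ⊢ <;> omega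

theorem sortColumns_spec (hv : Compares n le v) {Bd : ℕ} (hW : 4 * Bd + 100 ≤ W) {s : State}
    {a h : ℕ} (ha : s.reg 11 = a) (hh : s.reg 10 = h) (hBd : a + 3 * h ≤ Bd)
    (hA : GoodWindow n (s.cell 3) a (a + 3 * h)) :
    Runs W le procs sortColumns s (200 * h + 6) (fun s' => (∃ σ : Equiv.Perm ℕ,
      s'.cell 3 = s.cell 3 ∘ σ ∧ SupportedOn σ a (a + 3 * h) ∧
      ∀ j < h, v (s.cell 3 (σ (a + j))) ≤ v (s.cell 3 (σ (a + h + j))) ∧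
        v (s.cell 3 (σ (a + h + j))) ≤ v (s.cell 3 (σ (a + 2 * h + j)))) ∧
      Frame [8, 9, 12, 13, 14] [3] s s') := by
  refine Runs.frame (Runs.seq (T₁ := 2) (T₂ := 200 * h + 4)
    (Runs.straight (Q := fun s' => s' = s.setReg 8 0) ?_ ?_ rfl) ?_ (by omega)) _ _ False
    (fun h => h.elim) ?_
  · simp only [Cmd.Ok, Expr.Fits]; omega
  · simp [Cmd.scost, Expr.cost]
  · rintro _ rfl
    refine Runs.upto (a := 0) (N := h) [9, 12, 13, 14] [3] False (fun m s' =>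
      ∃ σ : Equiv.Perm ℕ, s'.cell 3 = s.cell 3 ∘ σ ∧ SupportedOn σ a (a + 3 * h) ∧
      ∀ j < m, v (s.cell 3 (σ (a + j))) ≤ v (s.cell 3 (σ (a + h + j))) ∧
        v (s.cell 3 (σ (a + h + j))) ≤ v (s.cell 3 (σ (a + 2 * h + j)))) 180
      (fun h => h.elim) (by simp [Cmd.Writes, sortCells, swapCells]) (by simp) (by simp) (by simp)
      (by omega) (by simp) (by simp [hh]) (by omega) ⟨1, rfl, .one _ _, by simp⟩ ?_
      (by omega) (fun s' hs' _ _ => hs')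
    rintro i s₁ - hi hx ⟨σ, hσA, hσ, hcol⟩ F
    have f11 : s₁.reg 11 = a := by rw [F.reg 11 (by simp)]; simp [ha]
    have f10 : s₁.reg 10 = h := by rw [F.reg 10 (by simp)]; simp [hh]
    have hG := hA.comp hσ
    rw [← hσA] at hG
    refine Runs.seq (T₁ := 4) (T₂ := 176) (Runs.straight (Q := fun s' =>
      s' = s₁.setReg 12 (a + i)) ?_ ?_ ?_) ?_ (by omega)
    · simp only [Cmd.Ok, Expr.Fits, Expr.eval, Op.eval, true_and, f11, hx]; omega
    · simp [Cmd.scost, Expr.cost]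
    · simp [Cmd.sem, Expr.eval, Op.eval, f11, hx]
    rintro _ rfl
    refine Runs.seq (T₁ := 4) (T₂ := 160) (Runs.straight (Q := fun s' =>
      s' = (s₁.setReg 12 (a + i)).setReg 13 (a + i + h)) ?_ ?_ ?_) ?_ (by omega)
    · simp [Cmd.Ok, Expr.Fits, Expr.eval, Op.eval, f10]; omega
    · simp [Cmd.scost, Expr.cost]
    · simp [Cmd.sem, Expr.eval, Op.eval, f10]
    rintro _ rfl
    refine Runs.seq (T₁ := 4) (T₂ := 150) (Runs.straight (Q := fun s' =>
      s' = ((s₁.setReg 12 (a + i)).setReg 13 (a + i + h)).setReg 14 (a + i + h + h)) ?_ ?_ ?_) ?_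
      (by omega)
    · simp [Cmd.Ok, Expr.Fits, Expr.eval, Op.eval, f10]; omega
    · simp [Cmd.scost, Expr.cost]
    · simp [Cmd.sem, Expr.eval, Op.eval, f10]
    rintro _ rfl
    refine (sortThree_spec hv (by omega) (i := a + i) (j := a + i + h) (l := a + i + h + h)
      (by simp) (by simp) (by simp) (by simp) (by simp) (by simp) (by omega) (by omega)
      ?_ ?_ ?_).mono le_rfl ?_
    · exact hG.lt _ (by omega) (by omega)
    · exact hG.lt _ (by omega) (by omega)
    · exact hG.lt _ (by omega) (by omega)
    · rintro s₂ ⟨⟨τ, hτA, hτ, h₁, h₂, h₃, h₄, h₅⟩, -⟩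
      simp only [State.setReg_cell, hσA] at hτA h₄ h₅
      refine ⟨σ * τ, hτA, hσ.mul fun m hm => hτ m (by omega) (by omega) (by omega), ?_⟩
      intro j hj
      simp only [Equiv.Perm.mul_apply]
      rcases Nat.lt_succ_iff_lt_or_eq.1 hj with hj | rfl
      · rw [hτ (a + j) (by omega) (by omega) (by omega),
          hτ (a + h + j) (by omega) (by omega) (by omega),
          hτ (a + 2 * h + j) (by omega) (by omega) (by omega)]
        exact hcol j hj
      · rw [show a + h + j = a + j + h by omega, show a + 2 * h + j = a + j + h + h by omega]
        exact ⟨h₄, h₅⟩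
  · simp [Cmd.Writes, sortCells, swapCells, Cmd.upto]

end Specs

/-! ### Partition of a window around a pivot. -/

section Specs

variable {W n : ℕ} {le : ℕ → ℕ → Bool} {procs : List Cmd} {v : ℕ → ℕ}

/-- The pivot waits at index `lo`. Among the cells already scanned, those up to `q` (register `7`)
have smaller keys and the later ones greater keys; a new smaller element is swapped to index `q +
1`. -/
theorem partition_loop_spec (hv : Compares n le v) {Bd : ℕ} (hW : 4 * Bd + 100 ≤ W) {s : State}
    {lo hi : ℕ} (h2 : s.reg 2 = lo) (h3 : s.reg 3 = hi) (h7 : s.reg 7 = lo) (h8 : s.reg 8 = lo + 1)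
    (hlo : lo < hi) (hBd : hi ≤ Bd) (hA : GoodWindow n (s.cell 3) lo hi) :
    Runs W le procs (.upto 8 3 (.cond (.keyLT (.cell 3 (.reg 8)) (.cell 3 (.reg 2)))
      (.assign 7 (.op .add (.reg 7) (.lit 1)) ;; swapCells 8 7) .skip)) s
      ((hi - lo) * 68 + 4) (fun s' => ∃ (σ : Equiv.Perm ℕ) (q : ℕ),
      s'.cell 3 = s.cell 3 ∘ σ ∧ SupportedOn σ (lo + 1) hi ∧ s'.reg 7 = q ∧ lo ≤ q ∧ q < hi ∧
      (∀ l, lo < l → l ≤ q → v (s.cell 3 (σ l)) < v (s.cell 3 lo)) ∧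
      (∀ l, q < l → l < hi → v (s.cell 3 lo) < v (s.cell 3 (σ l))) ∧
      Frame [8, 7, 9] [3] s s') := by
  refine Runs.upto (a := lo + 1) (N := hi) [7, 9] [3] False (fun i s' =>
      ∃ (σ : Equiv.Perm ℕ) (q : ℕ),
      s'.cell 3 = s.cell 3 ∘ σ ∧ SupportedOn σ (lo + 1) hi ∧ s'.reg 7 = q ∧ lo ≤ q ∧ q < i ∧
      (∀ l, lo < l → l ≤ q → v (s.cell 3 (σ l)) < v (s.cell 3 lo)) ∧
      (∀ l, q < l → l < i → v (s.cell 3 lo) < v (s.cell 3 (σ l)))) 60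
      (fun h => h.elim) (by simp [Cmd.Writes, swapCells]) (by simp) (by simp) (by simp)
      (by omega) h8 h3 (by omega) ?_ ?_ (by omega) ?_
  · exact ⟨1, lo, rfl, .one _ _, h7, le_rfl, by omega, fun l => by omega, fun l => by omega⟩
  · rintro i s₁ hai hi hx ⟨σ, q, hσA, hσ, hq, hq₁, hq₂, hl, hr⟩ F
    have f2 : s₁.reg 2 = lo := by rw [F.reg 2 (by simp), h2]
    have hG := hA.comp (hσ.mono (by omega) le_rfl)
    have hlo' : σ lo = lo := hσ lo (by omega)
    have hGi := hG.lt i (by omega) (by omega)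
    have hGl := hG.lt lo (by omega) (by omega)
    have he := Expr.eval_keyLT hv (s := s₁) (e₁ := .cell 3 (.reg 8)) (e₂ := .cell 3 (.reg 2))
      (by simp only [Expr.eval, hx, hσA]; exact hGi) (by simp only [Expr.eval, f2, hσA]; exact hGl)
    simp only [Expr.eval, hx, f2, hσA, Function.comp_apply, hlo'] at he
    refine Runs.cond (T := 14) (Expr.fits_keyLT (by omega) trivial trivial) (fun h => ?_)
      (fun h => ?_) (by simp [Expr.cost, Expr.keyLT])
    · have hlt : v (s.cell 3 (σ i)) < v (s.cell 3 lo) := by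
        by_contra hc
        exact h (by simp [he, hc])
      refine Runs.seq (T₁ := 4) (T₂ := 10) (Runs.straight (Q := fun s' =>
        s' = s₁.setReg 7 (q + 1)) ?_ ?_ ?_) ?_ (by omega)
      · simp only [Cmd.Ok, Expr.Fits, Expr.eval, Op.eval, true_and, hq]; omega
      · simp [Cmd.scost, Expr.cost]
      · simp [Cmd.sem, Expr.eval, Op.eval, hq]
      rintro _ rfl
      refine (swapCells_spec (by simp) (by simp)).mono le_rfl ?_
      rintro s₂ ⟨h₂, F₂⟩
      have hs7 : s₂.reg 7 = q + 1 := by rw [F₂.reg 7 (by simp)]; simp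
      simp only [State.setReg_cell, State.setReg_reg, if_true, hx, hσA, Nat.reduceEqDiff,
        if_false] at h₂
      refine ⟨σ * Equiv.swap i (q + 1), q + 1, h₂, ?_, by simpa using hs7, by omega,
        by omega, ?_, ?_⟩
      · exact hσ.mul (.swap (by omega) (by omega) (by omega) (by omega))
      · intro l hl₁ hl₂
        rcases Nat.lt_succ_iff_lt_or_eq.1 (Nat.lt_succ_of_le hl₂) with h | rfl
        · rw [Equiv.Perm.mul_apply, Equiv.swap_apply_of_ne_of_ne (by omega) (by omega)]
          exact hl l hl₁ (by omega)
        · simpa using hlt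
      · intro l hl₁ hl₂
        rcases Nat.lt_succ_iff_lt_or_eq.1 hl₂ with h | rfl
        · rw [Equiv.Perm.mul_apply, Equiv.swap_apply_of_ne_of_ne (by omega) (by omega)]
          exact hr l (by omega) (by omega)
        · simpa using hr (q + 1) (by omega) hl₁
    · have hge : v (s.cell 3 lo) < v (s.cell 3 (σ i)) := by
        rcases lt_trichotomy (v (s.cell 3 (σ i))) (v (s.cell 3 lo)) with h' | h' | h'
        · rw [he] at h
          simp [h'] at h
        · have := hv.inj _ _ hGi hGl (by simpa [hlo'] using h')
          have := hG.inj i lo (by omega) (by omega) (by omega) (by omega) this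
          omega
        · exact h'
      refine Runs.straight trivial (by simp [Cmd.scost]) ⟨σ, q, by simpa [Cmd.sem], hσ,
        by simpa [Cmd.sem], hq₁, by omega, hl, ?_⟩
      intro l hl₁ hl₂
      rcases Nat.lt_succ_iff_lt_or_eq.1 hl₂ with h | rfl
      · exact hr l hl₁ h
      · exact hge
  · rintro s' ⟨σ, q, h⟩ - F
    exact ⟨σ, q, h.1, h.2.1, h.2.2.1, h.2.2.2.1, h.2.2.2.2.1, h.2.2.2.2.2.1, h.2.2.2.2.2.2, F⟩

theorem partition_spec (hv : Compares n le v) {Bd : ℕ} (hW : 4 * Bd + 100 ≤ W) {s : State}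
    {lo hi m : ℕ} (h2 : s.reg 2 = lo) (h3 : s.reg 3 = hi) (h6 : s.reg 6 = m)
    (hlo : lo ≤ m) (hm : m < hi) (hBd : hi ≤ Bd) (hA : GoodWindow n (s.cell 3) lo hi) :
    Runs W le procs partition s ((hi - lo) * 68 + 40) (fun s' =>
      (∃ (σ : Equiv.Perm ℕ) (q : ℕ),
      s'.cell 3 = s.cell 3 ∘ σ ∧ SupportedOn σ lo hi ∧ s'.reg 7 = q ∧ lo ≤ q ∧ q < hi ∧ σ q = m ∧
      (∀ l, lo ≤ l → l < q → v (s.cell 3 (σ l)) < v (s.cell 3 m)) ∧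
      (∀ l, q < l → l < hi → v (s.cell 3 m) < v (s.cell 3 (σ l)))) ∧
      Frame [7, 8, 9] [3] s s') := by
  refine Runs.frame ?_ _ _ False (fun h => h.elim)
    (by simp [partition, Cmd.Writes, swapCells, Cmd.upto])
  refine (swapCells_spec (by simp) (by simp)).seq (T₂ := (hi - lo) * 68 + 20) ?_ (by omega)
  rintro s₁ ⟨hA₁, F₁⟩
  rw [h2, h6] at hA₁
  have f2 : s₁.reg 2 = lo := by rw [F₁.reg 2 (by simp), h2]
  have f3 : s₁.reg 3 = hi := by rw [F₁.reg 3 (by simp), h3]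
  have hsw : SupportedOn (Equiv.swap lo m) lo hi := .swap le_rfl (by omega) hlo hm
  refine Runs.seq (T₁ := 2) (T₂ := (hi - lo) * 68 + 18) (Runs.straight (Q := fun s' =>
    s' = s₁.setReg 7 lo) ?_ ?_ ?_) ?_ (by omega)
  · simp [Cmd.Ok, Expr.Fits]
  · simp [Cmd.scost, Expr.cost]
  · simp [Cmd.sem, Expr.eval, f2]
  rintro _ rfl
  refine Runs.seq (T₁ := 4) (T₂ := (hi - lo) * 68 + 14) (Runs.straight (Q := fun s' =>
    s' = (s₁.setReg 7 lo).setReg 8 (lo + 1)) ?_ ?_ ?_) ?_ (by omega)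
  · simp [Cmd.Ok, Expr.Fits, Expr.eval, Op.eval, f2]; omega
  · simp [Cmd.scost, Expr.cost]
  · simp [Cmd.sem, Expr.eval, f2, Op.eval]
  rintro _ rfl
  refine Runs.seq (T₁ := (hi - lo) * 68 + 4) (T₂ := 10) (partition_loop_spec hv hW (lo := lo)
    (hi := hi) (by simpa) (by simpa) (by simp) (by simp) (by omega) hBd ?_) ?_ (by omega)
  · simp only [State.setReg_cell, hA₁]
    exact hA.comp hsw
  rintro s₂ ⟨σ, q, hσA, hσ, hq, hq₁, hq₂, hl, hr, F₂⟩
  simp only [State.setReg_cell, hA₁, Function.comp_apply, Equiv.swap_apply_left] at hσA hl hr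
  have g2 : s₂.reg 2 = lo := by rw [F₂.reg 2 (by simp)]; simp [f2]
  refine (swapCells_spec (by simp) (by simp)).mono le_rfl ?_
  rintro s₃ ⟨hA₃, F₃⟩
  rw [g2, hq, hσA] at hA₃
  have hσlo : σ lo = lo := hσ lo (by omega)
  refine ⟨Equiv.swap lo m * (σ * Equiv.swap lo q), q, hA₃, ?_, ?_, hq₁, hq₂, ?_, ?_, ?_⟩
  · exact hsw.mul ((hσ.mono (by omega) le_rfl).mul (.swap le_rfl (by omega) hq₁ hq₂))
  · rw [F₃.reg 7 (by simp), hq]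
  · simp [hσlo]
  · intro l hl₁ hl₂
    rcases Nat.lt_or_eq_of_le hl₁ with h | rfl
    · simp only [Equiv.Perm.mul_apply]
      rw [Equiv.swap_apply_of_ne_of_ne (a := lo) (b := q) (by omega) (by omega)]
      exact hl l h (by omega)
    · simpa using hl q hl₂ le_rfl
  · intro l hl₁ hl₂
    simp only [Equiv.Perm.mul_apply]
    rw [Equiv.swap_apply_of_ne_of_ne (a := lo) (b := q) (by omega) (by omega)]
    exact hr l hl₁ hl₂

end Specs

/-- Moves a good pivot into the middle ninth of the window from `reg 2` to `reg 3`, and puts its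
index into `reg 6`. The recursive call saves the window and the target on a stack. -/
def choosePivot : Cmd :=
  (.assign 10 (.op .div (.op .sub (.reg 3) (.reg 2)) (.lit 3)) ;; .assign 11 (.reg 2)) ;;
  sortColumns ;;
  (.assign 11 (.op .add (.reg 2) (.reg 10)) ;; .assign 10 (.op .div (.reg 10) (.lit 3))) ;;
  sortColumns ;;
  (.store 9 (.reg 5) (.reg 2) ;; .store 10 (.reg 5) (.reg 3) ;; .store 11 (.reg 5) (.reg 4) ;;
    .assign 5 (.op .add (.reg 5) (.lit 1)) ;; .assign 2 (.op .add (.reg 11) (.reg 10)) ;;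
    .assign 3 (.op .add (.reg 2) (.reg 10)) ;;
    .assign 4 (.op .add (.reg 2) (.op .div (.reg 10) (.lit 2)))) ;;
  .call 0 ;;
  (.assign 6 (.reg 4) ;; .assign 5 (.op .sub (.reg 5) (.lit 1)) ;; .assign 2 (.cell 9 (.reg 5)) ;;
    .assign 3 (.cell 10 (.reg 5)) ;; .assign 4 (.cell 11 (.reg 5)))

/-- Rearranges the window from `reg 2` to `reg 3` of array `3` such that the smaller keys precede
and the greater keys follow the index `reg 4`. -/
def select : Cmd :=
  .cond (.op .lt (.op .sub (.reg 3) (.reg 2)) (.lit 9)) (.assign 6 (.reg 2)) choosePivot ;;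
  partition ;;
  .cond (.op .lt (.reg 4) (.reg 7)) (.assign 3 (.reg 7) ;; .call 0)
    (.cond (.op .lt (.reg 7) (.reg 4)) (.assign 2 (.op .add (.reg 7) (.lit 1)) ;; .call 0) .skip)

/-- The registers and the arrays that selection writes. -/
def selectRegs : List ℕ := [2, 3, 4, 5, 6, 7, 8, 9, 10, 11, 12, 13, 14]
def selectArrays : List ℕ := [3, 9, 10, 11]

theorem select_writes : Cmd.Writes selectRegs selectArrays True select := by
  simp [selectRegs, selectArrays, select, choosePivot, partition, sortColumns, sortCells, swapCells,
    Cmd.upto, Cmd.Writes]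

/-- The stack below the depth `d` is the same in both states. -/
def SameStack (d : ℕ) (s s' : State) : Prop :=
  ∀ i < d, s'.cell 9 i = s.cell 9 i ∧ s'.cell 10 i = s.cell 10 i ∧ s'.cell 11 i = s.cell 11 i

theorem SameStack.trans {d : ℕ} {s s' s'' : State} (h : SameStack d s s')
    (h' : SameStack d s' s'') : SameStack d s s'' := fun i hi => by
  obtain ⟨a, b, c⟩ := h i hi
  obtain ⟨a', b', c'⟩ := h' i hi
  exact ⟨a'.trans a, b'.trans b, c'.trans c⟩

theorem SameStack.of_frame {d : ℕ} {s s' : State} {R : List ℕ} (h : Frame R [3] s s') :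
    SameStack d s s' := fun i _ => by
  rw [h.cell 9 (by simp), h.cell 10 (by simp), h.cell 11 (by simp)]
  exact ⟨rfl, rfl, rfl⟩

/-- The index `t` splits the window `[lo, hi)`. -/
def SplitAt (w : ℕ → ℕ) (lo hi t : ℕ) : Prop :=
  (∀ i, lo ≤ i → i < t → w i ≤ w t) ∧ ∀ i, t < i → i < hi → w t ≤ w i

/-- The effect of selection on the window `[lo, hi)` with target `t` at depth `d`. -/
def Selected (v : ℕ → ℕ) (lo hi t d : ℕ) (s s' : State) : Prop :=
  (∃ σ : Equiv.Perm ℕ, s'.cell 3 = s.cell 3 ∘ σ ∧ SupportedOn σ lo hi ∧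
    SplitAt (fun i => v (s.cell 3 (σ i))) lo hi t) ∧
  s'.reg 4 = t ∧ s'.reg 5 = d ∧ SameStack d s s'

/-- Procedure `0` selects in windows of size `N` that end at or before `Bd`. -/
def Selects (W n : ℕ) (le : ℕ → ℕ → Bool) (procs : List Cmd) (v : ℕ → ℕ) (Bd N : ℕ) : Prop :=
  ∀ s lo hi t d, hi - lo = N → s.reg 2 = lo → s.reg 3 = hi → s.reg 4 = t → s.reg 5 = d →
    lo ≤ t → t < hi → hi ≤ Bd → d + (hi - lo) ≤ Bd → GoodWindow n (s.cell 3) lo hi →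
    Runs W le procs (.call 0) s (4000 * N) (Selected v lo hi t d s)

/-! ### Selection in linear time. -/

section Specs

variable {W n : ℕ} {le : ℕ → ℕ → Bool} {procs : List Cmd} {v : ℕ → ℕ}

/-- The pivot is the median of the middle ninth. About half of this ninth is on either side of the
pivot, and by `four_mul_cnt_le` the whole window has four times as many elements on that side, hence
`2 * ((hi - lo) / 9)`. Both sides count the pivot itself. -/
theorem choosePivot_spec (hv : Compares n le v) {Bd : ℕ} (hW : 4 * Bd + 100 ≤ W) {s : State}
    {lo hi t d : ℕ} (ih : ∀ N < hi - lo, Selects W n le procs v Bd N)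
    (h2 : s.reg 2 = lo) (h3 : s.reg 3 = hi) (h4 : s.reg 4 = t) (h5 : s.reg 5 = d)
    (hlo : lo + 9 ≤ hi) (hBd : hi ≤ Bd) (hd : d + (hi - lo) ≤ Bd)
    (hA : GoodWindow n (s.cell 3) lo hi) :
    Runs W le procs choosePivot s (4000 * ((hi - lo) / 9) + 100 * (hi - lo) + 100) (fun s' =>
      ∃ (σ : Equiv.Perm ℕ) (m : ℕ), s'.cell 3 = s.cell 3 ∘ σ ∧ SupportedOn σ lo hi ∧
        lo ≤ m ∧ m < hi ∧ s'.reg 6 = m ∧ s'.reg 2 = lo ∧ s'.reg 3 = hi ∧ s'.reg 4 = t ∧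
        s'.reg 5 = d ∧ SameStack d s s' ∧
        2 * ((hi - lo) / 9) ≤ cnt (fun i => v (s.cell 3 (σ i)) ≤ v (s.cell 3 (σ m))) lo hi ∧
        2 * ((hi - lo) / 9) ≤ cnt (fun i => v (s.cell 3 (σ m)) ≤ v (s.cell 3 (σ i))) lo hi) := by
  obtain ⟨h, hh⟩ : ∃ h, h = (hi - lo) / 3 := ⟨_, rfl⟩
  obtain ⟨g, hg⟩ : ∃ g, g = h / 3 := ⟨_, rfl⟩
  have hg' : (hi - lo) / 9 = g := by omega
  rw [hg']
  refine Runs.seq (T₁ := 8) (T₂ := 4000 * g + 100 * (hi - lo) + 92) (Runs.straight (Q := fun s' =>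
    s' = (s.setReg 10 h).setReg 11 lo) ?_ ?_ ?_) ?_ (by omega)
  · simp [Cmd.Ok, Expr.Fits, Expr.eval, Op.eval, h2, h3]; omega
  · simp [Cmd.scost, Expr.cost]
  · simp [Cmd.sem, Expr.eval, Op.eval, h2, h3, hh]
  rintro _ rfl
  refine Runs.seq (T₁ := 200 * h + 6) (T₂ := 4000 * g + (100 * (hi - lo) - 200 * h) + 86)
    (sortColumns_spec hv hW (a := lo) (h := h) (by simp) (by simp) (by omega)
    (hA.mono le_rfl (by omega))) ?_ (by omega)
  rintro s₁ ⟨⟨ρ, hρA, hρ, hcol⟩, F₁⟩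
  simp only [State.setReg_cell] at hρA hcol
  have e2 : s₁.reg 2 = lo := by rw [F₁.reg 2 (by simp)]; simp [h2]
  have e3 : s₁.reg 3 = hi := by rw [F₁.reg 3 (by simp)]; simp [h3]
  have e4 : s₁.reg 4 = t := by rw [F₁.reg 4 (by simp)]; simp [h4]
  have e5 : s₁.reg 5 = d := by rw [F₁.reg 5 (by simp)]; simp [h5]
  have e10 : s₁.reg 10 = h := by rw [F₁.reg 10 (by simp)]; simp
  have hρ' : SupportedOn ρ lo hi := hρ.mono le_rfl (by omega)
  have hA₁ := hA.comp hρ'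
  refine Runs.seq (T₁ := 8) (T₂ := 4000 * g + (100 * (hi - lo) - 200 * h) + 78)
    (Runs.straight (Q := fun s' =>
    s' = (s₁.setReg 11 (lo + h)).setReg 10 g) ?_ ?_ ?_) ?_ (by omega)
  · simp [Cmd.Ok, Cmd.sem, Expr.Fits, Expr.eval, Op.eval, e2, e10]; omega
  · simp [Cmd.scost, Expr.cost]
  · simp [Cmd.sem, Expr.eval, Op.eval, e2, e10, hg]
  rintro _ rfl
  refine Runs.seq (T₁ := 200 * g + 6) (T₂ := 4000 * g + 72)
    (sortColumns_spec hv hW (a := lo + h) (h := g) (by simp) (by simp) (by omega) ?_) ?_ (by omega)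
  · simp only [State.setReg_cell, hρA]
    exact hA₁.mono (by omega) (by omega)
  rintro s₂ ⟨⟨σ, hσA, hσ, hcol'⟩, F₂⟩
  simp only [State.setReg_cell, hρA, Function.comp_apply] at hσA hcol'
  have k2 : s₂.reg 2 = lo := by rw [F₂.reg 2 (by simp)]; simp [e2]
  have k3 : s₂.reg 3 = hi := by rw [F₂.reg 3 (by simp)]; simp [e3]
  have k4 : s₂.reg 4 = t := by rw [F₂.reg 4 (by simp)]; simp [e4]
  have k5 : s₂.reg 5 = d := by rw [F₂.reg 5 (by simp)]; simp [e5]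
  have k10 : s₂.reg 10 = g := by rw [F₂.reg 10 (by simp)]; simp
  have k11 : s₂.reg 11 = lo + h := by rw [F₂.reg 11 (by simp)]; simp
  have hσ' : SupportedOn σ lo hi := hσ.mono (by omega) (by omega)
  have hA₂ := hA₁.comp hσ'
  rw [← hσA] at hA₂
  -- The recursive call runs at depth `d + 1` and preserves the stack below it, so the frame stored
  -- next in cell `d` of arrays `9`, `10`, `11` survives.
  have hst : SameStack d s s₂ := fun i _ => by
    simp [F₂.cell 9, F₂.cell 10, F₂.cell 11, F₁.cell 9, F₁.cell 10, F₁.cell 11]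
  refine Runs.seq (T₁ := 29) (T₂ := 4000 * g + 40)
    (Runs.straight (Q := fun s' => s'.reg 2 = lo + h + g ∧ s'.reg 3 = lo + h + 2 * g ∧
      s'.reg 4 = lo + h + g + g / 2 ∧ s'.reg 5 = d + 1 ∧ s'.cell 3 = s₂.cell 3 ∧
      s'.cell 9 d = lo ∧ s'.cell 10 d = hi ∧ s'.cell 11 d = t ∧ SameStack d s₂ s') ?_ ?_ ?_) ?_
      (by omega)
  · simp [Cmd.Ok, Cmd.sem, Expr.Fits, Expr.eval, Op.eval, k2, k3, k4, k5, k10, k11]; omega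
  · simp [Cmd.scost, Expr.cost]
  · simp [Cmd.sem, Expr.eval, Op.eval, k2, k3, k4, k5, k10, k11]
    refine ⟨by omega, fun i hi => ?_⟩
    simp [Function.update_of_ne hi.ne]
  rintro s₃ ⟨m2, m3, m4, m5, m3A, m9, m10, m11, hst₃⟩
  refine Runs.seq (T₁ := 4000 * g) (T₂ := 20) (ih g (by omega) s₃ (lo + h + g) (lo + h + 2 * g)
    (lo + h + g + g / 2) (d + 1) (by omega) m2 m3 m4 m5 (by omega) (by omega) (by omega) (by omega)
    ?_) ?_ (by omega)
  · rw [m3A]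
    exact hA₂.mono (by omega) (by omega)
  rintro s₄ ⟨⟨τ, hτA, hτ, hsl, hsr⟩, n4, n5, hst₄⟩
  rw [m3A, hσA] at hτA hsl hsr
  simp only [Function.comp_apply] at hsl hsr
  obtain ⟨n9, n10, n11⟩ := hst₄ d (by omega)
  rw [m9] at n9
  rw [m10] at n10
  rw [m11] at n11
  have hst' : SameStack d s s₄ :=
    (hst.trans hst₃).trans fun i hi => hst₄ i (by omega)
  have hfour := fun p => four_mul_cnt_le (w := fun i => v (s.cell 3 (ρ i))) (lo := lo) (hi := hi)
    (h := h) (g := g) (σ := σ) (τ := τ) (p := p) (by omega) (by omega) (by omega) hcol hσ hcol' hτ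
  refine Runs.straight ?_ ?_ ⟨ρ * (σ * τ), lo + h + g + g / 2, ?_, ?_, ?_, ?_, ?_, ?_, ?_, ?_, ?_,
    ?_, ?_, ?_⟩
  · simp [Cmd.Ok, Cmd.sem, Expr.Fits, Expr.eval, Op.eval, n5]; omega
  · simp [Cmd.scost, Expr.cost]
  · exact hτA
  · exact hρ'.mul (hσ'.mul (hτ.mono (by omega) (by omega)))
  · omega
  · omega
  · simp [Cmd.sem, Expr.eval, n4]
  · simp [Cmd.sem, Expr.eval, Op.eval, n5, n9]
  · simp [Cmd.sem, Expr.eval, Op.eval, n5, n10]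
  · simp [Cmd.sem, Expr.eval, Op.eval, n5, n11]
  · simp [Cmd.sem, Expr.eval, Op.eval, n5]
  · exact hst'
  · have := hfour (· ≤ v (s.cell 3 (ρ (σ (τ (lo + h + g + g / 2))))))
      (Or.inl fun x y hxy hy => hxy.trans hy)
    -- The recursive call has put the pivot at offset `g / 2` of the middle ninth, so it and the `g
    -- / 2` elements before it qualify.
    have h' : g / 2 + 1 ≤ cnt (fun i => v (s.cell 3 (ρ (σ (τ i)))) ≤
        v (s.cell 3 (ρ (σ (τ (lo + h + g + g / 2)))))) (lo + h + g) (lo + h + 2 * g) := by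
      rw [show g / 2 + 1 = (lo + h + g + g / 2 + 1) - (lo + h + g) by omega, ← cnt_true]
      refine cnt_mono le_rfl (by omega) fun i hi₁ hi₂ _ => ?_
      rcases Nat.lt_succ_iff_lt_or_eq.1 hi₂ with h' | rfl
      · exact hsl i hi₁ h'
      · exact le_rfl
    simp only [Equiv.Perm.mul_apply]
    omega
  · have := hfour (v (s.cell 3 (ρ (σ (τ (lo + h + g + g / 2))))) ≤ ·)
      (Or.inr fun x y hxy hy => hy.trans hxy)
    have h' : g - g / 2 ≤ cnt (fun i => v (s.cell 3 (ρ (σ (τ (lo + h + g + g / 2))))) ≤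
        v (s.cell 3 (ρ (σ (τ i))))) (lo + h + g) (lo + h + 2 * g) := by
      rw [show g - g / 2 = (lo + h + 2 * g) - (lo + h + g + g / 2) by omega, ← cnt_true]
      refine cnt_mono (by omega) le_rfl fun i hi₁ hi₂ _ => ?_
      rcases Nat.lt_or_eq_of_le hi₁ with h' | rfl
      · exact hsr i h' hi₂
      · exact le_rfl
    simp only [Equiv.Perm.mul_apply]
    omega

/-- With `g = (hi - lo) / 9`, the pivot costs a call on `g` elements, and the final call is on at
most `hi - lo - 2 * g`. The `g` elements saved pay for the linear work at the rate 4000; the worst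
ratio is at `hi - lo = 17`, `g = 1`. Below nine elements, `g = 0` and any pivot does, because the
window loses at least the pivot; this is the subtracted 1. Only the call for the pivot is nested, so
depth plus window size stays below `Bd`. -/
theorem select_spec (hv : Compares n le v) {Bd : ℕ} (hW : 4 * Bd + 100 ≤ W)
    (hp : procs[0]? = some select) (N : ℕ) : Selects W n le procs v Bd N := by
  induction N using Nat.strong_induction_on with
  | _ N ih =>
  rintro s lo hi t d rfl h2 h3 h4 h5 hlot hthi hBd hd hA
  refine Runs.call (T := 4000 * (hi - lo) - 1) hp ?_ (by omega)
  refine Runs.seq (T₁ := 4000 * ((hi - lo) / 9) + 100 * (hi - lo) + 110)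
    (T₂ := 4000 * (hi - lo - 2 * ((hi - lo) / 9) - if hi - lo < 9 then 1 else 0) +
      68 * (hi - lo) + 80) (R := fun s' =>
      ∃ (σ : Equiv.Perm ℕ) (m : ℕ), s'.cell 3 = s.cell 3 ∘ σ ∧ SupportedOn σ lo hi ∧
        lo ≤ m ∧ m < hi ∧ s'.reg 6 = m ∧ s'.reg 2 = lo ∧ s'.reg 3 = hi ∧ s'.reg 4 = t ∧
        s'.reg 5 = d ∧ SameStack d s s' ∧
        2 * ((hi - lo) / 9) ≤ cnt (fun i => v (s.cell 3 (σ i)) ≤ v (s.cell 3 (σ m))) lo hi ∧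
        2 * ((hi - lo) / 9) ≤ cnt (fun i => v (s.cell 3 (σ m)) ≤ v (s.cell 3 (σ i))) lo hi)
    ?_ ?_ (by split_ifs <;> omega)
  · refine Runs.cond (T := 4000 * ((hi - lo) / 9) + 100 * (hi - lo) + 100) ?_ (fun h => ?_)
      (fun h => ?_) (by simp only [Expr.cost]; omega)
    · refine Expr.fits_lt (by omega) ⟨trivial, trivial, ?_⟩ (show 9 < W by omega)
      simp only [Expr.eval, Op.eval, h2, h3]
      omega
    · have h9 : hi - lo < 9 := by
        by_contra hc
        simp [Expr.eval, Op.eval, h2, h3, hc] at h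
      refine Runs.straight trivial (by simp [Cmd.scost, Expr.cost]) ⟨1, lo, ?_⟩
      have h0 : (hi - lo) / 9 = 0 := by omega
      simp [Cmd.sem, Expr.eval, h2, h3, h4, h5, h0, SameStack, SupportedOn.one]
      omega
    · have h9 : lo + 9 ≤ hi := by
        by_contra hc
        have : hi - lo < 9 := by omega
        simp [Expr.eval, Op.eval, h2, h3, this] at h
      exact choosePivot_spec hv hW ih h2 h3 h4 h5 h9 hBd hd hA
  rintro s₁ ⟨σ, m, hσA, hσ, hm₁, hm₂, e6, e2, e3, e4, e5, hst, hc₁, hc₂⟩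
  have hA₁ := hA.comp hσ
  refine Runs.seq (T₁ := (hi - lo) * 68 + 40)
    (T₂ := 4000 * (hi - lo - 2 * ((hi - lo) / 9) - if hi - lo < 9 then 1 else 0) + 40)
    (partition_spec hv hW e2 e3 e6 hm₁ hm₂ hBd (by rwa [hσA])) ?_ (by omega)
  rintro s₂ ⟨⟨τ, q, hτA, hτ, k7, hq₁, hq₂, hqm, hl, hr⟩, F⟩
  simp only [hσA, Function.comp_apply] at hτA hl hr
  have k2 : s₂.reg 2 = lo := by rw [F.reg 2 (by simp), e2]
  have k3 : s₂.reg 3 = hi := by rw [F.reg 3 (by simp), e3]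
  have k4 : s₂.reg 4 = t := by rw [F.reg 4 (by simp), e4]
  have k5 : s₂.reg 5 = d := by rw [F.reg 5 (by simp), e5]
  have hst₂ : SameStack d s s₂ := hst.trans (.of_frame F)
  have hA₂ := hA₁.comp hτ
  -- After the partition no key beyond index `q` is at most that of the pivot, so the rank of the
  -- pivot bounds `q` from below.
  have hd₁ : 2 * ((hi - lo) / 9) ≤ q + 1 - lo := by
    refine hc₁.trans ?_
    rw [← cnt_perm _ hτ, ← cnt_add _ (show lo ≤ q + 1 by omega) (show q + 1 ≤ hi by omega)]
    have h₁ := cnt_mono (p := fun i => v (s.cell 3 (σ (τ i))) ≤ v (s.cell 3 (σ m)))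
      (q := fun _ => True) (le_refl lo) (le_refl (q + 1)) (fun _ _ _ _ => trivial)
    have h₂ := cnt_mono (p := fun i => v (s.cell 3 (σ (τ i))) ≤ v (s.cell 3 (σ m)))
      (q := fun _ => True) (a := q + 1) (b := hi) (a' := q + 1) (b' := q + 1) le_rfl
    rw [cnt_true] at h₁
    have h₃ : cnt (fun i => v (s.cell 3 (σ (τ i))) ≤ v (s.cell 3 (σ m))) (q + 1) hi = 0 := by
      rw [cnt_congr (q := fun _ => False)]
      · simp [cnt]
      · intro i hi₁ hi₂
        simpa using hr i hi₁ hi₂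
    omega
  have hd₂ : 2 * ((hi - lo) / 9) ≤ hi - q := by
    refine hc₂.trans ?_
    rw [← cnt_perm _ hτ, ← cnt_add _ hq₁ hq₂.le]
    have h₁ := cnt_mono (p := fun i => v (s.cell 3 (σ m)) ≤ v (s.cell 3 (σ (τ i))))
      (q := fun _ => True) (le_refl q) (le_refl hi) (fun _ _ _ _ => trivial)
    rw [cnt_true] at h₁
    have h₃ : cnt (fun i => v (s.cell 3 (σ m)) ≤ v (s.cell 3 (σ (τ i)))) lo q = 0 := by
      rw [cnt_congr (q := fun _ => False)]
      · simp [cnt]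
      · intro i hi₁ hi₂
        simpa using hl i hi₁ hi₂
    omega
  obtain ⟨M, hM⟩ : ∃ M, M = hi - lo - 2 * ((hi - lo) / 9) - if hi - lo < 9 then 1 else 0 :=
    ⟨_, rfl⟩
  rw [← hM]
  have hML : q - lo ≤ M := by rw [hM]; split_ifs <;> omega
  have hMR : hi - (q + 1) ≤ M := by rw [hM]; split_ifs <;> omega
  clear hM
  refine Runs.cond (T := 4000 * M + 30) ?_ (fun h => ?_) (fun h => ?_)
    (by simp only [Expr.cost]; omega)
  · exact Expr.fits_lt (by omega) trivial trivial
  · have htq : t < q := by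
      by_contra hc
      simp [Expr.eval, Op.eval, k4, k7, hc] at h
    refine Runs.seq (T₁ := 2) (T₂ := 4000 * (q - lo)) (Runs.straight (Q := fun s' =>
      s' = s₂.setReg 3 q) trivial (by simp [Cmd.scost, Expr.cost])
      (by simp [Cmd.sem, Expr.eval, k7])) ?_ (by omega)
    rintro _ rfl
    refine (ih (q - lo) (by omega) _ lo q t d rfl (by simpa) (by simp) (by simpa) (by simpa) hlot
      htq (by omega) (by omega) ?_).mono le_rfl ?_
    · simp only [State.setReg_cell, hτA]
      exact hA₂.mono le_rfl (by omega)
    rintro s₃ ⟨⟨ρ, hρA, hρ, hsl, hsr⟩, n4, n5, hst₃⟩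
    simp only [State.setReg_cell, hτA, Function.comp_apply] at hρA hsl hsr
    refine ⟨⟨σ * (τ * ρ), hρA, hσ.mul (hτ.mul (hρ.mono le_rfl (by omega))), hsl, ?_⟩, n4, n5,
      hst₂.trans hst₃⟩
    intro i hi₁ hi₂
    simp only [Equiv.Perm.mul_apply]
    by_cases hiq : i < q
    · exact hsr i hi₁ hiq
    -- The second call does not touch the indices from `q` on. There the keys are at least that of
    -- the pivot, while the element now at `t` comes from before `q`.
    · have h₁ := hl (ρ t) (hρ.mem hlot htq).1 (hρ.mem hlot htq).2
      rw [hρ i (by omega)]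
      rcases Nat.lt_or_eq_of_le (not_lt.1 hiq) with h' | rfl
      · exact (h₁.trans (hr i h' hi₂)).le
      · rw [hqm]
        exact h₁.le
  · have htq : q ≤ t := by
      by_contra hc
      simp [Expr.eval, Op.eval, k4, k7, not_le.1 hc] at h
    refine Runs.cond (T := 4000 * M + 20) ?_ (fun h => ?_) (fun h => ?_)
      (by simp only [Expr.cost]; omega)
    · exact Expr.fits_lt (by omega) trivial trivial
    · have hqt : q < t := by
        by_contra hc
        simp [Expr.eval, Op.eval, k4, k7, hc] at h
      refine Runs.seq (T₁ := 4) (T₂ := 4000 * (hi - (q + 1))) (Runs.straight (Q := fun s' =>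
        s' = s₂.setReg 2 (q + 1)) ?_ (by simp [Cmd.scost, Expr.cost])
        (by simp [Cmd.sem, Expr.eval, Op.eval, k7])) ?_ (by omega)
      · simp [Cmd.Ok, Expr.Fits, Expr.eval, Op.eval, k7]; omega
      rintro _ rfl
      refine (ih (hi - (q + 1)) (by omega) _ (q + 1) hi t d rfl (by simp) (by simpa) (by simpa)
        (by simpa) hqt hthi (by omega) (by omega) ?_).mono le_rfl ?_
      · simp only [State.setReg_cell, hτA]
        exact hA₂.mono (by omega) le_rfl
      rintro s₃ ⟨⟨ρ, hρA, hρ, hsl, hsr⟩, n4, n5, hst₃⟩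
      simp only [State.setReg_cell, hτA, Function.comp_apply] at hρA hsl hsr
      refine ⟨⟨σ * (τ * ρ), hρA, hσ.mul (hτ.mul (hρ.mono (by omega) le_rfl)), ?_, hsr⟩, n4, n5,
        hst₂.trans hst₃⟩
      intro i hi₁ hi₂
      simp only [Equiv.Perm.mul_apply]
      by_cases hiq : q + 1 ≤ i
      · exact hsl i hiq hi₂
      · have h₁ := hr (ρ t) (hρ.mem hqt hthi).1 (hρ.mem hqt hthi).2
        rw [hρ i (by omega)]
        rcases Nat.lt_or_eq_of_le (Nat.lt_succ_iff.1 (not_le.1 hiq)) with h' | rfl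
        · exact ((hl i hi₁ h').trans h₁).le
        · rw [hqm]
          exact h₁.le
    · have hqt : t = q := by
        by_contra hc
        have : q < t := by omega
        simp [Expr.eval, Op.eval, k4, k7, this] at h
      subst hqt
      refine Runs.straight trivial (by simp [Cmd.scost]) ⟨⟨σ * τ, hτA, hσ.mul hτ, ?_, ?_⟩, k4, k5,
        hst₂⟩
      · intro i hi₁ hi₂
        simp only [Equiv.Perm.mul_apply, hqm]
        exact (hl i hi₁ hi₂).le
      · intro i hi₁ hi₂
        simp only [Equiv.Perm.mul_apply, hqm]
        exact (hr i hi₁ hi₂).le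

end Specs

/-! ## Partition of the array into buckets -/

/-- Stores the least power of two that is at least `reg 1` in `reg 15` and its exponent in
`reg 18`. -/
def computePower : Cmd :=
  (.assign 15 (.lit 1) ;; .assign 18 (.lit 0)) ;;
  .loop (.op .lt (.reg 15) (.reg 1))
    (.assign 15 (.op .add (.reg 15) (.reg 15)) ;; .assign 18 (.op .add (.reg 18) (.lit 1)))

/-- Splits every block of length `2 * reg 19` of array `3` into a lower and an upper half. -/
def halveBlocks : Cmd :=
  .loop (.op .lt (.op .add (.reg 20) (.reg 19)) (.reg 0))
    ((.assign 2 (.reg 20) ;; .assign 4 (.op .add (.reg 20) (.reg 19)) ;;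
      .assign 20 (.op .add (.reg 4) (.reg 19)) ;;
      .cond (.op .lt (.reg 20) (.reg 0)) (.assign 3 (.reg 20)) (.assign 3 (.reg 0))) ;;
      .call 0)

/-- Partitions array `3` into sorted blocks of length `reg 16`. -/
def sortBlocks : Cmd :=
  .assign 17 (.lit 0) ;;
  .upto 17 18 ((.assign 15 (.op .div (.reg 15) (.lit 2)) ;;
    .assign 19 (.op .mul (.reg 16) (.reg 15)) ;; .assign 20 (.lit 0)) ;; halveBlocks)

/-- All elements before `x` are less than all elements from `x` on. -/
def Cut (n : ℕ) (w : ℕ → ℕ) (x : ℕ) : Prop := ∀ i j, i < x → x ≤ j → j < n → w i < w j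

theorem Cut.of_le {n x : ℕ} (w : ℕ → ℕ) (h : n ≤ x) : Cut n w x := fun _ _ _ _ _ => by omega

theorem Cut.zero (n : ℕ) (w : ℕ → ℕ) : Cut n w 0 := fun _ _ _ _ _ => by omega

theorem Cut.perm {n x lo hi : ℕ} {w : ℕ → ℕ} {σ : Equiv.Perm ℕ} (h : Cut n w x)
    (hσ : SupportedOn σ lo hi) (hhi : hi ≤ n) (hx : x ≤ lo ∨ hi ≤ x) :
    Cut n (fun i => w (σ i)) x := by
  have key : ∀ i, (i < x → σ i < x) ∧ (x ≤ i → i < n → x ≤ σ i ∧ σ i < n) := by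
    intro i
    by_cases hi' : lo ≤ i ∧ i < hi
    · have := hσ.mem hi'.1 hi'.2
      omega
    · rw [hσ i (by omega)]
      omega
  intro i j hi hj hjn
  exact h _ _ ((key i).1 hi) ((key j).2 hj hjn).1 ((key j).2 hj hjn).2

/-- Pairs with an element outside the window are handled by the cuts at its two ends, pairs inside
by the split. Distinctness of the keys makes the inequality strict. -/
theorem Cut.of_splitAt {n lo hi t : ℕ} {w : ℕ → ℕ} {σ : Equiv.Perm ℕ} (hlo : Cut n w lo)
    (hhi : Cut n w hi) (hσ : SupportedOn σ lo hi) (hn : hi ≤ n)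
    (hsp : SplitAt (fun i => w (σ i)) lo hi t) (h₁ : lo ≤ t) (h₂ : t < hi)
    (hinj : ∀ i j, i < n → j < n → w (σ i) = w (σ j) → i = j) :
    Cut n (fun i => w (σ i)) t := by
  intro i j hit hj hjn
  by_cases hil : i < lo
  · exact hlo.perm hσ hn (Or.inl le_rfl) i j hil (by omega) hjn
  by_cases hjh : hi ≤ j
  · exact hhi.perm hσ hn (Or.inr le_rfl) i j (by omega) hjh hjn
  refine lt_of_le_of_ne ((hsp.1 i (by omega) hit).trans ?_) fun h => ?_
  · rcases Nat.lt_or_eq_of_le hj with h | rfl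
    · exact hsp.2 j h (by omega)
    · exact le_rfl
  · have := hinj i j (by omega) hjn h
    omega

/-! ### Sorting the array into blocks by repeated halving. -/

section Specs

variable {W n k : ℕ} {le : ℕ → ℕ → Bool} {procs : List Cmd} {v : ℕ → ℕ}

theorem Compares.inj_window (hv : Compares n le v) {A : ℕ → ℕ} (hA : GoodWindow n A 0 n) :
    ∀ i j, i < n → j < n → v (A i) = v (A j) → i = j := fun i j hi hj h =>
  hA.inj i j (Nat.zero_le _) hi (Nat.zero_le _) hj
    (hv.inj _ _ (hA.lt i (Nat.zero_le _) hi) (hA.lt j (Nat.zero_le _) hj) h)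

theorem two_pow_clog_le (hk : 1 ≤ k) : 2 ^ Nat.clog 2 k ≤ 2 * k := by
  rcases Nat.eq_zero_or_pos (Nat.clog 2 k) with h | h
  · rw [h]; omega
  · have := (Nat.lt_clog_iff_pow_lt (b := 2) (by omega)).1 (Nat.sub_one_lt_of_lt h)
    rw [show Nat.clog 2 k = Nat.clog 2 k - 1 + 1 by omega, pow_succ]
    omega

theorem computePower_spec (hk : 1 ≤ k) (hW : 2 * k + 10 ≤ W) {s : State} (h1 : s.reg 1 = k) {L : ℕ}
    (hL : L = Nat.clog 2 k) : Runs W le procs computePower s (12 * L + 10) (fun s' =>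
      (s'.reg 15 = 2 ^ L ∧ s'.reg 18 = L) ∧ Frame [15, 18] [] s s') := by
  have hkL : k ≤ 2 ^ L := hL ▸ Nat.le_pow_clog (by omega) k
  have hlt : ∀ j < L, 2 ^ j < k := fun j hj => by
    rw [hL] at hj
    exact (Nat.lt_clog_iff_pow_lt (by omega)).1 hj
  refine Runs.frame ?_ _ _ False (fun h => h.elim) (by simp [computePower, Cmd.Writes])
  refine Runs.seq (T₁ := 4) (T₂ := 12 * L + 6) (Runs.straight (Q := fun s' =>
    s' = (s.setReg 15 1).setReg 18 0) ?_ (by simp [Cmd.scost, Expr.cost])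
    (by simp [Cmd.sem, Expr.eval])) ?_ (by omega)
  · simp only [Cmd.Ok, Expr.Fits]; omega
  rintro _ rfl
  refine Runs.loop (fun b s' => ∃ j ≤ L, s'.reg 15 = 2 ^ j ∧ s'.reg 18 = j ∧ s'.reg 1 = k ∧
    b = 12 * (L - j) + 6) ?_ ?_ ?_ _ _ ⟨0, by omega, by simp, by simp, by simpa, by omega⟩
  · rintro b s' -
    exact Expr.fits_lt (by omega) trivial trivial
  · rintro b s' ⟨j, hj, h15, h18, h1, rfl⟩ hne
    have hjL : j < L := by
      rcases Nat.lt_or_eq_of_le hj with h | rfl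
      · exact h
      · simp [Expr.eval, Op.eval, h15, h1, not_lt.2 hkL] at hne
    have hpow := hlt j hjL
    have hj2 : j < 2 ^ j := Nat.lt_two_pow_self
    refine ⟨12 * (L - (j + 1)) + 6, 8, by simp only [Expr.cost]; omega, Runs.straight ?_
      (by simp [Cmd.scost, Expr.cost]) ⟨j + 1, hjL, ?_, ?_, ?_, rfl⟩⟩
    · simp [Cmd.Ok, Cmd.sem, Expr.Fits, Expr.eval, Op.eval, h15, h18]
      omega
    · simp [Cmd.sem, Expr.eval, Op.eval, h15, pow_succ]
      omega
    · simp [Cmd.sem, Expr.eval, Op.eval, h18]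
    · simp [Cmd.sem, h1]
  · rintro b s' ⟨j, hj, h15, h18, h1, rfl⟩ h0
    have hjL : j = L := by
      rcases Nat.lt_or_eq_of_le hj with h | rfl
      · have := hlt j h
        simp [Expr.eval, Op.eval, h15, h1, this] at h0
      · rfl
    subst hjL
    exact ⟨by simp [Expr.cost], h15, h18⟩

theorem halveBlocks_writes : Cmd.Writes (20 :: selectRegs) selectArrays True halveBlocks := by
  simp [halveBlocks, Cmd.Writes, selectRegs]

theorem select_writes_of_subset {R X : List ℕ} (hR : selectRegs ⊆ R) (hX : selectArrays ⊆ X) :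
    Cmd.Writes R X True select := by
  have : ∀ c : Cmd, Cmd.Writes selectRegs selectArrays True c → Cmd.Writes R X True c := by
    intro c
    induction c with
    | skip => exact id
    | assign x e => exact fun h => hR h
    | store a i e => exact fun h => hX h
    | seq c₁ c₂ ih₁ ih₂ => exact fun h => ⟨ih₁ h.1, ih₂ h.2⟩
    | cond e c₁ c₂ ih₁ ih₂ => exact fun h => ⟨ih₁ h.1, ih₂ h.2⟩
    | loop e c ih => exact ih
    | call p => exact id
  exact this _ select_writes

/-- Selecting at the midpoint of a block between two cuts creates a cut there and keeps all others.
A last block of at most `B` elements has no upper half and is skipped. -/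
theorem halveBlocks_spec (hv : Compares n le v) {B : ℕ} (hW : 4 * n + 3 * B + 100 ≤ W)
    (hB : 1 ≤ B) {s : State} (h0 : s.reg 0 = n) (h5 : s.reg 5 = 0) (h19 : s.reg 19 = B)
    (h20 : s.reg 20 = 0) (hA : GoodWindow n (s.cell 3) 0 n)
    (hcut : ∀ b, Cut n (fun i => v (s.cell 3 i)) (b * (2 * B))) :
    Runs W le [select] halveBlocks s (4100 * n + 6) (fun s' =>
      (GoodWindow n (s'.cell 3) 0 n ∧ s'.reg 5 = 0 ∧
        ∀ b, Cut n (fun i => v (s'.cell 3 i)) (b * B)) ∧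
      Frame (20 :: selectRegs) selectArrays s s') := by
  have hP : True → ∀ c ∈ [select], c.Writes (20 :: selectRegs) selectArrays True := by
    intro _ c hc
    rw [List.mem_singleton.1 hc]
    exact select_writes_of_subset (by simp) (by simp)
  refine Runs.frame ?_ _ _ True hP halveBlocks_writes
  -- Here `a` is the number of finished blocks. The clause on `a - 1` keeps the sum in the test
  -- below `n + 2 * B`, so that it is a word. A call treats at least two elements, so 100 extra
  -- steps per element pay for the overhead of the round.
  refine Runs.loop (fun b s' => ∃ a, s'.reg 20 = a * (2 * B) ∧ s'.reg 5 = 0 ∧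
    GoodWindow n (s'.cell 3) 0 n ∧ (∀ b, Cut n (fun i => v (s'.cell 3 i)) (b * (2 * B))) ∧
    (∀ b < a, Cut n (fun i => v (s'.cell 3 i)) (b * (2 * B) + B)) ∧ s'.reg 0 = n ∧
    s'.reg 19 = B ∧ (0 < a → (a - 1) * (2 * B) + B < n) ∧
    b = 4100 * (n - a * (2 * B)) + 6) ?_ ?_ ?_ _ _
    ⟨0, by simpa, h5, hA, hcut, by simp, h0, h19, by simp, by simp⟩
  · rintro b s' ⟨a, e20, e5, gA, c₁, c₂, e0, e19, ha, rfl⟩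
    refine Expr.fits_lt (by omega) ⟨trivial, trivial, ?_⟩ trivial
    simp only [Expr.eval, Op.eval, e20, e19]
    rcases Nat.eq_zero_or_pos a with rfl | h
    · omega
    · have := ha h
      obtain ⟨c, rfl⟩ : ∃ c, a = c + 1 := ⟨a - 1, by omega⟩
      rw [Nat.add_sub_cancel] at this
      rw [add_mul]
      omega
  · rintro b s' ⟨a, e20, e5, gA, c₁, c₂, e0, e19, ha, rfl⟩ hne
    obtain ⟨st, hst⟩ : ∃ st, st = a * (2 * B) := ⟨_, rfl⟩
    have hst' : (a + 1) * (2 * B) = st + 2 * B := by rw [hst]; ring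
    rw [← hst] at e20 ⊢
    have hlt : st + B < n := by
      by_contra hc
      simp [Expr.eval, Op.eval, e20, e19, e0, hc] at hne
    obtain ⟨hi, hhi⟩ : ∃ hi, hi = min (st + 2 * B) n := ⟨_, rfl⟩
    refine ⟨4100 * (n - (st + 2 * B)) + 6, 4000 * (hi - st) + 30,
      by simp only [Expr.cost]; omega, ?_⟩
    refine Runs.seq (T₁ := 22) (T₂ := 4000 * (hi - st)) (Runs.straight (Q := fun s₁ =>
      s₁.reg 2 = st ∧ s₁.reg 3 = hi ∧ s₁.reg 4 = st + B ∧ s₁.reg 5 = 0 ∧ s₁.cell = s'.cell ∧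
      s₁.reg 20 = st + 2 * B ∧ s₁.reg 0 = n ∧ s₁.reg 19 = B) ?_
      (by simp [Cmd.scost, Expr.cost]) ?_) ?_ (by omega)
    · simp [Cmd.Ok, Cmd.sem, Expr.Fits, Expr.eval, Op.eval, e20, e19, e0]
      refine ⟨by omega, by omega, ?_⟩
      split_ifs <;> omega
    · by_cases hc : st + B + B < n
      · simp [Cmd.sem, Expr.eval, Op.eval, e20, e19, e0, e5, hc]
        omega
      · simp [Cmd.sem, Expr.eval, Op.eval, e20, e19, e0, e5, hc]
        omega
    rintro s₁ ⟨k2, k3, k4, k5, kc, k20, k0, k19⟩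
    refine ((select_spec hv (Bd := n) (procs := [select]) (by omega) rfl (hi - st) s₁ st hi (st + B) 0 rfl k2 k3 k4
      k5 (by omega) (by omega) (by omega) (by omega) ?_).frame selectRegs selectArrays True
      (by simpa using select_writes) trivial).mono le_rfl ?_
    · rw [kc]
      exact gA.mono (by omega) (by omega)
    rintro s₂ ⟨⟨⟨σ, hσA, hσ, hsp⟩, -, m5, -⟩, F⟩
    rw [kc] at hσA hsp
    have hhin : hi ≤ n := by omega
    have gA' : GoodWindow n (s'.cell 3 ∘ σ) 0 n := gA.comp (hσ.mono (by omega) hhin)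
    have hinj := hv.inj_window gA'
    have hcs := c₁ a
    rw [← hst] at hcs
    have hch : Cut n (fun i => v (s'.cell 3 i)) hi := by
      rcases le_total (st + 2 * B) n with h | h
      · rw [hhi, min_eq_left h, ← hst']
        exact c₁ _
      · rw [hhi, min_eq_right h]
        exact .of_le _ le_rfl
    refine ⟨a + 1, ?_, m5, ?_, ?_, ?_, ?_, ?_, ?_, ?_⟩
    · rw [hst', F.reg 20 (by simp [selectRegs]), k20]
    · rwa [hσA]
    · intro b
      rw [hσA]
      refine (c₁ b).perm hσ hhin ?_
      rcases Nat.lt_or_ge a b with h | h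
      · right
        have : (a + 1) * (2 * B) ≤ b * (2 * B) := Nat.mul_le_mul_right _ h
        omega
      · left
        rw [hst]
        exact Nat.mul_le_mul_right _ h
    · intro b hb
      rw [hσA]
      rcases Nat.lt_succ_iff_lt_or_eq.1 hb with h | rfl
      · refine (c₂ b h).perm hσ hhin (Or.inl ?_)
        have : (b + 1) * (2 * B) ≤ a * (2 * B) := Nat.mul_le_mul_right _ h
        rw [add_mul] at this
        omega
      · rw [← hst]
        exact Cut.of_splitAt hcs hch hσ hhin hsp (by omega) (by omega) hinj
    · rw [F.reg 0 (by simp [selectRegs]), k0]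
    · rw [F.reg 19 (by simp [selectRegs]), k19]
    · intro _
      rw [Nat.add_sub_cancel, ← hst]
      exact hlt
    · rw [hst']
  · rintro b s' ⟨a, e20, e5, gA, c₁, c₂, e0, e19, ha, rfl⟩ hz
    have hge : n ≤ a * (2 * B) + B := by
      by_contra hc
      simp [Expr.eval, Op.eval, e20, e19, e0, not_le.1 hc] at hz
    refine ⟨by simp [Expr.cost], gA, e5, fun b => ?_⟩
    rcases Nat.even_or_odd' b with ⟨c, rfl | rfl⟩
    · rw [show 2 * c * B = c * (2 * B) by ring]
      exact c₁ c
    · rw [show (2 * c + 1) * B = c * (2 * B) + B by ring]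
      rcases Nat.lt_or_ge c a with h | h
      · exact c₂ c h
      · refine .of_le _ ?_
        have : a * (2 * B) ≤ c * (2 * B) := Nat.mul_le_mul_right _ h
        omega

/-- Round `i` halves blocks of length `m * 2 ^ (L - i)`. Each of the `L` rounds is linear, because
the blocks are disjoint and selection is linear. -/
theorem sortBlocks_spec (hv : Compares n le v) {L m : ℕ} (hW : 4 * n + 6 * (m * 2 ^ L) + 100 ≤ W)
    (hm : 1 ≤ m) (hmn : n ≤ m * 2 ^ L)
    {s : State} (h0 : s.reg 0 = n) (h5 : s.reg 5 = 0) (h15 : s.reg 15 = 2 ^ L) (h16 : s.reg 16 = m)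
    (h18 : s.reg 18 = L) (hA : GoodWindow n (s.cell 3) 0 n) :
    Runs W le [select] sortBlocks s (L * (4100 * n + 40) + 10) (fun s' =>
      (GoodWindow n (s'.cell 3) 0 n ∧ s'.reg 5 = 0 ∧
        ∀ b, Cut n (fun i => v (s'.cell 3 i)) (b * m)) ∧
      Frame (17 :: 15 :: 19 :: 20 :: selectRegs) selectArrays s s') := by
  have hP : True → ∀ c ∈ [select], c.Writes (15 :: 19 :: 20 :: selectRegs) selectArrays True := by
    intro _ c hc
    rw [List.mem_singleton.1 hc]
    exact select_writes_of_subset (by intro x; simp +contextual) (by simp)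
  have hmL : ∀ i, i ≤ L → m * 2 ^ i ≤ m * 2 ^ L := fun i hi =>
    Nat.mul_le_mul_left _ (Nat.pow_le_pow_right (by omega) hi)
  have hL : L < m * 2 ^ L := Nat.lt_two_pow_self.trans_le (Nat.le_mul_of_pos_left _ hm)
  refine Runs.seq (T₁ := 2) (T₂ := L * (4100 * n + 40) + 8) (Runs.straight (Q := fun s' =>
    s' = s.setReg 17 0) ?_ (by simp [Cmd.scost, Expr.cost])
    (by simp [Cmd.sem, Expr.eval])) ?_ (by omega)
  · simp only [Cmd.Ok, Expr.Fits]; omega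
  rintro _ rfl
  refine Runs.upto (a := 0) (N := L) (15 :: 19 :: 20 :: selectRegs) selectArrays True
    (fun i s' => s'.reg 15 = 2 ^ (L - i) ∧ s'.reg 5 = 0 ∧ GoodWindow n (s'.cell 3) 0 n ∧
      ∀ b, Cut n (fun i => v (s'.cell 3 i)) (b * (m * 2 ^ (L - i)))) (4100 * n + 30) hP ?_
      (by simp [selectRegs]) (by simp [selectRegs]) (by simp) (by omega) (by simp) (by simpa)
      (Nat.zero_le _) ?_ ?_ ?_ ?_
  · simp [Cmd.Writes, halveBlocks, selectRegs]
  -- At the start one block covers the array: every multiple of its length is 0 or at least `n`, and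
  -- cuts there are trivial.
  · refine ⟨by simpa, by simpa, hA, fun b => ?_⟩
    rcases Nat.eq_zero_or_pos b with rfl | h
    · rw [zero_mul]
      exact .zero _ _
    · exact .of_le _ (hmn.trans (Nat.le_mul_of_pos_left _ h))
  · rintro i s₁ - hi h17 ⟨e15, e5, gA, hcut⟩ F
    have e0 : s₁.reg 0 = n := by rw [F.reg 0 (by simp [selectRegs])]; simpa
    have e16 : s₁.reg 16 = m := by rw [F.reg 16 (by simp [selectRegs])]; simpa
    have hpow : 2 ^ (L - i) = 2 * 2 ^ (L - (i + 1)) := by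
      rw [← pow_succ', show L - (i + 1) + 1 = L - i by omega]
    have hle := hmL (L - (i + 1)) (by omega)
    have hdiv : 2 ^ (L - i) / 2 = 2 ^ (L - (i + 1)) := by omega
    have hpos : 0 < 2 ^ (L - (i + 1)) := by positivity
    have hle' : 2 ^ (L - (i + 1)) ≤ m * 2 ^ (L - (i + 1)) := Nat.le_mul_of_pos_left _ hm
    refine Runs.seq (T₁ := 12) (T₂ := 4100 * n + 6) (Runs.straight (Q := fun s' =>
      s' = ((s₁.setReg 15 (2 ^ (L - (i + 1)))).setReg 19 (m * 2 ^ (L - (i + 1)))).setReg 20 0) ?_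
      (by simp [Cmd.scost, Expr.cost]) ?_) ?_ (by omega)
    · simp [Cmd.Ok, Cmd.sem, Expr.Fits, Expr.eval, Op.eval, e15, e16, hdiv]
      omega
    · simp [Cmd.sem, Expr.eval, Op.eval, e15, e16, hdiv]
    rintro _ rfl
    refine (halveBlocks_spec hv (B := m * 2 ^ (L - (i + 1))) (by omega) (by omega) (by simpa)
      (by simpa) (by simp) (by simp) (by simpa using gA) fun b => ?_).mono le_rfl ?_
    · rw [show 2 * (m * 2 ^ (L - (i + 1))) = m * 2 ^ (L - i) by rw [hpow]; ring]
      exact hcut b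
    · rintro s₂ ⟨⟨g₂, k5, k⟩, F₂⟩
      refine ⟨?_, by simpa using k5, g₂, k⟩
      rw [State.setReg_reg, if_neg (by simp), F₂.reg 15 (by simp [selectRegs])]
      simp
  · have := Nat.mul_le_mul_left L (show 4100 * n + 30 + 8 ≤ 4100 * n + 40 by omega)
    rw [Nat.sub_zero]
    omega
  · rintro s' ⟨-, e5, gA, hcut⟩ - F
    refine ⟨⟨gA, e5, fun b => by simpa using hcut b⟩, fun x hx => ?_, F.cell⟩
    rw [F.reg x hx, State.setReg_reg, if_neg]
    rintro rfl
    simp at hx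

end Specs

/-! ## Stable partitions -/

theorem cnt_self (p : ℕ → Prop) (a : ℕ) : cnt p a a = 0 := by simp [cnt]

theorem cnt_succ_of_pos {p : ℕ → Prop} {a b : ℕ} (hab : a ≤ b) (h : p b) :
    cnt p a (b + 1) = cnt p a b + 1 := by
  rw [← cnt_add p hab (Nat.le_succ b)]
  simp [cnt, Finset.filter_singleton, h]

theorem cnt_succ_of_neg {p : ℕ → Prop} {a b : ℕ} (hab : a ≤ b) (h : ¬p b) :
    cnt p a (b + 1) = cnt p a b := by
  rw [← cnt_add p hab (Nat.le_succ b)]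
  simp [cnt, Finset.filter_singleton, h]

theorem cnt_add_cnt_not (p : ℕ → Prop) (a b : ℕ) :
    cnt p a b + cnt (fun i => ¬p i) a b = b - a := by
  classical
  rw [cnt, cnt, Finset.card_filter_add_card_filter_not]
  simp

theorem cnt_add_cnt_disjoint {p q r : ℕ → Prop} (a b : ℕ) (h : ∀ i, r i ↔ p i ∨ q i)
    (hd : ∀ i, ¬(p i ∧ q i)) : cnt p a b + cnt q a b = cnt r a b := by
  classical
  rw [cnt, cnt, cnt, ← Finset.card_union_of_disjoint, ← Finset.filter_or]
  · congr 1
    ext i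
    simp [h]
  · rw [Finset.disjoint_filter]
    exact fun i _ hp hq => hd i ⟨hp, hq⟩

theorem cnt_le (p : ℕ → Prop) (a b : ℕ) : cnt p a b ≤ b - a := by
  have := cnt_add_cnt_not p a b
  omega

/-- Ranks of the elements with property `p` in `[l, r)` form an interval. -/
theorem exists_cnt_eq_iff (p : ℕ → Prop) {l r : ℕ} (h : l ≤ r) (y : ℕ) :
    (∃ x, l ≤ x ∧ x < r ∧ p x ∧ cnt p 0 x = y) ↔ cnt p 0 l ≤ y ∧ y < cnt p 0 r := by
  induction r, h using Nat.le_induction with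
  | base =>
    constructor
    · rintro ⟨x, h₁, h₂, -⟩; omega
    · rintro ⟨h₁, h₂⟩; omega
  | succ r hr ih =>
    have hmono : cnt p 0 l ≤ cnt p 0 r := cnt_mono le_rfl hr fun _ _ _ h => h
    constructor
    · rintro ⟨x, h₁, h₂, hp, rfl⟩
      rcases Nat.lt_succ_iff_lt_or_eq.1 h₂ with h | rfl
      · have := ih.1 ⟨x, h₁, h, hp, rfl⟩
        have h' : cnt p 0 r ≤ cnt p 0 (r + 1) := cnt_mono le_rfl (by omega) fun _ _ _ h => h
        omega
      · rw [cnt_succ_of_pos (Nat.zero_le _) hp]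
        omega
    · rintro ⟨h₁, h₂⟩
      by_cases hy : y < cnt p 0 r
      · obtain ⟨x, a, b, c⟩ := ih.2 ⟨h₁, hy⟩
        exact ⟨x, a, by omega, c⟩
      · by_cases hp : p r
        · rw [cnt_succ_of_pos (Nat.zero_le _) hp] at h₂
          exact ⟨r, hr, by omega, hp, by omega⟩
        · rw [cnt_succ_of_neg (Nat.zero_le _) hp] at h₂
          omega

/-- The index of `i` after the stable partition of `[0, n)` by `p`. -/
def StableIndex (p : ℕ → Prop) (n : ℕ) (f : ℕ → ℕ) : Prop :=
  ∀ i < n, (p i → f i = cnt p 0 i) ∧ (¬p i → f i = cnt p 0 n + (i - cnt p 0 i))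

/-- This makes the elements without the property symmetric to those with it, so facts on ranks apply
to both parts of a stable partition. -/
theorem sub_cnt (p : ℕ → Prop) (i : ℕ) : i - cnt p 0 i = cnt (fun i => ¬p i) 0 i := by
  have := cnt_add_cnt_not p 0 i
  omega

theorem cnt_lt_cnt {p : ℕ → Prop} {i j : ℕ} (h : i < j) (hi : p i) : cnt p 0 i < cnt p 0 j := by
  have : cnt p 0 (i + 1) ≤ cnt p 0 j := cnt_mono le_rfl (by omega) fun _ _ _ h => h
  rw [cnt_succ_of_pos (Nat.zero_le _) hi] at this
  omega

theorem StableIndex.lt {p : ℕ → Prop} {n : ℕ} {f : ℕ → ℕ} (hf : StableIndex p n f) {i : ℕ}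
    (hi : i < n) : f i < n := by
  have h := cnt_add_cnt_not p 0 n
  by_cases hp : p i
  · rw [(hf i hi).1 hp]
    have := cnt_lt_cnt hi hp
    omega
  · rw [(hf i hi).2 hp, sub_cnt]
    have := cnt_lt_cnt (p := fun i => ¬p i) hi hp
    omega

theorem StableIndex.injOn {p : ℕ → Prop} {n : ℕ} {f : ℕ → ℕ} (hf : StableIndex p n f) :
    Set.InjOn f (Set.Iio n) := by
  intro i hi j hj h
  rw [Set.mem_Iio] at hi hj
  have key : ∀ {q : ℕ → Prop}, q i → q j → cnt q 0 i = cnt q 0 j → i = j := by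
    intro q hqi hqj h
    rcases lt_trichotomy i j with h' | h' | h'
    · have := cnt_lt_cnt h' hqi
      omega
    · exact h'
    · have := cnt_lt_cnt h' hqj
      omega
  by_cases hpi : p i <;> by_cases hpj : p j
  · exact key hpi hpj (by rw [← (hf i hi).1 hpi, h, (hf j hj).1 hpj])
  · rw [(hf i hi).1 hpi, (hf j hj).2 hpj] at h
    have := cnt_lt_cnt hi hpi
    omega
  · rw [(hf i hi).2 hpi, (hf j hj).1 hpj] at h
    have := cnt_lt_cnt hj hpj
    omega
  · rw [(hf i hi).2 hpi, (hf j hj).2 hpj, sub_cnt, sub_cnt] at h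
    exact key (q := fun i => ¬p i) hpi hpj (by omega)

/-- The window `[l, r)` of `cur` consists of the elements of `[a, b)` with `u y = p`, for some `p`,
and its element of rank `t` with respect to any refinement of `u` has rank `T` in `[a, b)`. -/
structure Narrowed (n : ℕ) (u cur : ℕ → ℕ) (a b T l r t : ℕ) : Prop where
  le : l ≤ r
  le_n : r ≤ n
  lt : t < r - l
  exists_class : ∃ p, (∀ y, (∃ x, l ≤ x ∧ x < r ∧ cur x = y) ↔ (a ≤ y ∧ y < b ∧ u y = p)) ∧
    cnt (fun y => u y < p) a b + t = T

/-- The map `cur` is injective, so it is a bijection from the window onto the elements that the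
window holds. -/
theorem Narrowed.cnt_eq {n : ℕ} {cur : ℕ → ℕ} {a b l r : ℕ} {P Q : ℕ → Prop} {R : ℕ → Prop}
    (hinj : GoodWindow n cur 0 n) (hr : r ≤ n)
    (hset : ∀ y, (∃ x, l ≤ x ∧ x < r ∧ cur x = y) ↔ (a ≤ y ∧ y < b ∧ P y))
    (hQ : ∀ x, l ≤ x → x < r → (Q x ↔ R (cur x))) :
    cnt Q l r = cnt (fun y => P y ∧ R y) a b := by
  classical
  refine Finset.card_bij (fun x _ => cur x) ?_ ?_ ?_
  · intro x hx
    simp only [Finset.mem_filter, Finset.mem_Ico] at hx ⊢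
    obtain ⟨h₁, h₂, h₃⟩ := (hset (cur x)).1 ⟨x, hx.1.1, hx.1.2, rfl⟩
    exact ⟨⟨h₁, h₂⟩, h₃, (hQ x hx.1.1 hx.1.2).1 hx.2⟩
  · intro x hx x' hx' h
    simp only [Finset.mem_filter, Finset.mem_Ico] at hx hx'
    exact hinj.inj _ _ (Nat.zero_le _) (by omega) (Nat.zero_le _) (by omega) h
  · intro y hy
    simp only [Finset.mem_filter, Finset.mem_Ico] at hy
    obtain ⟨x, h₁, h₂, rfl⟩ := (hset y).2 ⟨hy.1.1, hy.1.2, hy.2.1⟩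
    exact ⟨x, by simpa [h₁, h₂] using (hQ x h₁ h₂).2 hy.2.2, rfl⟩

/-- One level of the descent: `u` is refined by one binary digit, and `cur` is stably partitioned
by this digit. -/
theorem Narrowed.step {n : ℕ} {u cur cur' f : ℕ → ℕ} {a b T l r t : ℕ} {z : ℕ → Prop}
    (h : Narrowed n (fun y => u y / 2) cur a b T l r t) (hinj : GoodWindow n cur 0 n)
    (hz : ∀ x < n, z x ↔ u (cur x) % 2 = 0)
    (hf : StableIndex z n f) (hcur' : ∀ x < n, cur' (f x) = cur x) :
    (t < cnt z 0 r - cnt z 0 l → Narrowed n u cur' a b T (cnt z 0 l) (cnt z 0 r) t) ∧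
    (¬t < cnt z 0 r - cnt z 0 l → Narrowed n u cur' a b T (cnt z 0 n + (l - cnt z 0 l))
      (cnt z 0 n + (r - cnt z 0 r)) (t - (cnt z 0 r - cnt z 0 l))) := by
  obtain ⟨hlr, hrn, htr, p, hset, hcnt⟩ := h
  have hmono : cnt z 0 l ≤ cnt z 0 r := cnt_mono le_rfl hlr fun _ _ _ h => h
  have hmono' : cnt z 0 r ≤ cnt z 0 n := cnt_mono le_rfl hrn fun _ _ _ h => h
  have hzl : cnt z 0 l + cnt z l r = cnt z 0 r := cnt_add z (Nat.zero_le _) hlr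
  have hn := cnt_add_cnt_not z 0 n
  have hr := cnt_add_cnt_not z 0 r
  have hlz := cnt_add_cnt_not z 0 l
  have hlrz := cnt_add_cnt_not z l r
  have hrn' : cnt (fun i => ¬z i) 0 r ≤ cnt (fun i => ¬z i) 0 n :=
    cnt_mono le_rfl hrn fun _ _ _ h => h
  have hlr' : cnt (fun i => ¬z i) 0 l ≤ cnt (fun i => ¬z i) 0 r :=
    cnt_mono le_rfl hlr fun _ _ _ h => h
  -- The elements of class `p` with digit zero form class `2 * p` of the refinement. This is the
  -- number to compare with `t`.
  have hclass : cnt z l r = cnt (fun y => u y = 2 * p) a b := by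
    rw [Narrowed.cnt_eq hinj hrn hset (Q := z) (R := fun y => u y % 2 = 0)
      fun x _ h₂ => hz x (by omega)]
    exact cnt_congr fun i _ _ => by omega
  constructor
  · intro ht
    refine ⟨hmono, by omega, ht, 2 * p, fun y => ?_, ?_⟩
    · rw [show (a ≤ y ∧ y < b ∧ u y = 2 * p) ↔ ((a ≤ y ∧ y < b ∧ u y / 2 = p) ∧ u y % 2 = 0) by
        omega, ← hset y]
      constructor
      · rintro ⟨x', h₁, h₂, rfl⟩
        obtain ⟨x, hx₁, hx₂, hzx, rfl⟩ := (exists_cnt_eq_iff z hlr x').2 ⟨h₁, h₂⟩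
        have hxn : x < n := by omega
        rw [← (hf x hxn).1 hzx, hcur' x hxn]
        exact ⟨⟨x, hx₁, hx₂, rfl⟩, (hz x hxn).1 hzx⟩
      · rintro ⟨⟨x, hx₁, hx₂, rfl⟩, hpar⟩
        have hxn : x < n := by omega
        have hzx := (hz x hxn).2 hpar
        obtain ⟨h₁, h₂⟩ := (exists_cnt_eq_iff z hlr _).1 ⟨x, hx₁, hx₂, hzx, rfl⟩
        refine ⟨cnt z 0 x, h₁, h₂, ?_⟩
        rw [← (hf x hxn).1 hzx, hcur' x hxn]
    · rw [← hcnt, cnt_congr fun i _ _ => (by omega : u i < 2 * p ↔ u i / 2 < p)]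
  · intro ht
    refine ⟨by omega, by omega, by omega, 2 * p + 1, fun y => ?_, ?_⟩
    · rw [show (a ≤ y ∧ y < b ∧ u y = 2 * p + 1) ↔
        ((a ≤ y ∧ y < b ∧ u y / 2 = p) ∧ ¬u y % 2 = 0) by omega, ← hset y, sub_cnt, sub_cnt]
      constructor
      · rintro ⟨x', h₁, h₂, rfl⟩
        obtain ⟨x, hx₁, hx₂, hzx, hx'⟩ := (exists_cnt_eq_iff (fun i => ¬z i) hlr
          (x' - cnt z 0 n)).2 (by omega)
        have hxn : x < n := by omega
        have : x' = f x := by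
          rw [(hf x hxn).2 hzx, sub_cnt]
          omega
        rw [this, hcur' x hxn]
        exact ⟨⟨x, hx₁, hx₂, rfl⟩, fun h => hzx ((hz x hxn).2 h)⟩
      · rintro ⟨⟨x, hx₁, hx₂, rfl⟩, hpar⟩
        have hxn : x < n := by omega
        have hzx : ¬z x := fun h => hpar ((hz x hxn).1 h)
        obtain ⟨h₁, h₂⟩ := (exists_cnt_eq_iff (fun i => ¬z i) hlr _).1 ⟨x, hx₁, hx₂, hzx, rfl⟩
        refine ⟨f x, ?_, ?_, hcur' x hxn⟩ <;> rw [(hf x hxn).2 hzx, sub_cnt] <;> omega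
    -- In the right branch the elements below class `2 * p + 1` are those below the old class
    -- together with class `2 * p`. The size of the latter is what `t` loses.
    · rw [← cnt_add_cnt_disjoint (p := fun y => u y / 2 < p) (q := fun y => u y = 2 * p) a b
        (fun i => by omega) (fun i => by omega), ← hclass, ← hcnt]
      omega

/-! ## Descent of the queries to buckets -/

/-- `1` if the digit with weight `reg 24` of the bucket of element `reg 21` of array `5` is `0`. -/
def zeroDigit : Expr :=
  .op .sub (.lit 1) (.op .sub (.op .div (.cell 4 (.cell 5 (.reg 21))) (.reg 24))
    (.op .mul (.lit 2) (.op .div (.op .div (.cell 4 (.cell 5 (.reg 21))) (.reg 24)) (.lit 2))))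

/-- Puts the number of elements with digit `0` in each prefix of array `5` into array `7`. -/
def countZeros : Cmd :=
  (.store 7 (.lit 0) (.lit 0) ;; .assign 21 (.lit 0)) ;;
  .upto 21 0 (.store 7 (.op .add (.reg 21) (.lit 1))
    (.op .add (.cell 7 (.reg 21)) zeroDigit))

/-- Stably partitions array `5` by the digit, by means of array `8`. -/
def permute : Cmd :=
  (.assign 22 (.cell 7 (.reg 0)) ;; .assign 21 (.lit 0)) ;;
  .upto 21 0 (.store 8 (.op .add (.op .mul zeroDigit (.cell 7 (.reg 21)))
      (.op .mul (.op .sub (.lit 1) zeroDigit)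
        (.op .add (.reg 22) (.op .sub (.reg 21) (.cell 7 (.reg 21))))))
    (.cell 5 (.reg 21))) ;;
  .assign 21 (.lit 0) ;;
  .upto 21 0 (.store 5 (.reg 21) (.cell 8 (.reg 21)))

/-- Updates the window and the rank of every query. -/
def descend : Cmd :=
  .assign 23 (.lit 0) ;;
  .upto 23 1
    (.assign 25 (.cell 7 (.cell 0 (.reg 23))) ;; .assign 26 (.cell 7 (.cell 1 (.reg 23))) ;;
      .cond (.op .lt (.cell 6 (.reg 23)) (.op .sub (.reg 26) (.reg 25)))
        (.store 0 (.reg 23) (.reg 25) ;; .store 1 (.reg 23) (.reg 26))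
        (.store 6 (.reg 23) (.op .sub (.cell 6 (.reg 23)) (.op .sub (.reg 26) (.reg 25))) ;;
          .store 0 (.reg 23) (.op .add (.reg 22) (.op .sub (.cell 0 (.reg 23)) (.reg 25))) ;;
          .store 1 (.reg 23) (.op .add (.reg 22) (.op .sub (.cell 1 (.reg 23)) (.reg 26)))))

/-- Descends through all binary digits of the buckets. -/
def findBuckets : Cmd :=
  .assign 17 (.lit 0) ;;
  .upto 17 18 (.assign 24 (.op .div (.reg 24) (.lit 2)) ;; countZeros ;; permute ;; descend)

/-! ### One level of the descent: prefix counts, stable partition, update of the queries. -/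

section Specs

variable {W n k : ℕ} {le : ℕ → ℕ → Bool} {procs : List Cmd}

/-- Element `x` of array `5` has digit `0` in weight `B`. -/
def ZeroDigit (B : ℕ) (s : State) (x : ℕ) : Prop := s.cell 4 (s.cell 5 x) / B % 2 = 0

/-- The machine has no remainder, so the parity of a quotient `q` is computed as `q - 2 * (q / 2)`.
-/
theorem zeroDigit_eval {s : State} {x B : ℕ} (hx : s.reg 21 = x) (hB : s.reg 24 = B) :
    (ZeroDigit B s x → zeroDigit.eval le s = 1) ∧ (¬ZeroDigit B s x → zeroDigit.eval le s = 0) := by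
  simp only [zeroDigit, Expr.eval, Op.eval, hx, hB, ZeroDigit]
  omega

theorem zeroDigit_fits {s : State} {x B : ℕ} (hW : 2 < W) (hx : s.reg 21 = x)
    (hB : s.reg 24 = B) (hb : s.cell 4 (s.cell 5 x) < W) : zeroDigit.Fits W le s := by
  have := Nat.div_le_self (s.cell 4 (s.cell 5 x)) B
  simp only [zeroDigit, Expr.Fits, Expr.eval, Op.eval, hx, hB, true_and]
  omega

theorem countZeros_spec (hW : n + 10 < W) {s : State} {B : ℕ} (h0 : s.reg 0 = n)
    (h24 : s.reg 24 = B) (hb : ∀ i < n, s.cell 4 (s.cell 5 i) < W) :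
    Runs W le procs countZeros s (n * 40 + 20) (fun s' =>
      (∀ i ≤ n, s'.cell 7 i = cnt (ZeroDigit B s) 0 i) ∧ Frame [21] [7] s s') := by
  refine Runs.frame ?_ _ _ False (fun h => h.elim) (by simp [countZeros, Cmd.Writes, Cmd.upto])
  refine Runs.seq (T₁ := 5) (T₂ := n * 40 + 4) (Runs.straight (Q := fun s' =>
    s' = (s.setCell 7 0 0).setReg 21 0) ?_ (by simp [Cmd.scost, Expr.cost])
    (by simp [Cmd.sem, Expr.eval])) ?_ (by omega)
  · simp only [Cmd.Ok, Expr.Fits]; omega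
  rintro _ rfl
  refine Runs.upto (a := 0) (N := n) [] [7] False (fun i s' =>
    ∀ j ≤ i, s'.cell 7 j = cnt (ZeroDigit B s) 0 j) 32 (fun h => h.elim)
    (by simp [Cmd.Writes]) (by simp) (by simp) (by simp) (by omega) (by simp) (by simpa)
    (by omega) (by simp [cnt_self]) ?_ (by omega) (fun s' h _ _ => h)
  intro i s' _ hi hx hI F
  have e24 : s'.reg 24 = B := by rw [F.reg 24 (by simp)]; simpa
  have e4 : s'.cell 4 = s.cell 4 := by rw [F.cell 4 (by simp)]; simp
  have e5 : s'.cell 5 = s.cell 5 := by rw [F.cell 5 (by simp)]; simp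
  have hz := zeroDigit_eval (le := le) hx e24
  simp only [ZeroDigit, e4, e5] at hz
  rw [← ZeroDigit] at hz
  have hfit : zeroDigit.Fits W le s' := zeroDigit_fits (by omega) hx e24 (by
    rw [e4, e5]; exact hb i hi)
  have hi7 := hI i le_rfl
  have hle := cnt_le (ZeroDigit B s) 0 i
  refine Runs.straight ?_ (by simp [Cmd.scost, Expr.cost, zeroDigit]) ?_
  · simp only [Cmd.Ok, Expr.Fits, Expr.eval, Op.eval, hfit, hx, hi7, true_and]
    by_cases h : ZeroDigit B s i
    · rw [hz.1 h]; omega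
    · rw [hz.2 h]; omega
  · intro j hj
    simp only [Cmd.sem, Expr.eval, Op.eval, hx, hi7, State.setReg_cell, State.setCell_cell,
      if_true]
    rcases Nat.lt_succ_iff_lt_or_eq.1 (Nat.lt_succ_of_le hj) with h | rfl
    · rw [Function.update_of_ne (by omega), hI j (by omega)]
    · rw [Function.update_self]
      by_cases h : ZeroDigit B s i
      · rw [cnt_succ_of_pos (Nat.zero_le _) h, hz.1 h]
      · rw [cnt_succ_of_neg (Nat.zero_le _) h, hz.2 h, add_zero]

theorem exists_stableIndex (p : ℕ → Prop) (n : ℕ) : ∃ f, StableIndex p n f := by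
  classical
  exact ⟨fun i => if p i then cnt p 0 i else cnt p 0 n + (i - cnt p 0 i), fun i _ =>
    ⟨fun h => by simp [h], fun h => by simp [h]⟩⟩

/-- The digit selects the target index by arithmetic instead of a branch, so each loop is a single
store and `Runs.fill` applies. The elements pass through array `8`, since moving them in place would
overwrite cells still to be read. -/
theorem permute_spec (hW : 2 * n + 10 < W) {s : State} {B : ℕ} (h0 : s.reg 0 = n)
    (h24 : s.reg 24 = B) (hb : ∀ i < n, s.cell 4 (s.cell 5 i) < W)
    (h7 : ∀ i ≤ n, s.cell 7 i = cnt (ZeroDigit B s) 0 i) {f : ℕ → ℕ}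
    (hf : StableIndex (ZeroDigit B s) n f) :
    Runs W le procs permute s (n * 100 + 30) (fun s' =>
      (s'.reg 22 = cnt (ZeroDigit B s) 0 n ∧ ∀ i < n, s'.cell 5 (f i) = s.cell 5 i) ∧
      Frame [21, 22] [5, 8] s s') := by
  refine Runs.frame ?_ _ _ False (fun h => h.elim) (by simp [permute, Cmd.Writes, Cmd.upto])
  refine Runs.seq (T₁ := 5) (T₂ := n * 100 + 20) (Runs.straight (Q := fun s' =>
    s' = (s.setReg 22 (cnt (ZeroDigit B s) 0 n)).setReg 21 0) ?_
    (by simp [Cmd.scost, Expr.cost])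
    (by simp [Cmd.sem, Expr.eval, h0, h7])) ?_ (by omega)
  · simp only [Cmd.Ok, Expr.Fits]
    exact ⟨trivial, by omega⟩
  rintro _ rfl
  have hcn := cnt_le (ZeroDigit B s) 0 n
  refine Runs.seq (T₁ := n * 80 + 4) (T₂ := n * 15 + 10) (R := fun s' =>
    (∀ i < n, s'.cell 8 (f i) = s.cell 5 i) ∧ s'.cell 5 = s.cell 5 ∧ s'.reg 0 = n ∧
      s'.reg 22 = cnt (ZeroDigit B s) 0 n) ?_ ?_ (by omega)
  · refine Runs.fill (N := n) f (s.cell 5) (by simp) (by omega) (by simp) (by simpa) hf.injOn ?_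
      (by simp [Expr.cost, zeroDigit]; omega) ?_
    · intro i s' hi hx F
      have e24 : s'.reg 24 = B := by rw [F.reg 24 (by simp)]; simpa
      have e22 : s'.reg 22 = cnt (ZeroDigit B s) 0 n := by rw [F.reg 22 (by simp)]; simp
      have e4 : s'.cell 4 = s.cell 4 := by rw [F.cell 4 (by simp)]; simp
      have e5 : s'.cell 5 = s.cell 5 := by rw [F.cell 5 (by simp)]; simp
      have e7 : s'.cell 7 i = cnt (ZeroDigit B s) 0 i := by
        rw [F.cell 7 (by simp)]; simp [h7 i hi.le]
      have hz := zeroDigit_eval (le := le) hx e24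
      simp only [ZeroDigit, e4, e5] at hz
      rw [← ZeroDigit] at hz
      have hfit : zeroDigit.Fits W le s' := zeroDigit_fits (by omega) hx e24 (by
        rw [e4, e5]; exact hb i hi)
      have hci := cnt_le (ZeroDigit B s) 0 i
      simp only [Expr.Fits, Expr.eval, Op.eval, hfit, hx, e7, e22, e5, true_and, and_true]
      by_cases hp : ZeroDigit B s i
      · simp [hz.1 hp, (hf i hi).1 hp]
        omega
      · simp [hz.2 hp, (hf i hi).2 hp]
        omega
    · intro s' hs' _ F
      refine ⟨hs', ?_, ?_, ?_⟩
      · rw [F.cell 5 (by simp)]; simp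
      · rw [F.reg 0 (by simp)]; simpa
      · rw [F.reg 22 (by simp)]; simp
  · rintro s₁ ⟨e8, e5, e0, e22⟩
    refine Runs.seq (T₁ := 2) (T₂ := n * 15 + 4) (Runs.straight (Q := fun s' =>
      s' = s₁.setReg 21 0) ?_ (by simp [Cmd.scost, Expr.cost])
      (by simp [Cmd.sem, Expr.eval])) ?_ (by omega)
    · simp only [Cmd.Ok, Expr.Fits]; omega
    rintro _ rfl
    refine Runs.fill (N := n) id (s₁.cell 8) (by simp) (by omega) (by simp) (by simpa)
      Function.injective_id.injOn ?_ (by simp [Expr.cost]; omega) ?_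
    · intro i s' hi hx F
      simp [Expr.Fits, Expr.eval, hx, F.cell 8]
    · intro s' hs' _ F
      refine ⟨?_, fun i hi => ?_⟩
      · rw [F.reg 22 (by simp)]; simpa
      · rw [← e8 i hi]
        exact hs' (f i) (hf.lt hi)

theorem descend_spec (hW : 4 * n + 10 < W) (hWk : k + 10 < W) {s : State} (h1 : s.reg 1 = k)
    {c : ℕ → ℕ} {Z : ℕ} (h7 : ∀ i ≤ n, s.cell 7 i = c i) (hc : ∀ i ≤ n, c i ≤ n) (hZ : Z ≤ n)
    (h22 : s.reg 22 = Z)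
    (hq : ∀ j < k, s.cell 0 j ≤ n ∧ s.cell 1 j ≤ n ∧ s.cell 6 j ≤ n) :
    Runs W le procs descend s (k * 80 + 10) (fun s' =>
      (∀ j < k, (s.cell 6 j < c (s.cell 1 j) - c (s.cell 0 j) →
          s'.cell 0 j = c (s.cell 0 j) ∧ s'.cell 1 j = c (s.cell 1 j) ∧
          s'.cell 6 j = s.cell 6 j) ∧
        (¬s.cell 6 j < c (s.cell 1 j) - c (s.cell 0 j) →
          s'.cell 0 j = Z + (s.cell 0 j - c (s.cell 0 j)) ∧
          s'.cell 1 j = Z + (s.cell 1 j - c (s.cell 1 j)) ∧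
          s'.cell 6 j = s.cell 6 j - (c (s.cell 1 j) - c (s.cell 0 j)))) ∧
      Frame [23, 25, 26] [0, 1, 6] s s') := by
  refine Runs.frame ?_ _ _ False (fun h => h.elim) (by simp [descend, Cmd.Writes, Cmd.upto])
  refine Runs.seq (T₁ := 2) (T₂ := k * 80 + 4) (Runs.straight (Q := fun s' =>
    s' = s.setReg 23 0) ?_ (by simp [Cmd.scost, Expr.cost])
    (by simp [Cmd.sem, Expr.eval])) ?_ (by omega)
  · simp only [Cmd.Ok, Expr.Fits]; omega
  rintro _ rfl
  refine Runs.upto (a := 0) (N := k) [25, 26] [0, 1, 6] False (fun i s' =>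
    (∀ j < i, (s.cell 6 j < c (s.cell 1 j) - c (s.cell 0 j) →
          s'.cell 0 j = c (s.cell 0 j) ∧ s'.cell 1 j = c (s.cell 1 j) ∧
          s'.cell 6 j = s.cell 6 j) ∧
        (¬s.cell 6 j < c (s.cell 1 j) - c (s.cell 0 j) →
          s'.cell 0 j = Z + (s.cell 0 j - c (s.cell 0 j)) ∧
          s'.cell 1 j = Z + (s.cell 1 j - c (s.cell 1 j)) ∧
          s'.cell 6 j = s.cell 6 j - (c (s.cell 1 j) - c (s.cell 0 j)))) ∧
    (∀ j, i ≤ j → s'.cell 0 j = s.cell 0 j ∧ s'.cell 1 j = s.cell 1 j ∧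
      s'.cell 6 j = s.cell 6 j)) 72 (fun h => h.elim)
    (by simp [Cmd.Writes]) (by simp) (by simp) (by simp) (by omega) (by simp) (by simpa)
    (by omega) (by simp) ?_ (by omega) (fun s' h _ _ => h.1)
  rintro i s' - hi hx ⟨hI, hI'⟩ F
  have e22 : s'.reg 22 = Z := by rw [F.reg 22 (by simp)]; simpa
  obtain ⟨e0, e1, e6⟩ := hI' i le_rfl
  obtain ⟨hq0, hq1, hq6⟩ := hq i hi
  have e70 : s'.cell 7 (s.cell 0 i) = c (s.cell 0 i) := by
    rw [F.cell 7 (by simp)]; simp [h7 _ hq0]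
  have e71 : s'.cell 7 (s.cell 1 i) = c (s.cell 1 i) := by
    rw [F.cell 7 (by simp)]; simp [h7 _ hq1]
  have hc0 := hc _ hq0
  have hc1 := hc _ hq1
  have hne : ∀ j, j < i → j ≠ i := fun j h => h.ne
  have hne' : ∀ j, i + 1 ≤ j → j ≠ i := fun j h => by omega
  refine Runs.seq (T₁ := 4) (T₂ := 60) (Runs.straight (Q := fun s₁ =>
    s₁ = s'.setReg 25 (c (s.cell 0 i))) ?_ (by simp [Cmd.scost, Expr.cost])
    (by simp [Cmd.sem, Expr.eval, hx, e0, e70])) ?_ (by omega)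
  · simp [Cmd.Ok, Expr.Fits]
  rintro _ rfl
  refine Runs.seq (T₁ := 4) (T₂ := 50) (Runs.straight (Q := fun s₁ =>
    s₁ = (s'.setReg 25 (c (s.cell 0 i))).setReg 26 (c (s.cell 1 i))) ?_
    (by simp [Cmd.scost, Expr.cost])
    (by simp [Cmd.sem, Expr.eval, hx, e1, e71])) ?_ (by omega)
  · simp [Cmd.Ok, Expr.Fits]
  rintro _ rfl
  refine Runs.cond (T := 40) ?_ (fun h => ?_) (fun h => ?_) (by simp [Expr.cost])
  · refine Expr.fits_lt (by omega) trivial ⟨trivial, trivial, ?_⟩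
    simp [Expr.eval, Op.eval]
    omega
  · have ht : s.cell 6 i < c (s.cell 1 i) - c (s.cell 0 i) := by
      by_contra hcon
      simp [Expr.eval, Op.eval, hx, e6, hcon] at h
    refine Runs.straight (by simp [Cmd.Ok, Expr.Fits]) (by simp [Cmd.scost, Expr.cost])
      ⟨fun j hj => ?_, fun j hj => ?_⟩
    · rcases Nat.lt_succ_iff_lt_or_eq.1 hj with h' | rfl
      · simpa [Cmd.sem, Expr.eval, hx, Function.update_of_ne (hne j h')] using hI j h'
      · simp [Cmd.sem, Expr.eval, hx, ht, e6]
    · simpa [Cmd.sem, Expr.eval, hx, Function.update_of_ne (hne' j hj)] using hI' j (by omega)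
  · have ht : ¬s.cell 6 i < c (s.cell 1 i) - c (s.cell 0 i) := by
      intro hcon
      simp [Expr.eval, Op.eval, hx, e6, hcon] at h
    refine Runs.straight ?_ (by simp [Cmd.scost, Expr.cost])
      ⟨fun j hj => ?_, fun j hj => ?_⟩
    · simp [Cmd.Ok, Cmd.sem, Expr.Fits, Expr.eval, Op.eval, hx, e6, e0, e1, e22]
      omega
    · rcases Nat.lt_succ_iff_lt_or_eq.1 hj with h' | rfl
      · simpa [Cmd.sem, Expr.eval, hx, Function.update_of_ne (hne j h')] using hI j h'
      · simp [Cmd.sem, Expr.eval, Op.eval, hx, ht, e6, e0, e1, e22]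
    · simpa [Cmd.sem, Expr.eval, hx, Function.update_of_ne (hne' j hj)] using hI' j (by omega)

end Specs

/-! ### Injective self-maps of `[0, n)` and the descent through all levels. -/

theorem exists_of_injOn {n : ℕ} {f : ℕ → ℕ} (hf : ∀ i < n, f i < n)
    (hinj : Set.InjOn f (Set.Iio n)) {y : ℕ} (hy : y < n) : ∃ x < n, f x = y := by
  have := Finset.surjOn_of_injOn_of_card_le (s := Finset.range n) (t := Finset.range n) f
    (fun i hi => by simpa using hf i (by simpa using hi)) (by simpa using hinj) le_rfl
  obtain ⟨x, hx, rfl⟩ := this (show y ∈ _ by simpa using hy)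
  exact ⟨x, by simpa using hx, rfl⟩

theorem GoodWindow.exists_eq {n : ℕ} {A : ℕ → ℕ} (h : GoodWindow n A 0 n) {y : ℕ} (hy : y < n) :
    ∃ x < n, A x = y :=
  exists_of_injOn (fun i hi => h.lt i (Nat.zero_le _) hi)
    (fun i hi j hj => h.inj i j (Nat.zero_le _) hi (Nat.zero_le _) hj) hy

theorem GoodWindow.of_permute {n : ℕ} {A A' f : ℕ → ℕ} (h : GoodWindow n A 0 n)
    (hf : ∀ i < n, f i < n) (hinj : Set.InjOn f (Set.Iio n)) (hA' : ∀ i < n, A' (f i) = A i) :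
    GoodWindow n A' 0 n := by
  refine ⟨fun i _ hi => ?_, fun i j _ hi _ hj he => ?_⟩
  · obtain ⟨x, hx, rfl⟩ := exists_of_injOn hf hinj hi
    rw [hA' x hx]
    exact h.lt x (Nat.zero_le _) hx
  · obtain ⟨x, hx, rfl⟩ := exists_of_injOn hf hinj hi
    obtain ⟨y, hy, rfl⟩ := exists_of_injOn hf hinj hj
    rw [hA' x hx, hA' y hy] at he
    rw [h.inj x y (Nat.zero_le _) hx (Nat.zero_le _) hy he]

section Specs

variable {W n k : ℕ} {le : ℕ → ℕ → Bool} {procs : List Cmd}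

/-- Before round `i` the classes are given by the bucket numbers divided by `2 ^ (L - i)`, that is,
by their `i` leading digits. After the last round they are the buckets themselves. -/
theorem findBuckets_spec {L : ℕ} (hW : 4 * n + k + 2 ^ L + 100 < W) {s : State} (h0 : s.reg 0 = n)
    (h1 : s.reg 1 = k) (h18 : s.reg 18 = L) (h24 : s.reg 24 = 2 ^ L)
    (hb : ∀ i < n, s.cell 4 i < 2 ^ L) (hcur : GoodWindow n (s.cell 5) 0 n) (a b T : ℕ → ℕ)
    (hq : ∀ j < k, Narrowed n (fun y => s.cell 4 y / 2 ^ L) (s.cell 5) (a j) (b j) (T j)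
      (s.cell 0 j) (s.cell 1 j) (s.cell 6 j)) :
    Runs W le procs findBuckets s (L * (140 * n + 80 * k + 100) + 10) (fun s' =>
      (GoodWindow n (s'.cell 5) 0 n ∧ ∀ j < k, Narrowed n (s.cell 4) (s'.cell 5) (a j) (b j) (T j)
        (s'.cell 0 j) (s'.cell 1 j) (s'.cell 6 j)) ∧
      Frame [17, 21, 22, 23, 24, 25, 26] [0, 1, 5, 6, 7, 8] s s') := by
  have hL : L < 2 ^ L := Nat.lt_two_pow_self
  refine Runs.frame ?_ _ _ False (fun h => h.elim)
    (by simp [findBuckets, countZeros, permute, descend, Cmd.Writes, Cmd.upto])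
  refine Runs.seq (T₁ := 2) (T₂ := L * (140 * n + 80 * k + 100) + 8) (Runs.straight (Q := fun s' =>
    s' = s.setReg 17 0) ?_ (by simp [Cmd.scost, Expr.cost])
    (by simp [Cmd.sem, Expr.eval])) ?_ (by omega)
  · simp only [Cmd.Ok, Expr.Fits]; omega
  rintro _ rfl
  refine Runs.upto (a := 0) (N := L) [21, 22, 23, 24, 25, 26] [0, 1, 5, 6, 7, 8] False
    (fun i s' => s'.reg 24 = 2 ^ (L - i) ∧ GoodWindow n (s'.cell 5) 0 n ∧
      ∀ j < k, Narrowed n (fun y => s.cell 4 y / 2 ^ (L - i)) (s'.cell 5) (a j) (b j) (T j)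
        (s'.cell 0 j) (s'.cell 1 j) (s'.cell 6 j)) (140 * n + 80 * k + 80) (fun h => h.elim)
    (by simp [countZeros, permute, descend, Cmd.Writes, Cmd.upto]) (by simp) (by simp) (by simp)
    (by omega) (by simp) (by simpa) (by omega) (by simpa using ⟨h24, hcur, hq⟩) ?_ ?_
    (fun s' h _ _ => by simpa using h.2)
  · rintro i s₁ - hi hx ⟨e24, gC, hN⟩ F
    have e0 : s₁.reg 0 = n := by rw [F.reg 0 (by simp)]; simpa
    have e1 : s₁.reg 1 = k := by rw [F.reg 1 (by simp)]; simpa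
    have e4 : s₁.cell 4 = s.cell 4 := by rw [F.cell 4 (by simp)]; simp
    obtain ⟨B, hB⟩ : ∃ B, B = 2 ^ (L - (i + 1)) := ⟨_, rfl⟩
    have hpow : 2 ^ (L - i) = B * 2 := by
      rw [hB, ← pow_succ, show L - (i + 1) + 1 = L - i by omega]
    rw [hpow] at e24 hN
    have hb' : ∀ x < n, s.cell 4 (s₁.cell 5 x) < W := fun x hx => by
      have := hb _ (gC.lt x (Nat.zero_le _) hx)
      omega
    refine Runs.seq (T₁ := 4) (T₂ := 140 * n + 80 * k + 70) (Runs.straight (Q := fun s' =>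
      s' = s₁.setReg 24 B) ?_ (by simp [Cmd.scost, Expr.cost])
      (by simp [Cmd.sem, Expr.eval, Op.eval, e24])) ?_ (by omega)
    · have : 2 ^ (L - i) ≤ 2 ^ L := Nat.pow_le_pow_right (by omega) (by omega)
      simp only [Cmd.Ok, Expr.Fits, Expr.eval, Op.eval, e24, true_and]
      omega
    rintro _ rfl
    refine Runs.seq (T₁ := n * 40 + 20) (T₂ := 100 * n + 80 * k + 50)
      (countZeros_spec (n := n) (B := B) (by omega) (by simpa) (by simp) (by simpa [e4] using hb'))
      ?_ (by omega)
    rintro s₂ ⟨h7, F₂⟩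
    obtain ⟨z, hz⟩ : ∃ z, z = ZeroDigit B s₁ := ⟨_, rfl⟩
    have k4 : s₂.cell 4 = s.cell 4 := by rw [F₂.cell 4 (by simp)]; simpa
    have k5 : s₂.cell 5 = s₁.cell 5 := by rw [F₂.cell 5 (by simp)]; simp
    have hz₁ : ZeroDigit B (s₁.setReg 24 B) = z := hz.symm
    have hz₂ : ZeroDigit B s₂ = z := by
      rw [hz]
      funext x
      simp only [ZeroDigit, k4, k5, e4]
    rw [hz₁] at h7
    obtain ⟨f, hf⟩ := exists_stableIndex z n
    refine Runs.seq (T₁ := n * 100 + 30) (T₂ := 80 * k + 20)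
      (permute_spec (n := n) (B := B) (f := f) (by omega) ?_ ?_ ?_ ?_ ?_) ?_ (by omega)
    · rw [F₂.reg 0 (by simp)]; simpa
    · rw [F₂.reg 24 (by simp)]; simp
    · simpa [k4, k5] using hb'
    · rwa [hz₂]
    · rwa [hz₂]
    rintro s₃ ⟨⟨m22, m5⟩, F₃⟩
    rw [hz₂] at m22
    rw [k5] at m5
    have m7 : ∀ i ≤ n, s₃.cell 7 i = cnt z 0 i := by
      rw [F₃.cell 7 (by simp)]; exact h7
    have m0 : s₃.cell 0 = s₁.cell 0 := by
      rw [F₃.cell 0 (by simp), F₂.cell 0 (by simp)]; simp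
    have m1 : s₃.cell 1 = s₁.cell 1 := by
      rw [F₃.cell 1 (by simp), F₂.cell 1 (by simp)]; simp
    have m6 : s₃.cell 6 = s₁.cell 6 := by
      rw [F₃.cell 6 (by simp), F₂.cell 6 (by simp)]; simp
    have hcle : ∀ i ≤ n, cnt z 0 i ≤ n := fun i hi => by
      have := cnt_le z 0 i
      omega
    refine (descend_spec (n := n) (k := k) (by omega) (by omega) ?_ m7 hcle (hcle n le_rfl) m22
      ?_).mono (by omega) ?_
    · rw [F₃.reg 1 (by simp), F₂.reg 1 (by simp)]; simpa
    · intro j hj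
      obtain ⟨h₁, h₂, h₃, -⟩ := hN j hj
      rw [m0, m1, m6]
      omega
    rintro s₄ ⟨hd, F₄⟩
    have n5 : s₄.cell 5 = s₃.cell 5 := F₄.cell 5 (by simp)
    refine ⟨?_, ?_, fun j hj => ?_⟩
    · rw [State.setReg_reg, if_neg (by simp), F₄.reg 24 (by simp), F₃.reg 24 (by simp),
        F₂.reg 24 (by simp)]
      simpa using hB
    · rw [State.setReg_cell, n5]
      exact gC.of_permute (fun i hi => hf.lt hi) hf.injOn m5
    · rw [State.setReg_cell, n5, ← hB]
      have hNj := hN j hj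
      -- Division by `B * 2` becomes division by `B` and then by 2, the form in which
      -- `Narrowed.step` splits off one digit.
      simp only [← Nat.div_div_eq_div_mul] at hNj
      have hstep := hNj.step (cur' := s₃.cell 5) (f := f) (z := z) gC
        (fun x _ => by rw [hz, ZeroDigit, e4]) hf m5
      have hdj := hd j hj
      rw [m0, m1, m6] at hdj
      by_cases ht : s₁.cell 6 j < cnt z 0 (s₁.cell 1 j) - cnt z 0 (s₁.cell 0 j)
      · obtain ⟨q₁, q₂, q₃⟩ := hdj.1 ht
        rw [q₁, q₂, q₃]
        exact hstep.1 ht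
      · obtain ⟨q₁, q₂, q₃⟩ := hdj.2 ht
        rw [q₁, q₂, q₃]
        exact hstep.2 ht
  · have := Nat.mul_le_mul_left L
      (show 140 * n + 80 * k + 80 + 8 ≤ 140 * n + 80 * k + 100 by omega)
    rw [Nat.sub_zero]
    omega

end Specs

/-! ## Initialization and answers -/

/-- Stores the values of `e`, which depends on the index in `reg 21`, in the first cells of array
`r`, as many as `reg y` says. -/
def fillArray (r y : ℕ) (e : Expr) : Cmd :=
  .assign 21 (.lit 0) ;; .upto 21 y (.store r (.reg 21) e)

/-- Fills arrays `3` and `5` with the positions, array `6` with the target ranks of the queries,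
and makes the right endpoints in array `1` exclusive. -/
def initArrays : Cmd :=
  fillArray 3 0 (.reg 21) ;; fillArray 5 0 (.reg 21) ;;
  fillArray 6 1 (.op .div (.op .sub (.cell 1 (.reg 21)) (.cell 0 (.reg 21))) (.lit 2)) ;;
  fillArray 12 1 (.op .add (.cell 1 (.reg 21)) (.lit 1)) ;;
  fillArray 1 1 (.cell 12 (.reg 21))

/-- Stores the bucket of each position in array `4`. -/
def storeBuckets : Cmd :=
  .assign 21 (.lit 0) ;; .upto 21 0 (.store 4 (.cell 3 (.reg 21)) (.op .div (.reg 21) (.reg 16)))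

/-- Selects in the final window of each query. -/
def answer : Cmd :=
  .assign 23 (.lit 0) ;;
  .upto 23 1
    ((.assign 2 (.lit 0) ;; .assign 3 (.op .sub (.cell 1 (.reg 23)) (.cell 0 (.reg 23))) ;;
      .assign 4 (.cell 6 (.reg 23))) ;;
      fillArray 3 3 (.cell 5 (.op .add (.cell 0 (.reg 23)) (.reg 21))) ;;
      .call 0 ;; .store 2 (.reg 23) (.cell 3 (.reg 4)))

theorem Narrowed.exists_selected {n : ℕ} {u v cur A : ℕ → ℕ} {a b T l r t : ℕ}
    {σ : Equiv.Perm ℕ} (h : Narrowed n u cur a b T l r t) (hcur : GoodWindow n cur 0 n)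
    (hv : ∀ i j, i < n → j < n → v i = v j → i = j) (hb : b ≤ n)
    (hu : ∀ x y, x < n → y < n → u x < u y → v x < v y)
    (hA : ∀ i < r - l, A i = cur (l + i)) (hσ : SupportedOn σ 0 (r - l))
    (hsp : SplitAt (fun i => v (A (σ i))) 0 (r - l) t) :
    a ≤ A (σ t) ∧ A (σ t) < b ∧ cnt (fun y => v y < v (A (σ t))) a b = T := by
  obtain ⟨hlr, hrn, htr, p, hset, hcnt⟩ := h
  have hσt := (hσ.mem (Nat.zero_le _) htr).2
  obtain ⟨x, hx⟩ : ∃ x, x = A (σ t) := ⟨_, rfl⟩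
  rw [← hx]
  obtain ⟨h₁, h₂, h₃⟩ := (hset x).1 ⟨l + σ t, by omega, by omega, by rw [hx, hA _ hσt]⟩
  refine ⟨h₁, h₂, ?_⟩
  rw [← hcnt]
  -- The buckets are intervals in the order of the keys: elements of lower buckets precede `x`,
  -- those of higher buckets do not, and within the bucket of `x` the keys decide.
  have hsplit : cnt (fun y => u y < p) a b + cnt (fun y => u y = p ∧ v y < v x) a b =
      cnt (fun y => v y < v x) a b := by
    rw [cnt_add_cnt_disjoint (r := fun y => u y < p ∨ (u y = p ∧ v y < v x)) a b
      (fun i => Iff.rfl) (fun i => by omega)]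
    refine cnt_congr fun i hi₁ hi₂ => ?_
    rcases lt_trichotomy (u i) p with h | h | h
    · simp [h, hu i x (by omega) (by omega) (h₃ ▸ h)]
    · simp [h]
    · have := hu x i (by omega) (by omega) (h₃ ▸ h)
      omega
  rw [← hsplit, ← Narrowed.cnt_eq hcur hrn hset (Q := fun i => v (cur i) < v x)
    (R := fun y => v y < v x) fun x _ _ => Iff.rfl]
  congr 1
  have hinj : ∀ i j, i < r - l → j < r - l → v (A (σ i)) = v (A (σ j)) → i = j := by
    intro i j hi hj hij
    have hi' := (hσ.mem (Nat.zero_le _) hi).2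
    have hj' := (hσ.mem (Nat.zero_le _) hj).2
    rw [hA _ hi', hA _ hj'] at hij
    have := hv _ _ (hcur.lt _ (Nat.zero_le _) (by omega)) (hcur.lt _ (Nat.zero_le _) (by omega)) hij
    have := hcur.inj _ _ (Nat.zero_le _) (by omega) (Nat.zero_le _) (by omega) this
    exact σ.injective (by omega)
  have h0 := cnt_shift (fun i => v (cur i) < v x) 0 (r - l) l
  rw [zero_add, Nat.sub_add_cancel hlr] at h0
  -- After selection exactly the cells before index `t` hold keys smaller than that of `x`, so the
  -- remaining count is `t`.
  rw [← h0, cnt_congr (q := fun i => v (A i) < v x) fun i _ hi => by rw [hA i hi, add_comm],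
    ← cnt_perm _ hσ, ← cnt_add _ (Nat.zero_le t) htr.le,
    cnt_congr (q := fun _ => True) (a := 0) (b := t) fun i _ hi => ?_,
    cnt_congr (q := fun _ => False) (a := t) fun i hi hi' => ?_, cnt_true]
  · simp [cnt]
  · rw [hx]
    simp only [iff_false, not_lt]
    rcases Nat.lt_or_eq_of_le hi with h | rfl
    · exact hsp.2 i h hi'
    · exact le_rfl
  · rw [hx]
    simp only [iff_true]
    refine lt_of_le_of_ne (hsp.1 i (Nat.zero_le _) hi) fun h => ?_
    have := hinj i t (by omega) htr h
    omega

theorem Narrowed.length_le {n m : ℕ} {u cur : ℕ → ℕ} {a b T l r t : ℕ}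
    (h : Narrowed n u cur a b T l r t) (hcur : GoodWindow n cur 0 n) (hb : b ≤ n)
    (hm : ∀ p, cnt (fun y => u y = p) 0 n ≤ m) : r - l ≤ m := by
  obtain ⟨-, hrn, -, p, hset, -⟩ := h
  rw [← cnt_true, Narrowed.cnt_eq hcur hrn hset (R := fun _ => True) fun _ _ _ => Iff.rfl]
  exact (cnt_mono (Nat.zero_le _) hb fun _ _ _ h => h.1).trans (hm p)

/-- Bucket `p` consists of the elements that the sorted blocks hold in the cells from `p * m` to `p
* m + m - 1`. -/
theorem cnt_bucket_le {n m : ℕ} (hm : 0 < m) {u A : ℕ → ℕ} (hA : GoodWindow n A 0 n)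
    (hu : ∀ i < n, u (A i) = i / m) (p : ℕ) : cnt (fun y => u y = p) 0 n ≤ m := by
  classical
  have h := Narrowed.cnt_eq (P := fun _ => True) (Q := fun i => i / m = p) (R := fun y => u y = p)
    (a := 0) (b := n) (l := 0) hA le_rfl (fun y => ?_) fun i _ hi => by rw [hu i hi]
  · rw [cnt_congr (q := fun y => True ∧ u y = p) fun i _ _ => by simp, ← h]
    calc cnt (fun i => i / m = p) 0 n ≤ (Finset.Ico (p * m) (p * m + m)).card := by
          refine Finset.card_le_card fun i hi => ?_
          simp only [Finset.mem_filter, Finset.mem_Ico] at hi ⊢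
          rw [← hi.2]
          have := Nat.div_add_mod' i m
          have := Nat.mod_lt i hm
          omega
      _ = m := by simp
  · constructor
    · rintro ⟨x, -, hx, rfl⟩
      exact ⟨Nat.zero_le _, hA.lt x (Nat.zero_le _) hx, trivial⟩
    · rintro ⟨-, hy, -⟩
      obtain ⟨x, hx, rfl⟩ := hA.exists_eq hy
      exact ⟨x, Nat.zero_le _, hx, rfl⟩

/-! ### Initialization, bucket numbers and the final selections. -/

section Specs

variable {W n k : ℕ} {le : ℕ → ℕ → Bool} {procs : List Cmd} {v : ℕ → ℕ}

theorem fillArray_spec {r y : ℕ} {e : Expr} {s : State} {N : ℕ} (g : ℕ → ℕ)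
    (hy : y ≠ 21) (hW : N + 1 < W) (hsy : s.reg y = N)
    (he : ∀ i s', i < N → s'.reg 21 = i → Frame [21] [r] s s' → e.Fits W le s' ∧ e.eval le s' = g i) :
    Runs W le procs (fillArray r y e) s (N * (e.cost + 10) + 6) (fun s' =>
      (∀ i < N, s'.cell r i = g i) ∧ Frame [21] [r] s s') := by
  refine Runs.seq (T₁ := 2) (T₂ := N * (e.cost + 10) + 4) (Runs.straight
    (Q := fun s' => s' = s.setReg 21 0)
    (by simp only [Cmd.Ok, Expr.Fits]; omega) (by simp [Cmd.scost, Expr.cost])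
    (by simp [Cmd.sem, Expr.eval])) ?_ (by omega)
  rintro _ rfl
  have hF : ∀ {s'}, Frame [21] [r] (s.setReg 21 0) s' → Frame [21] [r] s s' := fun F =>
    ⟨fun x hx => by rw [F.reg x hx, State.setReg_reg, if_neg (by simpa using hx)], F.cell⟩
  refine Runs.fill (N := N) id g hy hW (by simp) (by simpa [hy]) Function.injective_id.injOn
    (fun i s' hi hx F => ?_) ?_ (fun s' h _ F => ⟨h, hF F⟩)
  · obtain ⟨h₁, h₂⟩ := he i s' hi hx (hF F)
    exact ⟨trivial, h₁, hx, h₂⟩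
  · simp only [Expr.cost]
    rw [show 1 + e.cost + 9 = e.cost + 10 by omega]

theorem initArrays_spec (hW : n + k + 10 < W) {s : State} {l r : ℕ → ℕ} (h0 : s.reg 0 = n)
    (h1 : s.reg 1 = k) (hl : ∀ j < k, s.cell 0 j = l j) (hr : ∀ j < k, s.cell 1 j = r j)
    (hrn : ∀ j < k, r j < n) :
    Runs W le procs initArrays s (40 * n + 80 * k + 50) (fun s' =>
      ((∀ i < n, s'.cell 3 i = i) ∧ (∀ i < n, s'.cell 5 i = i) ∧
        ∀ j < k, s'.cell 0 j = l j ∧ s'.cell 1 j = r j + 1 ∧ s'.cell 6 j = (r j - l j) / 2) ∧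
      Frame [21] [1, 3, 5, 6, 12] s s') := by
  refine Runs.frame ?_ _ _ False (fun h => h.elim)
    (by simp [initArrays, fillArray, Cmd.Writes, Cmd.upto])
  refine (fillArray_spec (e := .reg 21) (N := n) id (by simp) (by omega) h0
    fun i s' _ hi _ => ⟨trivial, hi⟩).seq (T₂ := 20 * n + 80 * k + 40) ?_
    (by simp only [Expr.cost]; omega)
  rintro s₁ ⟨a₃, F₁⟩
  refine (fillArray_spec (e := .reg 21) (N := n) id (by simp) (by omega) (by rw [F₁.reg 0 (by simp), h0])
    fun i s' _ hi _ => ⟨trivial, hi⟩).seq (T₂ := 80 * k + 30) ?_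
    (by simp only [Expr.cost]; omega)
  rintro s₂ ⟨a₅, F₂⟩
  -- Of `M = r j - l j + 1` entries, the median has `(M + 1) / 2 - 1 = (r j - l j) / 2` smaller
  -- keys.
  refine (fillArray_spec (N := k) (fun j => (r j - l j) / 2) (by simp) (by omega)
    (by rw [F₂.reg 1 (by simp), F₁.reg 1 (by simp), h1]) ?_).seq (T₂ := 60 * k + 20) ?_
    (by simp only [Expr.cost]; omega)
  · intro i s' hi hx F
    have := hrn i hi
    simp [Expr.Fits, Expr.eval, Op.eval, hx, F.cell 0, F.cell 1, F₂.cell 0, F₂.cell 1, F₁.cell 0,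
      F₁.cell 1, hl i hi, hr i hi]
    omega
  rintro s₃ ⟨a₆, F₃⟩
  -- The rule for filling lets the stored expression read only arrays other than the target, so the
  -- endpoints pass through array `12`.
  refine (fillArray_spec (N := k) (fun j => r j + 1) (by simp) (by omega)
    (by rw [F₃.reg 1 (by simp), F₂.reg 1 (by simp), F₁.reg 1 (by simp), h1]) ?_).seq
    (T₂ := 40 * k + 10) ?_ (by simp only [Expr.cost]; omega)
  · intro i s' hi hx F
    have := hrn i hi
    simp [Expr.Fits, Expr.eval, Op.eval, hx, F.cell 1, F₃.cell 1, F₂.cell 1, F₁.cell 1, hr i hi]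
    omega
  rintro s₄ ⟨a₁₂, F₄⟩
  refine (fillArray_spec (N := k) (fun j => r j + 1) (by simp) (by omega)
    (by rw [F₄.reg 1 (by simp), F₃.reg 1 (by simp), F₂.reg 1 (by simp), F₁.reg 1 (by simp), h1])
    ?_).mono (by simp only [Expr.cost]; omega) ?_
  · intro i s' hi hx F
    simp [Expr.Fits, Expr.eval, hx, F.cell 12, a₁₂ i hi]
  rintro s₅ ⟨a₁, F₅⟩
  refine ⟨fun i hi => ?_, fun i hi => ?_, fun j hj => ⟨?_, a₁ j hj, ?_⟩⟩
  · rw [F₅.cell 3 (by simp), F₄.cell 3 (by simp), F₃.cell 3 (by simp), F₂.cell 3 (by simp), a₃ i hi,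
      id]
  · rw [F₅.cell 5 (by simp), F₄.cell 5 (by simp), F₃.cell 5 (by simp), a₅ i hi, id]
  · rw [F₅.cell 0 (by simp), F₄.cell 0 (by simp), F₃.cell 0 (by simp), F₂.cell 0 (by simp),
      F₁.cell 0 (by simp), hl j hj]
  · rw [F₅.cell 6 (by simp), F₄.cell 6 (by simp), a₆ j hj]

theorem storeBuckets_spec (hW : n + 10 < W) {s : State} {m : ℕ} (h0 : s.reg 0 = n)
    (h16 : s.reg 16 = m) (hA : GoodWindow n (s.cell 3) 0 n) :
    Runs W le procs storeBuckets s (20 * n + 10) (fun s' =>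
      (∀ i < n, s'.cell 4 (s.cell 3 i) = i / m) ∧ Frame [21] [4] s s') := by
  refine Runs.frame ?_ _ _ False (fun h => h.elim)
    (by simp [storeBuckets, Cmd.Writes, Cmd.upto])
  refine Runs.seq (T₁ := 2) (T₂ := 20 * n + 8) (Runs.straight
    (Q := fun s' => s' = s.setReg 21 0)
    (by simp only [Cmd.Ok, Expr.Fits]; omega) (by simp [Cmd.scost, Expr.cost])
    (by simp [Cmd.sem, Expr.eval])) ?_ (by omega)
  rintro _ rfl
  refine Runs.fill (N := n) (s.cell 3) (fun i => i / m) (by simp) (by omega) (by simp)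
    (by simpa) (fun i hi j hj => hA.inj i j (Nat.zero_le _) hi (Nat.zero_le _) hj)
    (fun i s' hi hx F => ?_) (by simp only [Expr.cost]; omega) (fun s' h _ _ => h)
  have := Nat.div_le_self i m
  have e16 : s'.reg 16 = m := by rw [F.reg 16 (by simp)]; simpa
  have e3 : s'.cell 3 = s.cell 3 := by rw [F.cell 3 (by simp)]; simp
  simp only [Expr.Fits, Expr.eval, Op.eval, hx, e16, e3, true_and, and_true]
  omega

/-- Each window is copied to the front of array `3` before the selection, because the windows of
different queries may overlap and array `5` must stay intact. Copying and selection are linear in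
`m`. -/
theorem answer_spec (hv : Compares n le v) (hW : 4 * n + k + 200 ≤ W) {s : State} {u : ℕ → ℕ}
    {m : ℕ} (hm : ∀ p, cnt (fun y => u y = p) 0 n ≤ m)
    (hu : ∀ x y, x < n → y < n → u x < u y → v x < v y) (h1 : s.reg 1 = k) (h5 : s.reg 5 = 0)
    (hcur : GoodWindow n (s.cell 5) 0 n) (a b T : ℕ → ℕ) (hb : ∀ j < k, b j ≤ n)
    (hq : ∀ j < k, Narrowed n u (s.cell 5) (a j) (b j) (T j) (s.cell 0 j) (s.cell 1 j)
      (s.cell 6 j)) :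
    Runs W le [select] answer s (k * (4020 * m + 50) + 10) (fun s' =>
      ∀ j < k, a j ≤ s'.cell 2 j ∧ s'.cell 2 j < b j ∧
        cnt (fun y => v y < v (s'.cell 2 j)) (a j) (b j) = T j) := by
  have hP : True → ∀ c ∈ [select], c.Writes (21 :: selectRegs) (2 :: selectArrays) True := by
    intro _ c hc
    rw [List.mem_singleton.1 hc]
    exact select_writes_of_subset (by simp) (by simp)
  refine Runs.seq (T₁ := 2) (T₂ := k * (4020 * m + 50) + 8) (Runs.straight
    (Q := fun s' => s' = s.setReg 23 0)
    (by simp only [Cmd.Ok, Expr.Fits]; omega) (by simp [Cmd.scost, Expr.cost])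
    (by simp [Cmd.sem, Expr.eval])) ?_ (by omega)
  rintro _ rfl
  refine Runs.upto (a := 0) (N := k) (21 :: selectRegs) (2 :: selectArrays) True (fun i s' =>
    s'.reg 5 = 0 ∧ ∀ j < i, a j ≤ s'.cell 2 j ∧ s'.cell 2 j < b j ∧
        cnt (fun y => v y < v (s'.cell 2 j)) (a j) (b j) = T j) (4020 * m + 40) hP
    (by simp [Cmd.Writes, fillArray, Cmd.upto, selectRegs, selectArrays]) (by simp [selectRegs])
    (by simp [selectRegs]) (by simp) (by omega) (by simp) (by simpa) (by omega) (by simpa) ?_ ?_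
    (fun s' h _ _ => h.2)
  · rintro i s₁ - hi hx ⟨e5, hI⟩ F
    have c5 : s₁.cell 5 = s.cell 5 := by rw [F.cell 5 (by simp [selectArrays])]; simp
    obtain ⟨l, hl⟩ : ∃ l, l = s.cell 0 i := ⟨_, rfl⟩
    obtain ⟨r, hr⟩ : ∃ r, r = s.cell 1 i := ⟨_, rfl⟩
    obtain ⟨t, ht⟩ : ∃ t, t = s.cell 6 i := ⟨_, rfl⟩
    have c0 : s₁.cell 0 i = l := by rw [F.cell 0 (by simp [selectArrays])]; simp [hl]
    have c1 : s₁.cell 1 i = r := by rw [F.cell 1 (by simp [selectArrays])]; simp [hr]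
    have c6 : s₁.cell 6 i = t := by rw [F.cell 6 (by simp [selectArrays])]; simp [ht]
    have hN := hq i hi
    rw [← hl, ← hr, ← ht] at hN
    have hlen := hN.length_le hcur (hb i hi) hm
    have hle := hN.le
    have hrn := hN.le_n
    have htr := hN.lt
    refine Runs.seq (T₁ := 11) (T₂ := 4015 * m + 20) (Runs.straight (Q := fun s' =>
      s' = ((s₁.setReg 2 0).setReg 3 (r - l)).setReg 4 t) ?_
      (by simp [Cmd.scost, Expr.cost]) (by simp [Cmd.sem, Expr.eval, Op.eval, hx, c0, c1, c6])) ?_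
      (by omega)
    · simp [Cmd.Ok, Cmd.sem, Expr.Fits, Expr.eval, Op.eval, hx, c0, c1]
      omega
    rintro _ rfl
    refine (fillArray_spec (N := r - l) (fun j => s.cell 5 (l + j)) (by simp) (by omega) (by simp)
      ?_).seq (T₂ := 4000 * m + 10) ?_ (by simp only [Expr.cost]; omega)
    · intro j s' hj hx' F'
      have e23 : s'.reg 23 = i := by rw [F'.reg 23 (by simp)]; simpa
      have d0 : s'.cell 0 i = l := by rw [F'.cell 0 (by simp)]; simpa
      have d5 : s'.cell 5 = s.cell 5 := by rw [F'.cell 5 (by simp)]; simpa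
      simp only [Expr.Fits, Expr.eval, Op.eval, hx', e23, d0, d5, true_and, and_true]
      omega
    rintro s₂ ⟨hA, F₂⟩
    have k2 : s₂.reg 2 = 0 := by rw [F₂.reg 2 (by simp)]; simp
    have k3 : s₂.reg 3 = r - l := by rw [F₂.reg 3 (by simp)]; simp
    have k4 : s₂.reg 4 = t := by rw [F₂.reg 4 (by simp)]; simp
    have k5 : s₂.reg 5 = 0 := by rw [F₂.reg 5 (by simp)]; simpa
    have k23 : s₂.reg 23 = i := by rw [F₂.reg 23 (by simp)]; simpa
    have kc2 : s₂.cell 2 = s₁.cell 2 := by rw [F₂.cell 2 (by simp)]; simp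
    have gA : GoodWindow n (s₂.cell 3) 0 (r - l) := by
      refine ⟨fun j _ hj => ?_, fun j j' _ hj _ hj' he => ?_⟩
      · rw [hA j hj]
        exact hcur.lt _ (Nat.zero_le _) (by omega)
      · rw [hA j hj, hA j' hj'] at he
        have := hcur.inj _ _ (Nat.zero_le _) (by omega) (Nat.zero_le _) (by omega) he
        omega
    refine ((select_spec hv (Bd := n) (procs := [select]) (by omega) rfl (r - l) s₂ 0 (r - l) t 0
      (by omega) k2 k3 k4 k5 (by omega) htr (by omega) (by omega) gA).frame selectRegs selectArrays
      True (by simpa using select_writes) trivial).seq (T₂ := 5) ?_ (by omega)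
    rintro s₃ ⟨⟨⟨σ, hσA, hσ, hsp⟩, m4, m5, -⟩, F₃⟩
    have m23 : s₃.reg 23 = i := by rw [F₃.reg 23 (by simp [selectRegs]), k23]
    have m2 : s₃.cell 2 = s₁.cell 2 := by rw [F₃.cell 2 (by simp [selectArrays]), kc2]
    refine Runs.straight (by simp [Cmd.Ok, Expr.Fits]) (by simp [Cmd.scost, Expr.cost])
      ⟨by simpa [Cmd.sem] using m5, fun j hj => ?_⟩
    simp only [Cmd.sem, Expr.eval, m23, m4, State.setReg_cell, State.setCell_cell, if_true, hσA,
      m2, Function.comp_apply]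
    rcases Nat.lt_succ_iff_lt_or_eq.1 hj with h | rfl
    · rw [Function.update_of_ne h.ne]
      exact hI j h
    · rw [Function.update_self]
      exact hN.exists_selected hcur hv.inj (hb j hi) hu hA hσ hsp
  · have := Nat.mul_le_mul_left k (show 4020 * m + 40 + 8 ≤ 4020 * m + 50 by omega)
    rw [Nat.sub_zero]
    omega

end Specs

/-! ## The range median program -/

/-- The program for the range median problem. -/
def medianProgram : Program where
  main := initArrays ;; computePower ;;
    (.assign 16 (.op .add (.op .div (.reg 0) (.reg 15)) (.lit 1)) ;; .assign 24 (.reg 15)) ;;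
    sortBlocks ;; storeBuckets ;; findBuckets ;; answer
  procs := [select]

theorem medianProgram_spec {W n k : ℕ} {le : ℕ → ℕ → Bool} {v : ℕ → ℕ} (hn : 1 ≤ n) (hk : 1 ≤ k)
    (hv : Compares n le v) (hW : 100 * (n + k + 2) ≤ W) {s : State} {l r : ℕ → ℕ}
    (h0 : s.reg 0 = n) (h1 : s.reg 1 = k) (h5 : s.reg 5 = 0) (hl : ∀ j < k, s.cell 0 j = l j)
    (hr : ∀ j < k, s.cell 1 j = r j) (hlr : ∀ j < k, l j ≤ r j) (hrn : ∀ j < k, r j < n) :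
    Runs W le medianProgram.procs medianProgram.main s
      (5000 * ((Nat.clog 2 k + 1) * (n + k))) (fun s' => ∀ j < k, l j ≤ s'.cell 2 j ∧
        s'.cell 2 j < r j + 1 ∧
        cnt (fun y => v y < v (s'.cell 2 j)) (l j) (r j + 1) = (r j - l j) / 2) := by
  obtain ⟨L, hL⟩ : ∃ L, L = Nat.clog 2 k := ⟨_, rfl⟩
  have hkL : k ≤ 2 ^ L := hL ▸ Nat.le_pow_clog (by omega) k
  have hLk : 2 ^ L ≤ 2 * k := hL ▸ two_pow_clog_le hk
  have hpos : 0 < 2 ^ L := by positivity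
  -- The block length exceeds `n / 2 ^ L`, so that `2 ^ L` blocks cover the array even if the
  -- division is not exact.
  obtain ⟨m, hm⟩ : ∃ m, m = n / 2 ^ L + 1 := ⟨_, rfl⟩
  have hm1 : 0 < m := hm ▸ Nat.succ_pos _
  have hdm := Nat.div_add_mod n (2 ^ L)
  have hmod := Nat.mod_lt n hpos
  have hmL : m * 2 ^ L = 2 ^ L * (n / 2 ^ L) + 2 ^ L := by rw [hm]; ring
  -- Since `k ≤ 2 ^ L`, the final windows of all queries together have at most `n + k` elements,
  -- although they may overlap.
  have hkm : k * m ≤ n + k := by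
    have : k * (n / 2 ^ L) ≤ 2 ^ L * (n / 2 ^ L) := Nat.mul_le_mul_right _ hkL
    rw [hm, mul_add]
    omega
  have htotal : L * (4100 * n + 40) + L * (140 * n + 80 * k + 100) + k * (4020 * m + 50) + 12 * L +
      60 * n + 80 * k + 150 ≤ 5000 * ((L + 1) * (n + k)) := by
    have h₁ : L ≤ L * n := Nat.le_mul_of_pos_right _ hn
    have h₂ : k * (4020 * m + 50) = 4020 * (k * m) + 50 * k := by ring
    rw [h₂]
    nlinarith
  rw [← hL]
  refine (initArrays_spec (n := n) (k := k) (by omega) h0 h1 hl hr hrn).seq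
    (T₂ := L * (4100 * n + 40) + L * (140 * n + 80 * k + 100) + k * (4020 * m + 50) + 12 * L +
      20 * n + 90) ?_ (by omega)
  rintro s₁ ⟨⟨a3, a5, aq⟩, F₁⟩
  have e0 : s₁.reg 0 = n := by rw [F₁.reg 0 (by simp), h0]
  have e1 : s₁.reg 1 = k := by rw [F₁.reg 1 (by simp), h1]
  have e5 : s₁.reg 5 = 0 := by rw [F₁.reg 5 (by simp), h5]
  refine (computePower_spec hk (by omega) e1 hL).seq
    (T₂ := L * (4100 * n + 40) + L * (140 * n + 80 * k + 100) + k * (4020 * m + 50) +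
      20 * n + 80) ?_ (by omega)
  rintro s₂ ⟨⟨b15, b18⟩, F₂⟩
  have b0 : s₂.reg 0 = n := by rw [F₂.reg 0 (by simp), e0]
  refine Runs.seq (T₁ := 8) (T₂ := L * (4100 * n + 40) + L * (140 * n + 80 * k + 100) +
    k * (4020 * m + 50) + 20 * n + 50) (Runs.straight (Q := fun s' =>
      s' = (s₂.setReg 16 m).setReg 24 (2 ^ L)) ?_ (by simp [Cmd.scost, Expr.cost])
      (by simp [Cmd.sem, Expr.eval, Op.eval, b0, b15, hm])) ?_ (by omega)
  · have := Nat.div_le_self n (2 ^ L)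
    simp only [Cmd.Ok, Expr.Fits, Expr.eval, Op.eval, b0, b15, true_and, and_true]
    omega
  rintro _ rfl
  have hid : ∀ A : ℕ → ℕ, (∀ i < n, A i = i) → GoodWindow n A 0 n := fun A hA =>
    ⟨fun i _ hi => by rwa [hA i hi], fun i j _ hi _ hj h => by rwa [hA i hi, hA j hj] at h⟩
  have c3 : ∀ i < n, s₂.cell 3 i = i := by rw [F₂.cell 3 (by simp)]; exact a3
  have c5 : ∀ i < n, s₂.cell 5 i = i := by rw [F₂.cell 5 (by simp)]; exact a5
  refine (sortBlocks_spec hv (L := L) (m := m) (by omega) (by omega) (by omega) (by simpa)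
    (by simp [F₂.reg 5, e5]) (by simpa) (by simp) (by simpa) (by simpa using hid _ c3)).seq
    (T₂ := L * (140 * n + 80 * k + 100) + k * (4020 * m + 50) + 20 * n + 40) ?_ (by omega)
  rintro s₃ ⟨⟨g3, d5, hcut⟩, F₃⟩
  have d0 : s₃.reg 0 = n := by rw [F₃.reg 0 (by simp [selectRegs])]; simpa
  have d16 : s₃.reg 16 = m := by rw [F₃.reg 16 (by simp [selectRegs])]; simp
  refine (storeBuckets_spec (n := n) (m := m) (by omega) d0 d16 g3).seq
    (T₂ := L * (140 * n + 80 * k + 100) + k * (4020 * m + 50) + 30) ?_ (by omega)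
  rintro s₄ ⟨hu, F₄⟩
  have hub : ∀ i < n, s₄.cell 4 i < 2 ^ L := by
    intro y hy
    obtain ⟨i, hi, rfl⟩ := g3.exists_eq hy
    rw [hu i hi, Nat.div_lt_iff_lt_mul hm1, mul_comm]
    omega
  have humono : ∀ x y, x < n → y < n → s₄.cell 4 x < s₄.cell 4 y → v x < v y := by
    intro x y hx hy hxy
    obtain ⟨i, hi, rfl⟩ := g3.exists_eq hx
    obtain ⟨j, hj, rfl⟩ := g3.exists_eq hy
    rw [hu i hi, hu j hj] at hxy
    exact hcut (j / m) i j ((Nat.div_lt_iff_lt_mul hm1).1 hxy) (Nat.div_mul_le_self j m) hj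
  have f0 : s₄.reg 0 = n := by rw [F₄.reg 0 (by simp), d0]
  have f1 : s₄.reg 1 = k := by
    rw [F₄.reg 1 (by simp), F₃.reg 1 (by simp [selectRegs])]; simp [F₂.reg 1, e1]
  have f5 : s₄.reg 5 = 0 := by rw [F₄.reg 5 (by simp), d5]
  have f18 : s₄.reg 18 = L := by
    rw [F₄.reg 18 (by simp), F₃.reg 18 (by simp [selectRegs])]; simp [b18]
  have f24 : s₄.reg 24 = 2 ^ L := by
    rw [F₄.reg 24 (by simp), F₃.reg 24 (by simp [selectRegs])]; simp
  have fc : ∀ x ∈ [0, 1, 5, 6], s₄.cell x = s₁.cell x := by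
    intro x hx
    have hx' : x ≠ 4 ∧ x ∉ selectArrays := by
      simp only [List.mem_cons, List.not_mem_nil, or_false] at hx
      rcases hx with rfl | rfl | rfl | rfl <;> simp [selectArrays]
    rw [F₄.cell x (by simpa using hx'.1), F₃.cell x hx'.2]
    simp [F₂.cell x]
  have g5 : ∀ i < n, s₄.cell 5 i = i := by rw [fc 5 (by simp)]; exact a5
  refine (findBuckets_spec (n := n) (k := k) (L := L) (by omega) f0 f1 f18 f24 hub (hid _ g5) l
    (fun j => r j + 1) (fun j => (r j - l j) / 2) fun j hj => ?_).seq
    (T₂ := k * (4020 * m + 50) + 10) ?_ (by omega)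
  · obtain ⟨q0, q1, q6⟩ := aq j hj
    have := hlr j hj
    have := hrn j hj
    rw [fc 0 (by simp), fc 1 (by simp), fc 6 (by simp), q0, q1, q6]
    -- At the top level all elements have the empty prefix, class 0, and the window is the query
    -- itself.
    refine ⟨by omega, by omega, by omega, 0, fun y => ⟨?_, ?_⟩, by simp [cnt]⟩
    · rintro ⟨x, h₁, h₂, rfl⟩
      rw [g5 x (by omega)]
      exact ⟨h₁, h₂, Nat.div_eq_of_lt (hub x (by omega))⟩
    · rintro ⟨h₁, h₂, -⟩
      exact ⟨y, h₁, h₂, g5 y (by omega)⟩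
  rintro s₅ ⟨⟨g, hN⟩, F₅⟩
  exact answer_spec hv (by omega) (cnt_bucket_le hm1 g3 hu) humono
    (by rw [F₅.reg 1 (by simp), f1]) (by rw [F₅.reg 5 (by simp), f5]) g l (fun j => r j + 1)
    (fun j => (r j - l j) / 2) (fun j hj => hrn j hj) hN

/-! ## Keys and medians -/

section Keys

variable {α : Type u} [LinearOrder α] {n : ℕ}

/-- The number of entries before `S i` in the sorted order in which ties are broken by the
positions. -/
noncomputable def sortedRank (S : Fin n → α) (i : ℕ) : ℕ :=
  if h : i < n then
    (Finset.univ.filter fun j => toLex (S j, j) < toLex (S ⟨i, h⟩, (⟨i, h⟩ : Fin n))).card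
  else 0

theorem sortedRank_lt_iff (S : Fin n → α) (i j : Fin n) :
    sortedRank S i < sortedRank S j ↔ toLex (S i, i) < toLex (S j, j) := by
  have key : ∀ i j : Fin n, toLex (S i, i) < toLex (S j, j) → sortedRank S i < sortedRank S j := by
    intro i j h
    simp only [sortedRank, Fin.is_lt, dif_pos, Fin.eta]
    refine Finset.card_lt_card (Finset.ssubset_iff.2 ⟨i, by simp, fun x hx => ?_⟩)
    rcases Finset.mem_insert.1 hx with rfl | hx
    · simpa using h
    · simp only [Finset.mem_filter, Finset.mem_univ, true_and] at hx ⊢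
      exact hx.trans h
  refine ⟨fun h => ?_, key i j⟩
  rcases lt_trichotomy (toLex (S i, i)) (toLex (S j, j)) with h' | h' | h'
  · exact h'
  · have : i = j := (Prod.ext_iff.1 (toLex.injective h')).2
    subst this
    exact absurd h (lt_irrefl _)
  · exact absurd h (key j i h').asymm

/-- For `i < j` the key of `i` is smaller iff `S i ≤ S j`; otherwise it is smaller iff `S j ≤ S i`
fails. Thus one question to the oracle decides. -/
theorem compares_sortedRank (S : Fin n → α) : Compares n (entryLE S) (sortedRank S) := by
  refine ⟨fun i j hi hj => ?_, fun i j hi hj h => ?_⟩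
  · have := sortedRank_lt_iff S ⟨i, hi⟩ ⟨j, hj⟩
    simp only [Prod.Lex.toLex_lt_toLex, Fin.mk_lt_mk] at this
    rw [this]
    split_ifs with h
    · simp [entryLE, hi, hj, h, le_iff_lt_or_eq]
    · simp [entryLE, hi, hj, h]
  · have h₁ := sortedRank_lt_iff S ⟨i, hi⟩ ⟨j, hj⟩
    have h₂ := sortedRank_lt_iff S ⟨j, hj⟩ ⟨i, hi⟩
    simp only [h, lt_irrefl, false_iff] at h₁ h₂
    have := (Prod.ext_iff.1 (toLex.injective (le_antisymm (not_lt.1 h₂) (not_lt.1 h₁)))).2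
    simpa using this

/-- Entries strictly below `S x` have smaller keys, and entries with smaller keys are at most `S x`.
So the exact rank of the key implies both inequalities for the median, whatever the ties. -/
theorem isMedian_of_cnt (S : Fin n → α) (q : NonemptyInterval (Fin n)) (x : Fin n)
    (h₁ : (q.fst : ℕ) ≤ x) (h₂ : (x : ℕ) < q.snd + 1)
    (h : cnt (fun y => sortedRank S y < sortedRank S x) q.fst (q.snd + 1) =
      ((q.snd : ℕ) - q.fst) / 2) : IsMedian S q x := by
  have hq : (q.fst : ℕ) ≤ q.snd := q.fst_le_snd
  have hcard : (positions q).card = (q.snd : ℕ) + 1 - q.fst := by simp [positions]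
  have hmem : x ∈ positions q := by
    simp only [positions, Finset.mem_Icc, Fin.le_def]
    omega
  obtain ⟨F, hF⟩ : ∃ F, F = (positions q).filter
    fun j : Fin n => sortedRank S j < sortedRank S x := ⟨_, rfl⟩
  have hFcard : F.card = ((q.snd : ℕ) - q.fst) / 2 := by
    classical
    rw [← h, hF]
    refine Finset.card_bij (fun j _ => (j : ℕ)) ?_ ?_ ?_
    · intro j hj
      simp only [positions, Finset.mem_filter, Finset.mem_Icc, Fin.le_def, Finset.mem_Ico] at hj ⊢
      exact ⟨by omega, hj.2⟩
    · intro i _ j _ hij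
      exact Fin.ext hij
    · intro y hy
      simp only [positions, Finset.mem_filter, Finset.mem_Icc, Fin.le_def, Finset.mem_Ico] at hy ⊢
      have hsn := q.snd.is_lt
      exact ⟨⟨y, by omega⟩, ⟨by simp only; omega, hy.2⟩, rfl⟩
  refine ⟨hmem, ?_, ?_⟩
  · have : ((positions q).filter fun j => S j < S x).card ≤ F.card := by
      rw [hF]
      refine Finset.card_le_card fun j hj => ?_
      simp only [Finset.mem_filter] at hj ⊢
      refine ⟨hj.1, (sortedRank_lt_iff S j x).2 ?_⟩
      rw [Prod.Lex.toLex_lt_toLex]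
      exact Or.inl hj.2
    omega
  · have : (insert x F).card ≤ ((positions q).filter fun j => S j ≤ S x).card := by
      refine Finset.card_le_card fun j hj => ?_
      rw [Finset.mem_filter]
      rcases Finset.mem_insert.1 hj with rfl | hj
      · exact ⟨hmem, le_rfl⟩
      · rw [hF, Finset.mem_filter, sortedRank_lt_iff, Prod.Lex.toLex_lt_toLex] at hj
        exact ⟨hj.1, hj.2.elim le_of_lt fun h => h.1.le⟩
    rw [Finset.card_insert_of_notMem (by simp [hF])] at this
    omega

end Keys

/-- The program takes `O((L + 1) * (n + k))` steps, and `L + 1 ≤ 6 * log (k + 1)`. The factor `log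
(n + 1)` at the term with `k` is not needed; it is bounded below by `1 / 2`, which costs a factor 2.
-/
theorem log_bound {n k : ℕ} (hn : 1 ≤ n) (hk : 1 ≤ k) :
    ((5000 * ((Nat.clog 2 k + 1) * (n + k)) : ℕ) : ℝ) ≤
      60000 * (n * Real.log (k + 1) + k * Real.log (k + 1) * Real.log (n + 1)) := by
  have hlog2 : (1 / 2 : ℝ) ≤ Real.log 2 := by
    have := Real.log_two_gt_d9
    linarith
  have hk' : (1 : ℝ) ≤ k := by exact_mod_cast hk
  have hn' : (1 : ℝ) ≤ n := by exact_mod_cast hn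
  have hlk : Real.log 2 ≤ Real.log (k + 1) := Real.log_le_log (by norm_num) (by linarith)
  have hln : Real.log 2 ≤ Real.log (n + 1) := Real.log_le_log (by norm_num) (by linarith)
  have hL : (Nat.clog 2 k : ℝ) * Real.log 2 ≤ 2 * Real.log (k + 1) := by
    rw [← Real.log_pow, ← Nat.cast_ofNat (n := 2), ← Real.log_pow]
    refine Real.log_le_log (by positivity) ?_
    have h : 2 ^ Nat.clog 2 k ≤ (k + 1) ^ 2 := (two_pow_clog_le hk).trans (by nlinarith)
    exact_mod_cast h
  obtain ⟨x, hx⟩ : ∃ x, x = Real.log (k + 1) := ⟨_, rfl⟩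
  obtain ⟨y, hy⟩ : ∃ y, y = Real.log (n + 1) := ⟨_, rfl⟩
  obtain ⟨c, hc⟩ : ∃ c : ℝ, c = Nat.clog 2 k := ⟨_, rfl⟩
  push_cast
  rw [← hx, ← hy, ← hc]
  rw [← hx] at hlk hL
  rw [← hy] at hln
  rw [← hc] at hL
  have hc0 : 0 ≤ c := hc ▸ Nat.cast_nonneg _
  have hx2 : 1 / 2 ≤ x := hlog2.trans hlk
  have hy2 : 1 / 2 ≤ y := hlog2.trans hln
  have hcx : c + 1 ≤ 6 * x := by nlinarith
  have h₁ : (c + 1) * (n + k) ≤ 6 * x * (n + k) := mul_le_mul_of_nonneg_right hcx (by positivity)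
  have h₂ : (k : ℝ) * x ≤ k * x * (2 * y) :=
    le_mul_of_one_le_right (by positivity) (by linarith)
  have h₃ : 0 ≤ (n : ℝ) * x := by positivity
  nlinarith

/-- The median program solves the range median problem within the claimed time. -/
theorem medianProgram_solvesWithin {n k : ℕ} (hn : 1 ≤ n) (hk : 1 ≤ k) (α : Type u) [LinearOrder α]
    (S : Fin n → α) (Q : Fin k → NonemptyInterval (Fin n)) :
    medianProgram.SolvesWithin ((n + k + 2) ^ 5) S Q
      (60000 * (n * Real.log (k + 1) + k * Real.log (k + 1) * Real.log (n + 1))) := by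
  -- The fifth power suffices because `n + k + 2 ≥ 4` and `4 ^ 4 ≥ 100`.
  have hW : 100 * (n + k + 2) ≤ (n + k + 2) ^ 5 := by
    rw [pow_succ]
    refine Nat.mul_le_mul_right _ ?_
    calc 100 ≤ 4 ^ 4 := by norm_num
      _ ≤ (n + k + 2) ^ 4 := Nat.pow_le_pow_left (by omega) 4
  obtain ⟨t, s', he, ht, hs'⟩ := medianProgram_spec hn hk (compares_sortedRank S) hW
    (s := initState Q) (l := fun j => if h : j < k then ((Q ⟨j, h⟩).fst : ℕ) else 0)
    (r := fun j => if h : j < k then ((Q ⟨j, h⟩).snd : ℕ) else 0)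
    (by simp [initState]) (by simp [initState]) (by simp [initState])
    (fun j hj => by simp [initState, hj]) (fun j hj => by simp [initState, hj])
    (fun j hj => by simpa [hj] using (Q ⟨j, hj⟩).fst_le_snd)
    (fun j hj => by simp [hj])
  refine ⟨t, s', he, le_trans (by exact_mod_cast ht) (log_bound hn hk), fun j => ?_⟩
  obtain ⟨h₁, h₂, h₃⟩ := hs' j j.is_lt
  simp only [j.is_lt, dif_pos, Fin.eta] at h₁ h₂ h₃
  have hsn := (Q j).snd.is_lt
  exact ⟨⟨s'.cell 2 j, by omega⟩, rfl, isMedian_of_cnt S (Q j) _ h₁ h₂ h₃⟩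

/-! ## Lower bound: leaves of decision trees -/

section Trees

variable {n k : ℕ}

/-- The outcomes of the comparisons on input `S`. -/
def CompTree.path (S : Fin n → ℕ) : CompTree n k → List Bool
  | .output _ => []
  | .compare i j yes no => if S i ≤ S j then true :: yes.path S else false :: no.path S

/-- The strict inequalities found on input `S`. -/
def CompTree.Found (S : Fin n → ℕ) : CompTree n k → Fin n → Fin n → Prop
  | .output _, _, _ => False
  | .compare i j yes no, a, b => (S i ≤ S j ∧ i ≠ j ∧ a = i ∧ b = j) ∨
      (¬S i ≤ S j ∧ a = j ∧ b = i) ∨ (S i ≤ S j ∧ yes.Found S a b) ∨ (¬S i ≤ S j ∧ no.Found S a b)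

theorem CompTree.Found.lt {S : Fin n → ℕ} (hS : Function.Injective S) {T : CompTree n k}
    {a b : Fin n} (h : T.Found S a b) : S a < S b := by
  induction T with
  | output x => exact h.elim
  | compare i j yes no ihy ihn =>
    rcases h with ⟨h, hne, rfl, rfl⟩ | ⟨h, rfl, rfl⟩ | ⟨-, h⟩ | ⟨-, h⟩
    · exact lt_of_le_of_ne h fun he => hne (hS he)
    · exact not_le.1 h
    · exact ihy h
    · exact ihn h

/-- An input that satisfies all inequalities found on `S` gets the same answers to the comparisons,
so it reaches the same leaf. -/
theorem CompTree.run_eq_of_found {S U : Fin n → ℕ} {T : CompTree n k}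
    (h : ∀ a b, T.Found S a b → U a < U b) : T.run U = T.run S := by
  induction T with
  | output x => rfl
  | compare i j yes no ihy ihn =>
    by_cases hle : S i ≤ S j
    · have hU : U i ≤ U j := by
        by_cases hij : i = j
        · rw [hij]
        · exact (h i j (Or.inl ⟨hle, hij, rfl, rfl⟩)).le
      simp only [CompTree.run, hle, hU, if_true]
      exact ihy fun a b hab => h a b (Or.inr (Or.inr (Or.inl ⟨hle, hab⟩)))
    · have hU : ¬U i ≤ U j := not_le.2 (h j i (Or.inr (Or.inl ⟨hle, rfl, rfl⟩)))
      simp only [CompTree.run, hle, hU, if_false]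
      exact ihn fun a b hab => h a b (Or.inr (Or.inr (Or.inr ⟨hle, hab⟩)))

theorem CompTree.eq_of_path_eq {S U : Fin n → ℕ} {T : CompTree n k} (h : T.path S = T.path U) :
    T.run S = T.run U ∧ ∀ a b, T.Found S a b ↔ T.Found U a b := by
  induction T with
  | output x => exact ⟨rfl, fun _ _ => Iff.rfl⟩
  | compare i j yes no ihy ihn =>
    by_cases hS : S i ≤ S j <;> by_cases hU : U i ≤ U j <;> simp [CompTree.path, hS, hU] at h
    · obtain ⟨h₁, h₂⟩ := ihy h
      exact ⟨by simp [CompTree.run, hS, hU, h₁], fun a b => by simp [CompTree.Found, hS, hU, h₂]⟩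
    · obtain ⟨h₁, h₂⟩ := ihn h
      exact ⟨by simp [CompTree.run, hS, hU, h₁], fun a b => by simp [CompTree.Found, hS, hU, h₂]⟩

/-- A decision tree of height `h` has at most `2 ^ h` leaves. -/
theorem CompTree.card_le_two_pow {ι : Type*} (T : CompTree n k) (G : ι → Fin n → ℕ) (h : ℕ)
    (I : Finset ι) (hI : ∀ a ∈ I, T.comparisons (G a) ≤ h)
    (hinj : Set.InjOn (fun a => T.path (G a)) I) : I.card ≤ 2 ^ h := by
  classical
  induction T generalizing h I with
  | output x =>
    refine le_trans (Finset.card_le_one.2 fun a ha b hb => hinj ha hb rfl) Nat.one_le_two_pow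
  | compare i j yes no ihy ihn =>
    rcases I.eq_empty_or_nonempty with rfl | ⟨a₀, ha₀⟩
    · simp
    have hpos : 1 ≤ h := by
      have := hI a₀ ha₀
      simp only [CompTree.comparisons] at this
      omega
    have h₁ := ihy (h - 1) (I.filter fun a => G a i ≤ G a j) (fun a ha => by
        rw [Finset.mem_filter] at ha
        have := hI a ha.1
        simp only [CompTree.comparisons, ha.2, if_true] at this
        omega) (fun a ha b hb hab => by
        simp only [Finset.coe_filter, Set.mem_ofPred_eq] at ha hb
        exact hinj ha.1 hb.1 (by simpa [CompTree.path, ha.2, hb.2] using hab))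
    have h₂ := ihn (h - 1) (I.filter fun a => ¬G a i ≤ G a j) (fun a ha => by
        rw [Finset.mem_filter] at ha
        have := hI a ha.1
        simp only [CompTree.comparisons, ha.2, if_false] at this
        omega) (fun a ha b hb hab => by
        simp only [Finset.coe_filter, Set.mem_ofPred_eq] at ha hb
        exact hinj ha.1 hb.1 (by simpa [CompTree.path, ha.2, hb.2] using hab))
    rw [← Finset.card_filter_add_card_filter_not (s := I) fun a => G a i ≤ G a j,
      show h = h - 1 + 1 by omega, pow_succ]
    omega

/-- Two incomparable elements of a partial order are adjacent in some linear extension. -/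
theorem exists_adjacent_extension {S : Fin n → ℕ} (hS : Function.Injective S)
    {R : Fin n → Fin n → Prop} (hR : ∀ a b c, R a b → R b c → R a c) (hRS : ∀ a b, R a b → S a < S b)
    {p q : Fin n} (hpq : ¬R p q) (hqp : ¬R q p) (hne : p ≠ q) :
    ∃ U : Fin n → ℕ, Function.Injective U ∧ (∀ a b, R a b → U a < U b) ∧ U p < U q ∧
      ∀ y, y ≠ p → y ≠ q → ((U y < U p ↔ R y p ∨ R y q) ∧ (U y < U q ↔ R y p ∨ R y q)) := by
  classical
  obtain ⟨M, hM⟩ : ∃ M, ∀ y, S y < M := ⟨Finset.univ.sup S + 1, fun y =>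
    Nat.lt_succ_of_le (Finset.le_sup (Finset.mem_univ y))⟩
  have hirr : ∀ a, ¬R a a := fun a h => (hRS a a h).false
  have hDp : ¬(R p p ∨ R p q) := by simp [hirr, hpq]
  have hDq : ¬(R q p ∨ R q q) := by simp [hirr, hqp]
  -- The elements below `p` or `q` come first, ordered as in `S`, then `p`, then `q`, then the rest,
  -- again ordered as in `S`. The first set is symmetric in `p` and `q`, so exchanging them changes
  -- nothing but their own order.
  let U : Fin n → ℕ := fun y =>
    if R y p ∨ R y q then S y else if y = p then M else if y = q then M + 1 else M + 2 + S y
  have hUD : ∀ y, R y p ∨ R y q → U y = S y := fun y h => if_pos h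
  have hUp : U p = M := by simp only [U, if_neg hDp, if_true]
  have hUq : U q = M + 1 := by simp only [U, if_neg hDq, if_neg hne.symm, if_true]
  have hUo : ∀ y, ¬(R y p ∨ R y q) → y ≠ p → y ≠ q → U y = M + 2 + S y := fun y h h₁ h₂ => by
    simp only [U, if_neg h, if_neg h₁, if_neg h₂]
  have hcase : ∀ y, (U y = S y ∧ (R y p ∨ R y q)) ∨ (y = p ∧ U y = M) ∨ (y = q ∧ U y = M + 1) ∨
      (U y = M + 2 + S y ∧ ¬(R y p ∨ R y q) ∧ y ≠ p ∧ y ≠ q) := by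
    intro y
    by_cases h : R y p ∨ R y q
    · exact Or.inl ⟨hUD y h, h⟩
    by_cases h₁ : y = p
    · exact Or.inr (Or.inl ⟨h₁, h₁ ▸ hUp⟩)
    by_cases h₂ : y = q
    · exact Or.inr (Or.inr (Or.inl ⟨h₂, h₂ ▸ hUq⟩))
    · exact Or.inr (Or.inr (Or.inr ⟨hUo y h h₁ h₂, h, h₁, h₂⟩))
  refine ⟨U, fun a b hab => ?_, fun a b hab => ?_, by omega, fun y h₁ h₂ => ?_⟩
  · have ha := hM a
    have hb := hM b
    rcases hcase a with ⟨ea, -⟩ | ⟨rfl, ea⟩ | ⟨rfl, ea⟩ | ⟨ea, -⟩ <;>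
      rcases hcase b with ⟨eb, -⟩ | ⟨rfl, eb⟩ | ⟨rfl, eb⟩ | ⟨eb, -⟩ <;>
      first | rfl | (exfalso; omega) | exact hS (by omega)
  · have ha := hM a
    have hb := hM b
    have hlt := hRS a b hab
    have hda : R b p ∨ R b q → R a p ∨ R a q := fun h => h.imp (hR _ _ _ hab) (hR _ _ _ hab)
    rcases hcase b with ⟨eb, db⟩ | ⟨rfl, eb⟩ | ⟨rfl, eb⟩ | ⟨eb, -⟩
    · rw [eb, hUD a (hda db)]
      exact hlt
    · rw [eb, hUD a (Or.inl hab)]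
      exact ha
    · rw [eb, hUD a (Or.inr hab)]
      omega
    · rcases hcase a with ⟨ea, -⟩ | ⟨-, ea⟩ | ⟨-, ea⟩ | ⟨ea, -⟩ <;> omega
  · have hy := hM y
    rcases hcase y with ⟨ey, dy⟩ | ⟨rfl, -⟩ | ⟨rfl, -⟩ | ⟨ey, dy, -⟩
    · simp only [dy, iff_true]
      omega
    · exact absurd rfl h₁
    · exact absurd rfl h₂
    · simp only [dy, iff_false]
      omega

/-- For distinct entries, "at most" adds only the median itself to "less than", so the two
inequalities determine the rank. -/
theorem IsMedian.card_lt {S : Fin n → ℕ} (hS : Function.Injective S)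
    {q : NonemptyInterval (Fin n)} {x : Fin n} (h : IsMedian S q x) :
    ((positions q).filter fun j => S j < S x).card + 1 = ((positions q).card + 1) / 2 := by
  obtain ⟨hx, h₁, h₂⟩ := h
  have : ((positions q).filter fun j => S j ≤ S x) =
      insert x ((positions q).filter fun j => S j < S x) := by
    ext j
    simp only [Finset.mem_filter, Finset.mem_insert, le_iff_lt_or_eq]
    constructor
    · rintro ⟨hj, h | h⟩
      · exact Or.inr ⟨hj, h⟩
      · exact Or.inl (hS h)
    · rintro (rfl | ⟨hj, h⟩)
      · exact ⟨hx, Or.inr rfl⟩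
      · exact ⟨hj, Or.inl h⟩
  rw [this, Finset.card_insert_of_notMem (by simp)] at h₂
  omega

/-- A tree that solves the problem determines, for each query, which elements are less than the
median. -/
theorem CompTree.Solves.not_lt_of_path_eq {T : CompTree n k} {Q : Fin k → NonemptyInterval (Fin n)}
    (hT : T.Solves Q) {S S' : Fin n → ℕ} (hS : Function.Injective S) (hS' : Function.Injective S')
    (hpath : T.path S = T.path S') (j : Fin k) {i : Fin n} (hi : i ∈ positions (Q j))
    (hlt : S i < S (T.run S j)) : ¬S' (T.run S j) < S' i := by
  intro hgt
  obtain ⟨x, hx⟩ : ∃ x, x = T.run S j := ⟨_, rfl⟩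
  rw [← hx] at hlt hgt
  obtain ⟨-, hfound⟩ := CompTree.eq_of_path_eq hpath
  -- The inequalities found depend on the path alone, so their transitive closure holds in both `S`
  -- and `S'`. As these disagree on `i` and `x`, the two are incomparable in it.
  have hRS : ∀ a b, Relation.TransGen (T.Found S) a b → S a < S b := by
    intro a b h
    induction h with
    | single h => exact h.lt hS
    | tail _ h ih => exact ih.trans (h.lt hS)
  have hRS' : ∀ a b, Relation.TransGen (T.Found S) a b → S' a < S' b := by
    intro a b h
    induction h with
    | single h => exact ((hfound _ _).1 h).lt hS'
    | tail _ h ih => exact ih.trans (((hfound _ _).1 h).lt hS')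
  have hix : ¬Relation.TransGen (T.Found S) i x := fun h => (hRS' _ _ h).asymm hgt
  have hxi : ¬Relation.TransGen (T.Found S) x i := fun h => (hRS _ _ h).asymm hlt
  have hne : i ≠ x := by
    rintro rfl
    exact hlt.false
  obtain ⟨U, hU, hUR, hUlt, hUD⟩ := exists_adjacent_extension hS
    (fun a b c => Relation.TransGen.trans) hRS hix hxi hne
  obtain ⟨V, hV, hVR, hVlt, hVD⟩ := exists_adjacent_extension hS
    (fun a b c => Relation.TransGen.trans) hRS hxi hix hne.symm
  have hmU := hT U hU j
  rw [CompTree.run_eq_of_found fun a b h => hUR a b (.single h), ← hx] at hmU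
  have hmV := hT V hV j
  rw [CompTree.run_eq_of_found fun a b h => hVR a b (.single h), ← hx] at hmV
  have hcU := hmU.card_lt hU
  have hcV := hmV.card_lt hV
  -- The same elements precede the adjacent pair `i`, `x` in both extensions, and only in `U` does
  -- `i` precede `x`. So `x` has two different ranks although it is the answer in both cases.
  have hset : ((positions (Q j)).filter fun y => U y < U x) =
      insert i ((positions (Q j)).filter fun y => V y < V x) := by
    ext y
    simp only [Finset.mem_filter, Finset.mem_insert]
    by_cases hyi : y = i
    · subst hyi
      simp [hi, hUlt]
    by_cases hyx : y = x
    · subst hyx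
      simp [hyi]
    · rw [(hUD y hyi hyx).2, (hVD y hyx hyi).1, or_comm (a := Relation.TransGen _ y x)]
      simp [hyi]
  rw [hset, Finset.card_insert_of_notMem (by simp [hVlt.le])] at hcU
  omega

/-- The answers agree on both inputs. The remaining case, that `i` is itself the median for `S'`, is
excluded since it would be the median for `S` too. -/
theorem CompTree.Solves.lt_iff_of_path_eq {T : CompTree n k} {Q : Fin k → NonemptyInterval (Fin n)}
    (hT : T.Solves Q) {S S' : Fin n → ℕ} (hS : Function.Injective S) (hS' : Function.Injective S')
    (hpath : T.path S = T.path S') (j : Fin k) {i : Fin n} (hi : i ∈ positions (Q j)) :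
    S i < S (T.run S j) ↔ S' i < S' (T.run S' j) := by
  have hrun := (CompTree.eq_of_path_eq hpath).1
  have key : ∀ {S S' : Fin n → ℕ}, Function.Injective S → Function.Injective S' →
      T.path S = T.path S' → T.run S = T.run S' → S i < S (T.run S j) →
      S' i < S' (T.run S' j) := by
    intro S S' hS hS' hp hr h
    rw [← hr]
    refine lt_of_le_of_ne (not_lt.1 (hT.not_lt_of_path_eq hS hS' hp j hi h)) fun he => ?_
    rw [← hS' he] at h
    exact h.false
  exact ⟨key hS hS' hpath hrun, key hS' hS hpath.symm hrun.symm⟩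

/-! ## Lower bound: suffix queries -/

/-- There are `k` distinct suffixes of the array among which are all those that start in `E`. -/
theorem exists_suffix_queries (hn : 0 < n) (hk : k ≤ n) (E : Finset (Fin n)) (hE : E.card ≤ k) :
    ∃ Q : Fin k → NonemptyInterval (Fin n), Function.Injective Q ∧ Hierarchical Q ∧
      ∀ e ∈ E, ∃ j, ∀ i, i ∈ positions (Q j) ↔ e ≤ i := by
  obtain ⟨U, hEU, hU⟩ := Finset.exists_superset_card_eq hE (by simpa using hk)
  let last : Fin n := ⟨n - 1, by omega⟩
  have hlast : ∀ i : Fin n, i ≤ last := fun i => by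
    simp only [Fin.le_def, last]
    omega
  let Q : Fin k → NonemptyInterval (Fin n) := fun j => ⟨(U.orderEmbOfFin hU j, last), hlast _⟩
  have hQ : ∀ j i, i ∈ positions (Q j) ↔ U.orderEmbOfFin hU j ≤ i := fun j i => by
    simp [positions, Q, hlast]
  refine ⟨Q, fun i j hij => ?_, fun i j => ?_, fun e he => ?_⟩
  · have : U.orderEmbOfFin hU i = U.orderEmbOfFin hU j := congrArg (fun q => q.fst) hij
    exact (U.orderEmbOfFin hU).injective this
  · rcases le_total (U.orderEmbOfFin hU i) (U.orderEmbOfFin hU j) with h | h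
    · exact Or.inr (Or.inl fun x hx => (hQ i x).2 (h.trans ((hQ j x).1 hx)))
    · exact Or.inl fun x hx => (hQ j x).2 (h.trans ((hQ i x).1 hx))
  · have : e ∈ Set.range (U.orderEmbOfFin hU) := by
      rw [Finset.range_orderEmbOfFin]
      exact hEU he
    obtain ⟨j, rfl⟩ := this
    exact ⟨j, hQ j⟩

end Trees

/-! ## Lower bound: hard inputs -/

section HardInputs

variable {n k : ℕ}

/-- An input whose suffix of length `2 * y` consists of `y` medium entries, arranged by `σ`, and
`y` large entries. -/
def hardInput (n y : ℕ) (σ : ℕ → ℕ) (p : Fin n) : ℕ :=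
  if (p : ℕ) < n - 2 * y then p
  else if (p : ℕ) < n - y then n + σ (p - (n - 2 * y)) else 2 * n + p

theorem hardInput_cases {y : ℕ} (σ : ℕ → ℕ) (p : Fin n) :
    ((p : ℕ) < n - 2 * y ∧ hardInput n y σ p = p) ∨
    (n - 2 * y ≤ (p : ℕ) ∧ (p : ℕ) < n - y ∧ hardInput n y σ p = n + σ (p - (n - 2 * y))) ∨
    (n - y ≤ (p : ℕ) ∧ hardInput n y σ p = 2 * n + p) := by
  unfold hardInput
  split_ifs <;> omega

theorem hardInput_injective {y : ℕ} (hy : 2 * y ≤ n) {σ : ℕ → ℕ} (hσ : ∀ z < y, σ z < y)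
    (hinj : Set.InjOn σ (Set.Iio y)) : Function.Injective (hardInput n y σ) := by
  intro p q h
  have hp := p.is_lt
  have hq := q.is_lt
  have hp' := hσ (p - (n - 2 * y))
  have hq' := hσ (q - (n - 2 * y))
  apply Fin.ext
  rcases hardInput_cases (y := y) σ p with h₁ | h₁ | h₁ <;>
    rcases hardInput_cases (y := y) σ q with h₂ | h₂ | h₂ <;> try omega
  have := hinj (show (p : ℕ) - (n - 2 * y) < y by omega)
    (show (q : ℕ) - (n - 2 * y) < y by omega) (by omega)
  omega

/-- The medians of suffixes of a hard input are medium entries. -/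
theorem hardInput_median {y r : ℕ} (hy : 4 * y ≤ n) (hr : r < y) {σ : ℕ → ℕ}
    (hσ : ∀ z < y, σ z < y) (hinj : Set.InjOn σ (Set.Iio y)) {e : Fin n}
    (he : (e : ℕ) = n + 1 + 2 * r - 4 * y) {q : NonemptyInterval (Fin n)}
    (hq : ∀ i, i ∈ positions q ↔ e ≤ i) {x : Fin n} (hx : IsMedian (hardInput n y σ) q x) :
    hardInput n y σ x = n + r := by
  have hS := hardInput_injective (n := n) (by omega) hσ hinj
  obtain ⟨S, hSdef⟩ : ∃ S, S = hardInput n y σ := ⟨_, rfl⟩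
  have hcases : ∀ p, _ := fun p => hSdef ▸ hardInput_cases (n := n) (y := y) σ p
  rw [← hSdef] at hx hS ⊢
  have hxq := hx.1
  have hcard : (positions q).card = n - e := by
    have : positions q = Finset.Ici e := by
      ext i
      rw [hq, Finset.mem_Ici]
    rw [this, Fin.card_Ici]
  have hless := hx.card_lt hS
  obtain ⟨z, hz, hzr⟩ := exists_of_injOn hσ hinj hr
  -- The suffix has `4 * y - 1 - 2 * r` entries, so its median has `2 * y - 1 - r` smaller ones: the
  -- `2 * y - 1 - 2 * r` small entries of the suffix and `r` medium ones.
  have hcount : ((positions q).filter fun i => S i < n + r).card = 2 * y - 1 - r := by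
    have himage : ((positions q).filter fun i => S i < n + r).image S =
        Finset.Ico (e : ℕ) (n - 2 * y) ∪ Finset.Ico n (n + r) := by
      ext v
      simp only [Finset.mem_image, Finset.mem_filter, Finset.mem_union, Finset.mem_Ico, hq,
        Fin.le_def]
      constructor
      · rintro ⟨p, ⟨hp₁, hp₂⟩, rfl⟩
        have := hcases p
        omega
      · rintro (⟨h₁, h₂⟩ | ⟨h₁, h₂⟩)
        · have := hcases ⟨v, by omega⟩
          simp only at this
          exact ⟨⟨v, by omega⟩, ⟨h₁, by omega⟩, by omega⟩
        · obtain ⟨c, hc, hcv⟩ := exists_of_injOn hσ hinj (show v - n < y by omega)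
          have := hcases ⟨n - 2 * y + c, by omega⟩
          simp only [show n - 2 * y + c - (n - 2 * y) = c by omega] at this
          exact ⟨⟨n - 2 * y + c, by omega⟩, ⟨by simp only; omega, by omega⟩, by omega⟩
    rw [← Finset.card_image_of_injective _ hS, himage, Finset.card_union_of_disjoint]
    · simp only [Nat.card_Ico]
      omega
    · rw [Finset.disjoint_left]
      intro v h₁ h₂
      simp only [Finset.mem_Ico] at h₁ h₂
      omega
  rcases lt_trichotomy (S x) (n + r) with h | h | h
  · have : ((positions q).filter fun i => S i < S x).card <
        ((positions q).filter fun i => S i < n + r).card := by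
      refine Finset.card_lt_card (Finset.ssubset_iff.2 ⟨x, by simp, fun i hi => ?_⟩)
      rcases Finset.mem_insert.1 hi with rfl | hi
      · exact Finset.mem_filter.2 ⟨hxq, h⟩
      · rw [Finset.mem_filter] at hi ⊢
        exact ⟨hi.1, hi.2.trans h⟩
    omega
  · exact h
  · have hm := hcases ⟨n - 2 * y + z, by omega⟩
    simp only [show n - 2 * y + z - (n - 2 * y) = z by omega] at hm
    have : ((positions q).filter fun i => S i < n + r).card <
        ((positions q).filter fun i => S i < S x).card := by
      refine Finset.card_lt_card (Finset.ssubset_iff.2 ⟨⟨n - 2 * y + z, by omega⟩, ?_, ?_⟩)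
      · rw [Finset.mem_filter]
        omega
      · intro i hi
        rcases Finset.mem_insert.1 hi with rfl | hi
        · rw [Finset.mem_filter, hq, Fin.le_def]
          simp only
          omega
        · rw [Finset.mem_filter] at hi ⊢
          exact ⟨hi.1, hi.2.trans h⟩
    omega

/-- The permutation of `s * κ` elements, arranged in `s` rows, in which row `i` has the values that
are `i` modulo `s`, in the order given by `π i`. -/
def rowPerm {s κ : ℕ} (π : Fin s → Equiv.Perm (Fin κ)) (z : ℕ) : ℕ :=
  if h : z / κ < s ∧ z % κ < κ then (π ⟨z / κ, h.1⟩ ⟨z % κ, h.2⟩ : ℕ) * s + z / κ else 0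

theorem rowPerm_apply {s κ : ℕ} (π : Fin s → Equiv.Perm (Fin κ)) (i : Fin s) (c : Fin κ) :
    rowPerm π (κ * i + c) = (π i c : ℕ) * s + i := by
  have h₁ : (κ * i + c) / κ = i := by
    rw [Nat.mul_add_div (by have := c.is_lt; omega), Nat.div_eq_of_lt c.is_lt, add_zero]
  have h₂ : (κ * i + c) % κ = c := by
    rw [Nat.mul_add_mod, Nat.mod_eq_of_lt c.is_lt]
  simp only [rowPerm, h₁, h₂, i.is_lt, c.is_lt, and_self, dif_pos, Fin.eta]

theorem exists_row_col {s κ z : ℕ} (hz : z < s * κ) : ∃ (i : Fin s) (c : Fin κ), z = κ * i + c := by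
  have hκ : 0 < κ := Nat.pos_of_ne_zero (by rintro rfl; simp at hz)
  exact ⟨⟨z / κ, (Nat.div_lt_iff_lt_mul hκ).2 hz⟩, ⟨z % κ, Nat.mod_lt _ hκ⟩,
    (Nat.div_add_mod z κ).symm⟩

theorem mul_add_lt_mul_iff {s a b i : ℕ} (hi : i < s) : a * s + i < b * s ↔ a < b := by
  constructor
  · intro h
    by_contra hc
    have := Nat.mul_le_mul_right s (not_lt.1 hc)
    omega
  · intro h
    have := Nat.mul_le_mul_right s h
    rw [Nat.succ_mul] at this
    omega

theorem rowPerm_lt {s κ : ℕ} (π : Fin s → Equiv.Perm (Fin κ)) : ∀ z < s * κ, rowPerm π z < s * κ := by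
  intro z hz
  obtain ⟨i, c, rfl⟩ := exists_row_col hz
  rw [rowPerm_apply, mul_comm s κ, mul_add_lt_mul_iff i.is_lt]
  exact (π i c).is_lt

theorem rowPerm_injOn {s κ : ℕ} (π : Fin s → Equiv.Perm (Fin κ)) :
    Set.InjOn (rowPerm π) (Set.Iio (s * κ)) := by
  intro z hz z' hz' h
  obtain ⟨i, c, rfl⟩ := exists_row_col hz
  obtain ⟨i', c', rfl⟩ := exists_row_col hz'
  rw [rowPerm_apply, rowPerm_apply] at h
  have hs : 0 < s := by have := i.is_lt; omega
  have h₁ := congrArg (· % s) h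
  simp only [Nat.mul_add_mod', Nat.mod_eq_of_lt i.is_lt,
    Nat.mod_eq_of_lt i'.is_lt] at h₁
  have hi : i = i' := Fin.ext h₁
  subst hi
  have h₂ : (π i c : ℕ) = π i c' := Nat.eq_of_mul_eq_mul_right hs (by omega)
  rw [(π i).injective (Fin.ext h₂)]

/-- The factors of two copies of the factorial are paired in opposite order; each product `(i + 1) *
(m - i)` is at least `m`. -/
theorem pow_self_le_factorial_sq (m : ℕ) : m ^ m ≤ m.factorial ^ 2 := by
  have h₁ : ∏ i ∈ Finset.range m, (i + 1) = m.factorial := Finset.prod_range_add_one_eq_factorial m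
  have h₂ : ∏ i ∈ Finset.range m, (m - 1 - i + 1) = m.factorial := by
    rw [← h₁]
    exact Finset.prod_range_reflect (fun i => i + 1) m
  calc m ^ m = ∏ _i ∈ Finset.range m, m := by simp
    _ ≤ ∏ i ∈ Finset.range m, ((i + 1) * (m - 1 - i + 1)) := by
      refine Finset.prod_le_prod' fun i hi => ?_
      obtain ⟨d, rfl⟩ : ∃ d, m = i + 1 + d := ⟨m - (i + 1), by
        have := Finset.mem_range.1 hi
        omega⟩
      rw [show i + 1 + d - 1 - i + 1 = d + 1 by omega]
      nlinarith
    _ = m.factorial ^ 2 := by rw [Finset.prod_mul_distrib, h₁, h₂, sq]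

/-- The medium ranks are divided into `κ` classes of `s` consecutive ranks. In the inputs given by
`rowPerm`, every row has exactly one value in each class, so the classes of its entries reveal its
permutation. Different inputs therefore have different paths. -/
theorem exists_hard_queries {s κ : ℕ} (hs : 1 ≤ s) (hκ : 2 ≤ κ) (hκk : κ ≤ k) (hk : k ≤ n)
    (hn : 4 * (s * κ) ≤ n) :
    ∃ Q : Fin k → NonemptyInterval (Fin n), Function.Injective Q ∧ Hierarchical Q ∧
      ∀ T : CompTree n k, T.Solves Q → ∃ S : Fin n → ℕ, Function.Injective S ∧
        κ.factorial ^ s ≤ 2 ^ T.comparisons S := by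
  have hy : 0 < s * κ := by positivity
  have hjs : ∀ j < κ, j * s < s * κ := fun j hj => by
    rw [mul_comm s κ]
    exact Nat.mul_lt_mul_of_pos_right hj hs
  -- By `hardInput_median`, the suffix that starts here has as its median the medium entry of rank
  -- `(j + 1) * s`, counted from 0, on every hard input.
  let E : Finset (Fin n) := (Finset.univ : Finset (Fin (κ - 1))).image fun j : Fin (κ - 1) =>
    (⟨n + 1 + 2 * ((j + 1) * s) - 4 * (s * κ), by
      have := hjs (j + 1) (by omega)
      omega⟩ : Fin n)
  have hE : E.card ≤ k := Finset.card_image_le.trans (by simp; omega)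
  obtain ⟨Q, hQ, hQh, hQE⟩ := exists_suffix_queries (by omega) hk E hE
  refine ⟨Q, hQ, hQh, fun T hT => ?_⟩
  let G : (Fin s → Equiv.Perm (Fin κ)) → Fin n → ℕ := fun π => hardInput n (s * κ) (rowPerm π)
  have hG : ∀ π, Function.Injective (G π) := fun π =>
    hardInput_injective (by omega) (rowPerm_lt π) (rowPerm_injOn π)
  have hinj : Function.Injective fun π => T.path (G π) := by
    intro π π' hpath
    funext i
    ext c
    -- The entry in row `i` and column `c` has rank `π i c * s + i` with `i < s`. It is below the
    -- rank `j * s` of the median iff `π i c < j`.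
    have key : ∀ j, 1 ≤ j → j < κ → ((π i c : ℕ) < j ↔ (π' i c : ℕ) < j) := by
      intro j hj₁ hj₂
      have hjs' := hjs j hj₂
      have hmem : (⟨n + 1 + 2 * (j * s) - 4 * (s * κ), by omega⟩ : Fin n) ∈ E := by
        refine Finset.mem_image.2 ⟨⟨j - 1, by omega⟩, Finset.mem_univ _, ?_⟩
        simp only [Nat.sub_add_cancel hj₁]
      obtain ⟨a, ha⟩ := hQE _ hmem
      have hz : κ * i + c < s * κ := by
        have := Nat.mul_le_mul_left κ i.is_lt
        rw [Nat.mul_succ] at this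
        have := c.is_lt
        rw [mul_comm s κ]
        omega
      have hp : n - 2 * (s * κ) + (κ * i + c) < n := by omega
      have hval : ∀ π, G π ⟨n - 2 * (s * κ) + (κ * i + c), hp⟩ = n + ((π i c : ℕ) * s + i) := by
        intro π
        simp only [G, hardInput]
        rw [if_neg (by omega), if_pos (by omega), Nat.add_sub_cancel_left, rowPerm_apply]
      have hmed : ∀ π, G π (T.run (G π) a) = n + j * s := fun π =>
        hardInput_median hn hjs' (rowPerm_lt π) (rowPerm_injOn π) rfl ha (hT _ (hG π) a)
      have := hT.lt_iff_of_path_eq (hG π) (hG π') hpath a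
        (i := ⟨n - 2 * (s * κ) + (κ * i + c), hp⟩) ((ha _).2 (by
          simp only [Fin.le_def]
          omega))
      rw [hval, hval, hmed, hmed, Nat.add_lt_add_iff_left, Nat.add_lt_add_iff_left,
        mul_add_lt_mul_iff i.is_lt, mul_add_lt_mul_iff i.is_lt] at this
      exact this
    have h₁ := (π i c).is_lt
    have h₂ := (π' i c).is_lt
    by_contra hne
    rcases lt_or_gt_of_ne hne with h | h
    · have := (key (π' i c) (by omega) h₂).1 h
      omega
    · have := (key (π i c) (by omega) h₁).2 h
      omega
  obtain ⟨π, -, hπ⟩ := Finset.exists_max_image (Finset.univ : Finset (Fin s → Equiv.Perm (Fin κ)))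
    (fun π => T.comparisons (G π)) ⟨1, Finset.mem_univ _⟩
  refine ⟨G π, hG π, ?_⟩
  have := T.card_le_two_pow G _ Finset.univ hπ hinj.injOn
  simpa [Fintype.card_perm] using this

/-- For `n < 8` there is no room for two classes, and one comparison is enough. The median of the
last two entries is their minimum, which no fixed answer gives on both an increasing and a
decreasing array. -/
theorem exists_comparisons_pos (hn : 2 ≤ n) (hk : 2 ≤ k) (hkn : k ≤ n) :
    ∃ Q : Fin k → NonemptyInterval (Fin n), Function.Injective Q ∧ Hierarchical Q ∧
      ∀ T : CompTree n k, T.Solves Q → ∃ S : Fin n → ℕ, Function.Injective S ∧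
        1 ≤ T.comparisons S := by
  obtain ⟨Q, hQ, hQh, hQE⟩ := exists_suffix_queries (by omega) hkn {⟨n - 2, by omega⟩}
    (by simp; omega)
  refine ⟨Q, hQ, hQh, fun T hT => ⟨fun i => i, Fin.val_injective, ?_⟩⟩
  obtain ⟨j, hj⟩ := hQE _ (Finset.mem_singleton_self _)
  cases T with
  | compare => simp [CompTree.comparisons]
  | output x =>
    exfalso
    have hcard : (positions (Q j)).card = 2 := by
      have : positions (Q j) = Finset.Ici ⟨n - 2, by omega⟩ := by
        ext i
        rw [hj, Finset.mem_Ici]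
      rw [this, Fin.card_Ici]
      simp only
      omega
    have hmin : ∀ S : Fin n → ℕ, Function.Injective S → ∀ i ∈ positions (Q j), ¬S i < S (x j) := by
      intro S hS i hi hlt
      have h := (hT S hS j).card_lt hS
      rw [hcard] at h
      have : ((positions (Q j)).filter fun l => S l < S (x j)) = ∅ :=
        Finset.card_eq_zero.1 (Nat.succ.inj h)
      exact Finset.notMem_empty i (this ▸ Finset.mem_filter.2 ⟨hi, hlt⟩)
    have h₁ := hmin (fun i => i) Fin.val_injective ⟨n - 2, by omega⟩ ((hj _).2 le_rfl)
    have h₂ := hmin (fun i => n - i) (fun a b h => Fin.ext (by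
      have ha := a.is_lt
      have hb := b.is_lt
      simp only at h
      omega)) ⟨n - 1, by omega⟩ ((hj _).2 (by simp only [Fin.le_def]; omega))
    have := (x j).is_lt
    simp only at h₁ h₂
    omega

/-- The hard inputs give a height of at least `s * κ * log κ / 2`. With `n ≤ 8 * (s * κ)` and `log k
≤ 4 * log κ` this is at least `n * log k / 64`. For `n < 8` one comparison suffices, as `n * log k ≤
7 * 6`. -/
theorem exists_queries_lower_bound (hk : 2 ≤ k) (hkn : k ≤ n) :
    ∃ Q : Fin k → NonemptyInterval (Fin n), Function.Injective Q ∧ Hierarchical Q ∧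
      ∀ T : CompTree n k, T.Solves Q → ∃ S : Fin n → ℕ, Function.Injective S ∧
        (1 / 200 : ℝ) * (n * Real.log k) ≤ T.comparisons S := by
  have hk0 : (0 : ℝ) < k := by exact_mod_cast (by omega : 0 < k)
  have hkn' : (k : ℝ) ≤ n := by exact_mod_cast hkn
  have hlogk : 0 ≤ Real.log k := Real.log_nonneg (by exact_mod_cast (by omega : 1 ≤ k))
  rcases Nat.lt_or_ge n 8 with hn | hn
  · obtain ⟨Q, hQ, hQh, h⟩ := exists_comparisons_pos (by omega) hk hkn
    refine ⟨Q, hQ, hQh, fun T hT => ?_⟩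
    obtain ⟨S, hS, hc⟩ := h T hT
    refine ⟨S, hS, ?_⟩
    have hc' : (1 : ℝ) ≤ T.comparisons S := by exact_mod_cast hc
    have hn' : (n : ℝ) ≤ 7 := by exact_mod_cast (by omega : n ≤ 7)
    have hlog := Real.log_le_sub_one_of_pos hk0
    nlinarith
  -- At most a quarter of the entries can be medium, so the number of classes is capped at `n / 4`.
  · obtain ⟨κ, hκ⟩ : ∃ κ, κ = min k (n / 4) := ⟨_, rfl⟩
    have hκ2 : 2 ≤ κ := by omega
    obtain ⟨s, hs⟩ : ∃ s, s = (n / 4) / κ := ⟨_, rfl⟩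
    have hs1 : 1 ≤ s := hs ▸ (Nat.one_le_div_iff (by omega)).2 (by omega)
    have hdm := Nat.div_add_mod (n / 4) κ
    have hmod := Nat.mod_lt (n / 4) (show 0 < κ by omega)
    rw [← hs, mul_comm] at hdm
    have hsκ : κ ≤ s * κ := Nat.le_mul_of_pos_left _ hs1
    obtain ⟨Q, hQ, hQh, h⟩ := exists_hard_queries (n := n) (k := k) hs1 hκ2 (by omega) hkn
      (by omega)
    refine ⟨Q, hQ, hQh, fun T hT => ?_⟩
    obtain ⟨S, hS, hc⟩ := h T hT
    refine ⟨S, hS, ?_⟩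
    have hfact : κ ^ (s * κ) ≤ 2 ^ (2 * T.comparisons S) := by
      calc κ ^ (s * κ) = (κ ^ κ) ^ s := by rw [← pow_mul, mul_comm]
        _ ≤ (κ.factorial ^ 2) ^ s := Nat.pow_le_pow_left (pow_self_le_factorial_sq κ) s
        _ = (κ.factorial ^ s) ^ 2 := by rw [← pow_mul, ← pow_mul, mul_comm]
        _ ≤ (2 ^ T.comparisons S) ^ 2 := Nat.pow_le_pow_left hc 2
        _ = 2 ^ (2 * T.comparisons S) := by rw [← pow_mul, mul_comm]
    have hκ0 : (0 : ℝ) < κ := by exact_mod_cast (by omega : 0 < κ)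
    have hlog : ((s * κ : ℕ) : ℝ) * Real.log κ ≤ (2 * T.comparisons S : ℕ) * Real.log 2 := by
      rw [← Real.log_pow, ← Real.log_pow]
      exact Real.log_le_log (by positivity) (by exact_mod_cast hfact)
    -- If the cap is active, then `k ≤ n ≤ 4 * κ + 3 ≤ 8 * κ`, and `8 ≤ κ ^ 3`.
    have hkκ : k ≤ κ ^ 4 := by
      rcases Nat.le_total k (n / 4) with h' | h'
      · rw [hκ, min_eq_left h']
        exact Nat.le_self_pow (by omega) k
      · have : n ≤ 4 * κ + 3 := by omega
        have h3 : 8 ≤ κ ^ 3 := Nat.pow_le_pow_left hκ2 3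
        rw [pow_succ]
        nlinarith
    have hlogκ : Real.log k ≤ 4 * Real.log κ := by
      have : Real.log k ≤ Real.log ((κ : ℝ) ^ 4) :=
        Real.log_le_log hk0 (by exact_mod_cast hkκ)
      rwa [Real.log_pow] at this
    have hny : (n : ℝ) ≤ 8 * (s * κ : ℕ) := by exact_mod_cast (by omega : n ≤ 8 * (s * κ))
    have hl2 : Real.log 2 ≤ 1 := by
      have := Real.log_two_lt_d9
      linarith
    have hκl : 0 ≤ Real.log κ := by linarith
    have hcmp : (0 : ℝ) ≤ (2 * T.comparisons S : ℕ) := Nat.cast_nonneg _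
    have h₁ : (n : ℝ) * Real.log k ≤ 8 * (s * κ : ℕ) * (4 * Real.log κ) :=
      mul_le_mul hny hlogκ hlogk (by positivity)
    have h₂ : ((2 * T.comparisons S : ℕ) : ℝ) * Real.log 2 ≤ (2 * T.comparisons S : ℕ) :=
      mul_le_of_le_one_right hcmp hl2
    have h₃ : ((2 * T.comparisons S : ℕ) : ℝ) = 2 * T.comparisons S := by push_cast; ring
    have h₄ : (0 : ℝ) ≤ T.comparisons S := Nat.cast_nonneg _
    nlinarith

end HardInputs
end RangeMedians

theorem theorem1 :
    (∃ (P : RangeMedians.Program) (C : ℝ) (d : ℕ), ∀ n k : ℕ, 1 ≤ n → 1 ≤ k →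
      ∀ (α : Type u) [LinearOrder α] (S : Fin n → α) (Q : Fin k → NonemptyInterval (Fin n)),
        P.SolvesWithin ((n + k + 2) ^ d) S Q
          (C * (n * Real.log (k + 1) + k * Real.log (k + 1) * Real.log (n + 1)))) ∧
    (∃ c : ℝ, 0 < c ∧ ∀ n k : ℕ, 2 ≤ k → k ≤ n →
      ∃ Q : Fin k → NonemptyInterval (Fin n),
        Function.Injective Q ∧ RangeMedians.Hierarchical Q ∧
        ∀ T : RangeMedians.CompTree n k, T.Solves Q →
          ∃ S : Fin n → ℕ, Function.Injective S ∧
            c * (n * Real.log k) ≤ (T.comparisons S : ℝ)) :=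
  ⟨⟨RangeMedians.medianProgram, 60000, 5, fun _ _ hn hk α _ S Q =>
      RangeMedians.medianProgram_solvesWithin hn hk α S Q⟩,
    1 / 200, by norm_num, fun _ _ hk hkn => RangeMedians.exists_queries_lower_bound hk hkn⟩
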